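/- Let $\mathcal S,\mathcal X,\mathcal Y$ be finite alphabets, let $p(s)$ be a distribution on $\mathcal S$ (the law of an i.i.d. source), let $p(y|x)$ be a memoryless reference channel from $\mathcal X$ to $\mathcal Y$, and let $d_e:\mathcal S\times\mathcal X\to[0,\infty)$ and $d_r:\mathcal S\times\mathcal S\to[0,\infty)$ be the encoding and reconstruction distortion measures. An authentication scheme of block length $n$ consists of a key length $k$, an encoder that maps the source block $S^n$ and a key $\theta\in\{0,1\}^k$ to a channel input $X^n\in\mathcal X^n$ together with an authentic reconstruction $\hat S^n\in\mathcal S^n$, and a decoder $\Phi$ that maps a channel output $Y^n\in\mathcal Y^n$ and $\theta$ to $\mathcal S^n\cup\{\varnothing\}$. Encoder and decoder may be randomized. The key is uniform and independent of the source, it is unknown to the channel, and $\hat S^n$ is not affected by the channel, so that $\hat S^n\leftrightarrow(S^n,X^n)\leftrightarrow Y^n$. Consider the events \[ \mathcal E_{sa}=\{\Phi\ne\varnothing,\ \Phi\ne\hat S^n\},\qquad \mathcal E_{e}=\Big\{\tfrac1n\sum_{i=1}^n d_e(S_i,X_i)>D_e+\epsilon\Big\},\qquad \mathcal E_{r}=\{\Phi=\varnothing\}\cup\Big\{\Phi\neq\varnothing,\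 \tfrac1n\sum_{i=1}^n d_r(S_i,\Phi_i)>D_r+\epsilon\Big\}. \] The achievable distortion region is the closure in $\mathbb R^2$ of the set of pairs $(D_e,D_r)$ for which there is a sequence of schemes, indexed by $n$, such that $\Pr[\mathcal E_{sa}]\to0$ as $n\to\infty$ for every sequence of channels $p(y^n|x^n)$ in effect, and such that, for every $\epsilon>0$, $\Pr[\mathcal E_{e}]\to0$ and $\Pr[\mathcal E_{r}]\to0$ when the reference channel is in effect. Theorem. A pair $(D_e,D_r)$ lies in the achievable distortion region if and only if there exist a finite alphabet $\mathcal U$, functions $f:\mathcal U\times\mathcal S\to\mathcal X$ and $g:\mathcal U\to\mathcal S$, and a distribution $p(y,x,u,s)=p(s)\,p(u|s)\,p(x|u,s)\,p(y|x)$ with $p(x|u,s)=1_{x=f(u,s)}$, such that \[ I(U;Y)-I(S;U)\ge 0,\qquad E[d_e(S,f(U,S))]\le D_e,\qquad E[d_r(S,g(U))]\le D_r . \] The alphabet $\mathcal U$ can be required to satisfy $|\mathcal U|\le(|\mathcal S|+|\mathcal X|+3)\,|\mathcal S|\,|\mathcal X|$ without changing the condition. If instead $p(x|u,s)$ is allowed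 to be an arbitrary conditional distribution (with $E[d_e(S,X)]\le D_e$ in place of $E[d_e(S,f(U,S))]\le D_e$), the condition is again equivalent, and then $\mathcal U$ can be required to satisfy $|\mathcal U|\le|\mathcal S|+|\mathcal X|+3$. -/

import Mathlib

open scoped NNReal

noncomputable section

namespace Authentication

open scoped Classical in
/-- The mutual information (in bits) of two finite-alphabet random variables with joint
probability mass function `p`. Pairs of probability `0` contribute `0`. -/
def mutualInfo {A B : Type*} [Fintype A] [Fintype B] (p : A → B → ℝ) : ℝ :=
  ∑ a, ∑ b, p a b * Real.logb 2 (p a b / ((∑ b', p a b') * (∑ a', p a' b)))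

/-- An instance of the authentication problem. Probability distributions on a finite alphabet `A`
are the elements of `stdSimplex ℝ A`. The three finite alphabets are the parameters. -/
structure Problem (S X Y : Type*) [Fintype S] [Fintype X] [Fintype Y] where
  /-- the law `p(s)` of one source letter -/
  source : stdSimplex ℝ S
  /-- the single-letter reference channel `p(y|x)` -/
  channel : X → stdSimplex ℝ Y
  /-- the encoding distortion measure -/
  de : S → X → ℝ≥0
  /-- the reconstruction distortion measure -/
  dr : S → S → ℝ≥0

/-- An authentication scheme of block length `n`, with a secret key of `k` bits.
The encoder and the decoder may be randomized. The authentic reconstruction is determined by the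
encoder: it is a (possibly randomized) function of the source block, the key and the encoder
output, so that it is not affected by the realization of the channel. -/
structure Scheme (S X Y : Type*) [Fintype S] [Fintype X] [Fintype Y] (n : ℕ) where
  /-- number of bits of the secret key -/
  k : ℕ
  /-- the encoder: law of the channel input given the source block and the key -/
  encoder : (Fin n → S) → (Fin k → Bool) → stdSimplex ℝ (Fin n → X)
  /-- law of the authentic reconstruction given the source block, the key and the
  channel input -/
  authentic : (Fin n → S) → (Fin k → Bool) → (Fin n → X) → stdSimplex ℝ (Fin n → S)
  /-- the decoder: law of its output given the channel output and the key;
  `none` means that authentication is declared impossible -/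
  decoder : (Fin n → Y) → (Fin k → Bool) → stdSimplex ℝ (Option (Fin n → S))

section

variable {S X Y : Type*} [Fintype S] [Fintype X] [Fintype Y]

/-- An arbitrary channel (with arbitrary memory) acting on blocks of length `n`. -/
abbrev BlockChannel (X Y : Type*) [Fintype X] [Fintype Y] (n : ℕ) : Type _ :=
  (Fin n → X) → stdSimplex ℝ (Fin n → Y)

/-- The memoryless extension of the reference channel to blocks of length `n`. -/
def Problem.reference (P : Problem S X Y) (n : ℕ) : BlockChannel X Y n := fun x =>
  ⟨fun y => ∏ i, P.channel (x i) (y i),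
    fun _ => Finset.prod_nonneg fun i _ => (P.channel (x i)).2.1 _, by
      classical
      rw [← Fintype.piFinset_univ, Finset.sum_prod_piFinset]
      exact Finset.prod_eq_one fun i _ => (P.channel (x i)).2.2⟩

/-- The joint law of source block, key, channel input, authentic reconstruction, channel output and
decoder output when the channel `W` is in effect: the source is i.i.d., the key is uniform and
independent of the source, the channel sees only its input (in particular not the key), and the
decoder sees only the channel output and the key. -/
def Scheme.law (P : Problem S X Y) {n : ℕ} (A : Scheme S X Y n) (W : BlockChannel X Y n)
    (s : Fin n → S) (θ : Fin A.k → Bool) (x : Fin n → X) (r : Fin n → S) (y : Fin n → Y)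
    (φ : Option (Fin n → S)) : ℝ :=
  (∏ i, P.source (s i)) * (1 / 2 ^ A.k) * A.encoder s θ x * A.authentic s θ x r * W x y *
    A.decoder y θ φ

open scoped Classical in
/-- The probability of an event that is expressed through the source block `s`, the channel input
`x`, the authentic reconstruction `r`, the channel output `y` and the decoder output `φ`. -/
def Scheme.prob (P : Problem S X Y) {n : ℕ} (A : Scheme S X Y n) (W : BlockChannel X Y n)
    (E : (Fin n → S) → (Fin n → X) → (Fin n → S) → (Fin n → Y) → Option (Fin n → S) → Prop) : ℝ :=
  ∑ θ, ∑ s, ∑ x, ∑ r, ∑ y, ∑ φ, if E s x r y φ then A.law P W s θ x r y φ else 0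

/-- Every scheme produces an authentic reconstruction in the sense of the Markov condition
`r ↔ (s, x) ↔ y`: given the source block and the channel input, the authentic reconstruction and
the channel output are independent. -/
theorem Scheme.authentic_markov (P : Problem S X Y) {n : ℕ} (A : Scheme S X Y n)
    (W : BlockChannel X Y n) (a : Fin n → S) (b : Fin n → X) (c : Fin n → S) (d : Fin n → Y) :
    A.prob P W (fun s x r y _ => s = a ∧ x = b ∧ r = c ∧ y = d) *
        A.prob P W (fun s x _ _ _ => s = a ∧ x = b) =
      A.prob P W (fun s x r _ _ => s = a ∧ x = b ∧ r = c) *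
        A.prob P W (fun s x _ y _ => s = a ∧ x = b ∧ y = d) := by
  have h1 : ∀ y θ, ∑ φ, A.decoder y θ φ = 1 := fun y θ => (A.decoder y θ).2.2
  have h2 : ∑ y, W b y = 1 := (W b).2.2
  have h3 : ∀ θ, ∑ r, A.authentic a θ b r = 1 := fun θ => (A.authentic a θ b).2.2
  classical
  have h4 : ∀ (p q : Prop) (i : Decidable (p ∧ q)) (v : ℝ),
      @ite ℝ (p ∧ q) i v 0 = if p then if q then v else 0 else 0 := by
    intro p q i v
    by_cases hp : p <;> by_cases hq : q <;> simp [hp, hq]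
  simp only [Scheme.prob, Scheme.law]
  simp only [h4]
  simp only [Finset.sum_ite_irrel, Finset.sum_const_zero, Finset.sum_ite_eq', Finset.mem_univ,
    if_true, ← Finset.mul_sum, h1, h2, h3, mul_one, ← Finset.sum_mul]
  ring

/-- Successful attack: the decoder produces a reconstruction different from the authentic one. -/
def AttackEvent {n : ℕ} (_s : Fin n → S) (_x : Fin n → X) (r : Fin n → S) (_y : Fin n → Y)
    (φ : Option (Fin n → S)) : Prop :=
  φ ≠ none ∧ φ ≠ some r

/-- Excessive encoding distortion: the average encoding distortion exceeds `D`. -/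
def Problem.EncodingEvent (P : Problem S X Y) (D : ℝ) {n : ℕ} (s : Fin n → S) (x : Fin n → X)
    (_r : Fin n → S) (_y : Fin n → Y) (_φ : Option (Fin n → S)) : Prop :=
  (1 / (n : ℝ)) * ∑ i, (P.de (s i) (x i) : ℝ) > D

/-- Reconstruction failure: the decoder declares failure, or it produces a reconstruction whose
average distortion exceeds `D`. -/
def Problem.ReconstructionEvent (P : Problem S X Y) (D : ℝ) {n : ℕ} (s : Fin n → S)
    (_x : Fin n → X) (_r : Fin n → S) (_y : Fin n → Y) (φ : Option (Fin n → S)) : Prop :=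
  φ = none ∨ ∃ t, φ = some t ∧ (1 / (n : ℝ)) * ∑ i, (P.dr (s i) (t i) : ℝ) > D

open Filter Topology in
/-- There is a sequence of schemes for which the probability of a successful attack vanishes
whatever channels are in effect, and for every `ε > 0` the probabilities of exceeding
the distortions `De + ε` and `Dr + ε` vanish when the reference channel is in effect. -/
def Problem.Achieves (P : Problem S X Y) (De Dr : ℝ) : Prop :=
  ∃ A : (n : ℕ) → Scheme S X Y n,
    (∀ W : (n : ℕ) → BlockChannel X Y n,
      Tendsto (fun n => (A n).prob P (W n) AttackEvent) atTop (𝓝 0)) ∧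
    ∀ ε > 0,
      Tendsto (fun n => (A n).prob P (P.reference n) (P.EncodingEvent (De + ε))) atTop (𝓝 0) ∧
      Tendsto (fun n => (A n).prob P (P.reference n) (P.ReconstructionEvent (Dr + ε)))
        atTop (𝓝 0)

/-- The achievable distortion region. -/
def Problem.region (P : Problem S X Y) : Set (ℝ × ℝ) :=
  closure {D | P.Achieves D.1 D.2}

/-- The joint law `p(s) p(u|s) p(x|u,s) p(y|x)`. -/
def Problem.joint (P : Problem S X Y) {U : Type*} [Fintype U] (pU : S → stdSimplex ℝ U)
    (pX : U → S → stdSimplex ℝ X) (s : S) (u : U) (x : X) (y : Y) : ℝ :=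
  P.source s * pU s u * pX u s x * P.channel x y

/-- The mutual information `I(U;Y)` under the joint law above. -/
def Problem.infoUY (P : Problem S X Y) {U : Type*} [Fintype U] (pU : S → stdSimplex ℝ U)
    (pX : U → S → stdSimplex ℝ X) : ℝ :=
  mutualInfo fun u y => ∑ s, ∑ x, P.joint pU pX s u x y

/-- The mutual information `I(S;U)` under the joint law above. -/
def Problem.infoSU (P : Problem S X Y) {U : Type*} [Fintype U] (pU : S → stdSimplex ℝ U)
    (pX : U → S → stdSimplex ℝ X) : ℝ :=
  mutualInfo fun s u => ∑ x, ∑ y, P.joint pU pX s u x y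

/-- The expectation `E[h(S,U,X)]` under the joint law above. -/
def Problem.expect (P : Problem S X Y) {U : Type*} [Fintype U] (pU : S → stdSimplex ℝ U)
    (pX : U → S → stdSimplex ℝ X) (h : S → U → X → ℝ) : ℝ :=
  ∑ s, ∑ u, ∑ x, ∑ y, P.joint pU pX s u x y * h s u x

/-- The single-letter conditions for the auxiliary alphabet `U`, with a channel input drawn from
`p(x|u,s)`. -/
def Problem.RandomizedCondition (P : Problem S X Y) (De Dr : ℝ) (U : Type*) [Fintype U] : Prop :=
  ∃ (pU : S → stdSimplex ℝ U) (pX : U → S → stdSimplex ℝ X) (g : U → S),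
    P.infoUY pU pX - P.infoSU pU pX ≥ 0 ∧
    P.expect pU pX (fun s _ x => P.de s x) ≤ De ∧
    P.expect pU pX (fun s u _ => P.dr s (g u)) ≤ Dr

open scoped Classical in
/-- The single-letter conditions for the auxiliary alphabet `U`, with the channel input
`x = f (u, s)`, i.e. with `p(x|u,s)` concentrated at `f (u, s)`. -/
def Problem.DeterministicCondition (P : Problem S X Y) (De Dr : ℝ) (U : Type*) [Fintype U] : Prop :=
  ∃ (pU : S → stdSimplex ℝ U) (f : U → S → X) (g : U → S),
    let pX : U → S → stdSimplex ℝ X := fun u s => stdSimplex.vertex (f u s)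
    P.infoUY pU pX - P.infoSU pU pX ≥ 0 ∧
    P.expect pU pX (fun s u _ => P.de s (f u s)) ≤ De ∧
    P.expect pU pX (fun s u _ => P.dr s (g u)) ≤ Dr

end

end Authentication

end

open scoped NNReal

noncomputable section

set_option linter.unusedSectionVars false

namespace Authentication

open Real Finset

/-! ### Entropy of nonnegative vectors -/

section Entropy

variable {A B ι : Type*} [Fintype A] [Fintype B] [Fintype ι]

/-! Conditional entropies are written as sums of the homogeneous functional `ent` over unnormalised
slices of a joint law. Once H(S) and H(Y) are set aside, I(U;Y) - I(S;U) becomes a sum over u of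
single-letter terms `entDiff`. Choosing an auxiliary variable then amounts to choosing a convex
combination of vectors in `Problem.points`, whose coordinates are source law, input law, two
distortions and entropy difference. The input law is recorded because it determines H(Y).
`Problem.Feasible` is the single-letter condition in this language.

Converse. Let R be the authentic reconstruction. Unless an attack succeeds or the decoder fails, the
decoder outputs R, so Fano's inequality gives H(R|Y^n,key) = o(n) under the reference channel;
security is needed only against the reference channel itself. Since I(S^n;R|key) ≤ H(R|key) =
I(R;Y^n|key) + H(R|Y^n,key), the difference H(S^n|R,key) - H(Y^n|R,key) is at least nH(S) - H(Y^n) -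
o(n) (`Scheme.total_entDiff_ge`). For a fixed key and reconstruction, a form of the Csiszár sum
identity (`entDiff_prod`, `blockFunctional_mem`) splits this block difference into single-letter
ones, each with one letter of R as its reconstruction letter. After division by n the sum lies in
the convex hull of the points (`Scheme.exists_hull_point`). Compactness of the hull removes the
slack, and Carathéodory's theorem bounds the size of the auxiliary alphabet. Writing each kernel
p(x|u,s) as a mixture of functions of s makes the input deterministic without lowering the
information difference.

Achievability. A codebook has M messages, each with 2^τ possible tags; the key secretly assigns one
tag to every message. M exceeds exp(n I(S;U)) exponentially, so the codewords selected by a key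
cover the source on average (`soft_covering`), and a likelihood encoder behaves as if a uniform
message were drawn first and the source were then produced from its codeword through p(s|u). M 2^τ
is exponentially smaller than exp(n I(U;Y)), so message and tag are decodable over the reference
channel (`packing`). To have another message accepted, a channel must hit the tag of that message,
which is independent of everything sent; this has probability at most 2^(-τ) (`sum_tag_guess_le`).
Taking τ logarithmic in n costs no rate.

This needs a strict information gap. At equality, a small amount of uniform input independent of the
source is mixed in and opens a gap, unless the channel output does not depend on its input. In that
case U is independent of the source, and one fixed codeword known to the decoder suffices
(`Problem.mem_region_of_ent_le`). -/

/-- The (unnormalised) entropy in nats of a nonnegative vector. It is homogeneous of degree one and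
agrees with the Shannon entropy on probability vectors. -/
def ent (v : B → ℝ) : ℝ := ∑ b, negMulLog (v b) - negMulLog (∑ b, v b)

/-- Homogeneity is the reason for not normalising: the sum of `ent` over the slices p(u,·) of a
joint law is the conditional entropy given u, with no division by p(u) and no special case for p(u)
= 0. -/
theorem ent_smul (c : ℝ) (v : B → ℝ) : ent (fun b => c * v b) = c * ent v := by
  simp only [ent, negMulLog_mul, ← Finset.mul_sum, Finset.sum_add_distrib, ← Finset.sum_mul]
  ring

@[simp] theorem ent_zero : ent (fun _ : B => (0 : ℝ)) = 0 := by simp [ent]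

theorem ent_of_sum_eq_one {v : B → ℝ} (h : ∑ b, v b = 1) : ent v = ∑ b, negMulLog (v b) := by
  simp [ent, h]

theorem ent_comp_equiv (e : A ≃ B) (v : B → ℝ) : ent (fun a => v (e a)) = ent v := by
  simp only [ent]
  rw [Equiv.sum_comp e v, Equiv.sum_comp e (fun b => negMulLog (v b))]

theorem ent_of_subsingleton [Unique B] (v : B → ℝ) : ent v = 0 := by
  simp [ent]

/-- Gibbs' inequality. -/
theorem ent_le_cross {v w : B → ℝ} (hv : ∀ b, 0 ≤ v b) (hw : ∀ b, 0 ≤ w b) (hw1 : ∑ b, w b ≤ 1)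
    (hvw : ∀ b, w b = 0 → v b = 0) : ent v ≤ ∑ b, v b * (-log (w b)) := by
  have hV : 0 ≤ ∑ b, v b := Finset.sum_nonneg fun b _ => hv b
  set V := ∑ b, v b with hVdef
  -- This is log t ≤ t - 1 at t = V w(b) / v(b), multiplied by v(b).
  have key : ∀ b, v b - V * w b ≤ v b * log V * (-1) - negMulLog (v b) + v b * (-log (w b)) := by
    intro b
    rcases (hv b).eq_or_lt with h0 | hpos
    · rw [← h0]; simp; exact mul_nonneg hV (hw b)
    · have hVpos : 0 < V := lt_of_lt_of_le hpos
        (Finset.single_le_sum (f := v) (fun b _ => hv b) (Finset.mem_univ b))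
      have hwpos : 0 < w b := lt_of_le_of_ne (hw b) fun h => hpos.ne' (hvw b h.symm)
      have h1 := log_le_sub_one_of_pos (x := V * w b / v b) (by positivity)
      rw [log_div (by positivity) hpos.ne', log_mul hVpos.ne' hwpos.ne'] at h1
      have h2 := mul_le_mul_of_nonneg_left h1 hpos.le
      have h3 : v b * (V * w b / v b - 1) = V * w b - v b := by field_simp
      rw [h3] at h2
      simp only [negMulLog]
      nlinarith
  have hs := Finset.sum_le_sum fun b (_ : b ∈ Finset.univ) => key b
  simp only [Finset.sum_sub_distrib, Finset.sum_add_distrib, ← Finset.sum_mul, ← Finset.mul_sum,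
    ← hVdef] at hs
  have : V * ∑ b, w b ≤ V := by nlinarith
  simp only [ent, ← hVdef]
  have : negMulLog V = - (V * log V) := by simp [negMulLog]
  linarith

/-- Conditioning reduces entropy: every slice is compared by Gibbs' inequality with the same
reference law, the normalised total, and the cross terms add up to the entropy of the total. -/
theorem sum_ent_le_ent_sum {v : ι → B → ℝ} (hv : ∀ i b, 0 ≤ v i b) :
    ∑ i, ent (v i) ≤ ent (fun b => ∑ i, v i b) := by
  set t : B → ℝ := fun b => ∑ i, v i b with ht
  have ht0 : ∀ b, 0 ≤ t b := fun b => Finset.sum_nonneg fun i _ => hv i b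
  set T := ∑ b, t b with hT
  have hT0 : 0 ≤ T := Finset.sum_nonneg fun b _ => ht0 b
  have hle : ∀ i b, v i b ≤ t b := fun i b =>
    Finset.single_le_sum (f := fun i => v i b) (fun i _ => hv i b) (Finset.mem_univ i)
  rcases hT0.eq_or_lt with h0 | hpos
  · have ht' : ∀ b, t b = 0 := fun b => by
      have := (Finset.sum_eq_zero_iff_of_nonneg (fun b _ => ht0 b)).1 h0.symm
      exact this b (Finset.mem_univ b)
    have hv' : ∀ i, v i = fun _ => 0 := fun i => funext fun b =>
      le_antisymm ((hle i b).trans (ht' b).le) (hv i b)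
    have : t = fun _ => 0 := funext ht'
    simp [hv', this]
  · have h1 : ∀ i, ent (v i) ≤ ∑ b, v i b * (-log (t b / T)) := fun i => by
      refine ent_le_cross (hv i) (fun b => div_nonneg (ht0 b) hT0) ?_ ?_
      · rw [← Finset.sum_div, ← hT, div_self hpos.ne']
      · intro b hb
        rcases div_eq_zero_iff.1 hb with h | h
        · exact le_antisymm ((hle i b).trans h.le) (hv i b)
        · exact absurd h hpos.ne'
    refine (Finset.sum_le_sum fun i _ => h1 i).trans (le_of_eq ?_)
    rw [Finset.sum_comm]
    simp only [← Finset.sum_mul]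
    have : ∀ b, t b * (-log (t b / T)) = negMulLog (t b) + t b * log T := by
      intro b
      rcases (ht0 b).eq_or_lt with h | h
      · simp [← h]
      · rw [log_div h.ne' hpos.ne', negMulLog]; ring
    rw [Finset.sum_congr rfl fun b _ => this b, Finset.sum_add_distrib, ← Finset.sum_mul, ← hT, ent,
      ← hT, negMulLog]
    ring

theorem ent_add_le {v w : B → ℝ} (hv : ∀ b, 0 ≤ v b) (hw : ∀ b, 0 ≤ w b) :
    ent v + ent w ≤ ent (fun b => v b + w b) := by
  have := sum_ent_le_ent_sum (v := ![v, w]) (by intro i b; fin_cases i <;> simp [hv, hw])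
  simpa [Fin.sum_univ_two] using this

theorem ent_nonneg {v : B → ℝ} (hv : ∀ b, 0 ≤ v b) : 0 ≤ ent v := by
  rw [ent, sub_nonneg, negMulLog, neg_mul, Finset.sum_mul, ← Finset.sum_neg_distrib]
  refine Finset.sum_le_sum fun b _ => ?_
  rcases (hv b).eq_or_lt with h | h
  · simp [← h]
  · have := log_le_log h (Finset.single_le_sum (f := v) (fun b _ => hv b) (Finset.mem_univ b))
    rw [negMulLog]
    nlinarith

/-- Chain rule. -/
theorem ent_chain (p : A → B → ℝ) :
    ent (fun z : A × B => p z.1 z.2) = ent (fun a => ∑ b, p a b) + ∑ a, ent (p a) := by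
  simp only [ent, Fintype.sum_prod_type, Finset.sum_sub_distrib]
  ring

theorem ent_chain' (p : A → B → ℝ) :
    ent (fun z : A × B => p z.1 z.2) = ent (fun b => ∑ a, p a b) + ∑ b, ent (fun a => p a b) := by
  rw [← ent_chain (fun b a => p a b), ← ent_comp_equiv (Equiv.prodComm A B)]
  rfl

/-- Mutual information in terms of entropies. -/
theorem mutualInfo_eq_ent {p : A → B → ℝ} (hp : ∀ a b, 0 ≤ p a b) (h1 : ∑ a, ∑ b, p a b = 1) :
    mutualInfo p * log 2 = ent (fun b => ∑ a, p a b) - ∑ a, ent (p a) := by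
  have key : ∀ a b, p a b * logb 2 (p a b / ((∑ b', p a b') * (∑ a', p a' b))) * log 2 =
      - negMulLog (p a b) - p a b * log (∑ b', p a b') - p a b * log (∑ a', p a' b) := by
    intro a b
    rcases (hp a b).eq_or_lt with h | h
    · simp [← h]
    · have ha : 0 < ∑ b', p a b' := lt_of_lt_of_le h
        (Finset.single_le_sum (f := fun b => p a b) (fun b _ => hp a b) (Finset.mem_univ b))
      have hb : 0 < ∑ a', p a' b := lt_of_lt_of_le h
        (Finset.single_le_sum (f := fun a => p a b) (fun a _ => hp a b) (Finset.mem_univ a))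
      rw [mul_assoc, logb, div_mul_cancel₀ _ (log_pos one_lt_two).ne',
        log_div h.ne' (by positivity), log_mul ha.ne' hb.ne', negMulLog]
      ring
  rw [mutualInfo, Finset.sum_mul, Finset.sum_congr rfl fun a _ => Finset.sum_mul _ _ _]
  simp only [key, Finset.sum_sub_distrib, Finset.sum_neg_distrib]
  rw [Finset.sum_comm (f := fun a b => p a b * log (∑ a', p a' b))]
  simp only [← Finset.sum_mul, ent]
  rw [Finset.sum_comm (f := fun b a => p a b), h1]
  simp only [negMulLog, Finset.sum_sub_distrib, log_one, neg_mul, Finset.sum_neg_distrib]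
  ring

/-- Mutual information zero forces independence. -/
theorem eq_mul_of_mutualInfo_nonpos {p : A → B → ℝ} (hp : ∀ a b, 0 ≤ p a b)
    (h1 : ∑ a, ∑ b, p a b = 1) (h0 : mutualInfo p ≤ 0) (a : A) (b : B) :
    p a b = (∑ b', p a b') * (∑ a', p a' b) := by
  set pA : A → ℝ := fun a => ∑ b', p a b' with hpA
  set pB : B → ℝ := fun b => ∑ a', p a' b with hpB
  have hA0 : ∀ a, 0 ≤ pA a := fun a => Finset.sum_nonneg fun b _ => hp a b
  have hB0 : ∀ b, 0 ≤ pB b := fun b => Finset.sum_nonneg fun a _ => hp a b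
  have hl2 : 0 < log 2 := log_pos one_lt_two
  -- The divergence is rewritten with summands p log(p/q) - p + q, where q is the product of the
  -- marginals. The corrections cancel in the sum because both laws have mass one, and each summand
  -- is nonnegative and vanishes only at p = q.
  have key : ∀ a b, 0 ≤ p a b * log (p a b / (pA a * pB b)) - p a b + pA a * pB b ∧
      (p a b * log (p a b / (pA a * pB b)) - p a b + pA a * pB b = 0 →
        p a b = pA a * pB b) := by
    intro a b
    rcases (hp a b).eq_or_lt with h | h
    · rw [← h, zero_mul, sub_zero, zero_add]
      exact ⟨mul_nonneg (hA0 a) (hB0 b), fun h => h.symm⟩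
    · have ha : 0 < pA a := lt_of_lt_of_le h
        (Finset.single_le_sum (f := fun b => p a b) (fun b _ => hp a b) (Finset.mem_univ b))
      have hb : 0 < pB b := lt_of_lt_of_le h
        (Finset.single_le_sum (f := fun a => p a b) (fun a _ => hp a b) (Finset.mem_univ a))
      set t := p a b / (pA a * pB b) with ht
      have hab : 0 < pA a * pB b := by positivity
      have htp : p a b = t * (pA a * pB b) := by rw [ht]; field_simp
      have ht0 : 0 ≤ t := by positivity
      have e : p a b * log t - p a b + pA a * pB b = (pA a * pB b) * (t * log t - (t - 1)) := by
        rw [htp]; ring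
      rw [e]
      refine ⟨mul_nonneg hab.le (sub_nonneg.2 (self_sub_one_le_mul_log ht0)), fun h => ?_⟩
      by_contra hne
      have : t ≠ 1 := fun h1 => hne (by rw [htp, h1, one_mul])
      have := self_sub_one_lt_mul_log ht0 this
      rcases mul_eq_zero.1 h with h | h <;> linarith
  have hsum : ∑ a, ∑ b, (p a b * log (p a b / (pA a * pB b)) - p a b + pA a * pB b) =
      mutualInfo p * log 2 := by
    simp only [Finset.sum_add_distrib, Finset.sum_sub_distrib, h1, ← Finset.mul_sum,
      ← Finset.sum_mul]
    have e1 : ∑ a, pA a = 1 := h1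
    have e2 : ∑ b, pB b = 1 := by rw [← h1, Finset.sum_comm]
    rw [e1, e2, mutualInfo, Finset.sum_mul, Finset.sum_congr rfl fun a _ => Finset.sum_mul _ _ _]
    simp only [logb, mul_assoc, div_mul_cancel₀ _ hl2.ne', hpA, hpB]
    ring
  have hz : ∑ a, ∑ b, (p a b * log (p a b / (pA a * pB b)) - p a b + pA a * pB b) = 0 :=
    le_antisymm (hsum ▸ mul_nonpos_of_nonpos_of_nonneg h0 hl2.le)
      (Finset.sum_nonneg fun a _ => Finset.sum_nonneg fun b _ => (key a b).1)
  have hz1 := (Finset.sum_eq_zero_iff_of_nonneg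
    (fun a _ => Finset.sum_nonneg fun b _ => (key a b).1)).1 hz a (Finset.mem_univ a)
  have hz2 := (Finset.sum_eq_zero_iff_of_nonneg (fun b _ => (key a b).1)).1 hz1 b (Finset.mem_univ b)
  exact (key a b).2 hz2

@[fun_prop]
theorem continuous_ent : Continuous (ent : (B → ℝ) → ℝ) := by
  unfold ent
  exact (continuous_finsetSum _ fun b _ => continuous_negMulLog.comp (continuous_apply b)).sub
    (continuous_negMulLog.comp (continuous_finsetSum _ fun b _ => continuous_apply b))

/-- A Fano-type inequality with a randomized estimator `δ`. -/
theorem ent_le_fano [Nonempty B] {v : B → ℝ} (hv : ∀ b, 0 ≤ v b) (δ : Option B → ℝ)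
    (hδ : ∀ φ, 0 ≤ δ φ) (hδ1 : ∑ φ, δ φ = 1) [DecidableEq B] :
    ent v ≤ (∑ b, v b) * log 2 +
      log (Fintype.card B) * ∑ φ, ∑ b, if φ ≠ some b then v b * δ φ else 0 := by
  have hB : (0 : ℝ) < Fintype.card B := by exact_mod_cast Fintype.card_pos
  have hlB : 0 ≤ log (Fintype.card B) := log_nonneg (by exact_mod_cast Fintype.card_pos)
  have hl2 : 0 < log 2 := log_pos one_lt_two
  have step : ∀ φ : Option B, ent v ≤ (∑ b, v b) * log 2 +
      log (Fintype.card B) * ∑ b, if φ ≠ some b then v b else 0 := by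
    intro φ
    have hw : ∀ b, 0 < (if φ = some b then (1 / 2 : ℝ) else 0) + 1 / (2 * Fintype.card B) := by
      intro b; split_ifs <;> positivity
    -- The reference law puts half of its mass on the guess and spreads half uniformly. Its code
    -- length is at most log 2 at the guess and log 2 + log |B| elsewhere. For the guess `none` its
    -- mass is only 1/2, which Gibbs' inequality tolerates.
    refine (ent_le_cross (w := fun b => (if φ = some b then (1 / 2 : ℝ) else 0) +
      1 / (2 * Fintype.card B)) hv (fun b => (hw b).le) ?_ (fun b h => absurd h (hw b).ne')).trans ?_
    · rw [Finset.sum_add_distrib]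
      have : ∑ b, (if φ = some b then (1 / 2 : ℝ) else 0) ≤ 1 / 2 := by
        cases φ with
        | none => simp
        | some c => simp
      have h2 : ∑ _b : B, (1 / (2 * (Fintype.card B : ℝ))) = 1 / 2 := by
        rw [Finset.sum_const, Finset.card_univ, nsmul_eq_mul]; field_simp
      linarith
    · rw [Finset.sum_mul, Finset.mul_sum, ← Finset.sum_add_distrib]
      refine Finset.sum_le_sum fun b _ => ?_
      by_cases h : φ = some b
      · simp only [h, if_true, ne_eq, not_true, if_false, mul_zero, add_zero]
        refine mul_le_mul_of_nonneg_left ?_ (hv b)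
        rw [← log_inv]
        refine log_le_log (by positivity) ?_
        rw [inv_le_comm₀ (by positivity) (by positivity)]
        have : (0:ℝ) < 1 / (2 * Fintype.card B) := by positivity
        linarith
      · simp only [h, if_false, ne_eq, not_false_iff, if_true, zero_add]
        rw [one_div, log_inv, neg_neg, log_mul two_ne_zero hB.ne']
        linarith
  calc ent v = ∑ φ, δ φ * ent v := by rw [← Finset.sum_mul, hδ1, one_mul]
    _ ≤ ∑ φ, δ φ * ((∑ b, v b) * log 2 +
      log (Fintype.card B) * ∑ b, if φ ≠ some b then v b else 0) :=
        Finset.sum_le_sum fun φ _ => mul_le_mul_of_nonneg_left (step φ) (hδ φ)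
    _ = _ := by
      simp only [mul_add, Finset.sum_add_distrib, ← Finset.sum_mul, hδ1, one_mul, Finset.mul_sum]
      congr 1
      refine Finset.sum_congr rfl fun φ _ => Finset.sum_congr rfl fun b _ => ?_
      split_ifs <;> ring

end Entropy

/-! ### Single-letterization -/

section SingleLetter

variable {S X Y S₁ S₂ X₁ X₂ Y₁ Y₂ V : Type*} [Fintype S] [Fintype X] [Fintype Y] [Fintype S₁]
  [Fintype S₂] [Fintype X₁] [Fintype X₂] [Fintype Y₁] [Fintype Y₂]

/-- The marginal on the source alphabet of a joint (sub-)law of source and channel input. -/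
def srcLaw (q : S → X → ℝ) (s : S) : ℝ := ∑ x, q s x

/-- The law of the channel output when source and channel input have joint (sub-)law `q`. -/
def outLaw (w : X → Y → ℝ) (q : S → X → ℝ) (y : Y) : ℝ := ∑ s, ∑ x, q s x * w x y

/-- Source entropy minus output entropy. -/
def entDiff (w : X → Y → ℝ) (q : S → X → ℝ) : ℝ := ent (srcLaw q) - ent (outLaw w q)

theorem entDiff_smul (w : X → Y → ℝ) (c : ℝ) (q : S → X → ℝ) :
    entDiff w (fun s x => c * q s x) = c * entDiff w q := by
  have h1 : srcLaw (fun s x => c * q s x) = fun s => c * srcLaw q s := by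
    funext s; simp [srcLaw, Finset.mul_sum]
  have h2 : outLaw w (fun s x => c * q s x) = fun y => c * outLaw w q y := by
    funext s; simp [outLaw, Finset.mul_sum, mul_assoc]
  rw [entDiff, h1, h2, ent_smul, ent_smul, entDiff]; ring

/-- The two-block Csiszár sum identity. Expand H(S₁S₂) starting from S₂ and H(Y₁Y₂) starting from
Y₁. The leftover H(S₂) - H(Y₁) equals H(S₂|Y₁) - H(Y₁|S₂), so the first block is sliced by the other
source S₂ and the second block by the other output Y₁. -/
theorem entDiff_prod (w₁ : X₁ → Y₁ → ℝ) (w₂ : X₂ → Y₂ → ℝ) (h₁ : ∀ x, ∑ y, w₁ x y = 1)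
    (h₂ : ∀ x, ∑ y, w₂ x y = 1) (Q : S₁ → S₂ → X₁ → X₂ → ℝ) :
    ent (fun z : S₁ × S₂ => ∑ x₁, ∑ x₂, Q z.1 z.2 x₁ x₂) -
      ent (fun z : Y₁ × Y₂ => ∑ s₁, ∑ s₂, ∑ x₁, ∑ x₂, Q s₁ s₂ x₁ x₂ * (w₁ x₁ z.1 * w₂ x₂ z.2)) =
    ∑ s₂, entDiff w₁ (fun s₁ x₁ => ∑ x₂, Q s₁ s₂ x₁ x₂) +
      ∑ y₁, entDiff w₂ (fun s₂ x₂ => ∑ s₁, ∑ x₁, Q s₁ s₂ x₁ x₂ * w₁ x₁ y₁) := by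
  rw [ent_chain' (fun s₁ s₂ => ∑ x₁, ∑ x₂, Q s₁ s₂ x₁ x₂),
    ent_chain (fun y₁ y₂ => ∑ s₁, ∑ s₂, ∑ x₁, ∑ x₂, Q s₁ s₂ x₁ x₂ * (w₁ x₁ y₁ * w₂ x₂ y₂))]
  -- The joint entropy of S₂ and Y₁, expanded in both orders, trades H(S₂) - H(Y₁) for conditional
  -- entropies.
  have hR := (ent_chain (fun s₂ y₁ => ∑ s₁, ∑ x₁, ∑ x₂, Q s₁ s₂ x₁ x₂ * w₁ x₁ y₁)).symm.trans
    (ent_chain' (fun s₂ y₁ => ∑ s₁, ∑ x₁, ∑ x₂, Q s₁ s₂ x₁ x₂ * w₁ x₁ y₁))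
  have e1 : (fun s₂ => ∑ y₁, ∑ s₁, ∑ x₁, ∑ x₂, Q s₁ s₂ x₁ x₂ * w₁ x₁ y₁) =
      fun s₂ => ∑ s₁, ∑ x₁, ∑ x₂, Q s₁ s₂ x₁ x₂ := by
    funext s₂
    rw [Finset.sum_comm]
    refine Finset.sum_congr rfl fun s₁ _ => ?_
    rw [Finset.sum_comm]
    refine Finset.sum_congr rfl fun x₁ _ => ?_
    rw [Finset.sum_comm]
    simp [← Finset.mul_sum, h₁]
  have e2 : (fun y₁ => ∑ y₂, ∑ s₁, ∑ s₂, ∑ x₁, ∑ x₂, Q s₁ s₂ x₁ x₂ * (w₁ x₁ y₁ * w₂ x₂ y₂)) =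
      fun y₁ => ∑ s₂, ∑ s₁, ∑ x₁, ∑ x₂, Q s₁ s₂ x₁ x₂ * w₁ x₁ y₁ := by
    funext y₁
    rw [Finset.sum_comm, Finset.sum_comm (s := (univ : Finset S₂))]
    refine Finset.sum_congr rfl fun s₁ _ => ?_
    rw [Finset.sum_comm]
    refine Finset.sum_congr rfl fun s₂ _ => ?_
    rw [Finset.sum_comm]
    refine Finset.sum_congr rfl fun x₁ _ => ?_
    rw [Finset.sum_comm]
    simp [← Finset.mul_sum, h₂]
  have e3 : ∀ s₂, outLaw w₁ (fun s₁ x₁ => ∑ x₂, Q s₁ s₂ x₁ x₂) =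
      fun y₁ => ∑ s₁, ∑ x₁, ∑ x₂, Q s₁ s₂ x₁ x₂ * w₁ x₁ y₁ := by
    intro s₂; funext y₁; simp [outLaw, Finset.sum_mul]
  have e4 : ∀ y₁, srcLaw (fun s₂ x₂ => ∑ s₁, ∑ x₁, Q s₁ s₂ x₁ x₂ * w₁ x₁ y₁) =
      fun s₂ => ∑ s₁, ∑ x₁, ∑ x₂, Q s₁ s₂ x₁ x₂ * w₁ x₁ y₁ := by
    intro y₁; funext s₂
    rw [srcLaw, Finset.sum_comm]
    refine Finset.sum_congr rfl fun s₁ _ => ?_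
    rw [Finset.sum_comm]
  have e5 : ∀ y₁, outLaw w₂ (fun s₂ x₂ => ∑ s₁, ∑ x₁, Q s₁ s₂ x₁ x₂ * w₁ x₁ y₁) =
      fun y₂ => ∑ s₁, ∑ s₂, ∑ x₁, ∑ x₂, Q s₁ s₂ x₁ x₂ * (w₁ x₁ y₁ * w₂ x₂ y₂) := by
    intro y₁; funext y₂
    rw [outLaw, Finset.sum_comm (s := (univ : Finset S₁))]
    refine Finset.sum_congr rfl fun s₂ _ => ?_
    simp only [Finset.sum_mul]
    rw [Finset.sum_comm]
    refine Finset.sum_congr rfl fun s₁ _ => ?_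
    rw [Finset.sum_comm]
    simp only [mul_assoc]
  have e6 : ∀ s₂, srcLaw (fun s₁ x₁ => ∑ x₂, Q s₁ s₂ x₁ x₂) = fun s₁ => ∑ x₁, ∑ x₂, Q s₁ s₂ x₁ x₂ :=
    fun s₂ => rfl
  simp only [entDiff, e3, e4, e5, e6, e2, Finset.sum_sub_distrib]
  rw [e1] at hR
  linarith

/-- The memoryless extension of a kernel. -/
def nfold {n : ℕ} (w : X → Y → ℝ) (x : Fin n → X) (y : Fin n → Y) : ℝ := ∏ i, w (x i) (y i)

theorem nfold_nonneg {n : ℕ} {w : X → Y → ℝ} (hw : ∀ x y, 0 ≤ w x y) (x : Fin n → X)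
    (y : Fin n → Y) : 0 ≤ nfold w x y := Finset.prod_nonneg fun _ _ => hw _ _

theorem sum_prod_pi {ι : Type*} [Fintype ι] [DecidableEq ι] (f : ι → Y → ℝ) :
    ∑ y : ι → Y, ∏ i, f i (y i) = ∏ i, ∑ b, f i b := by
  rw [Finset.prod_univ_sum, Fintype.piFinset_univ]

theorem sum_nfold {n : ℕ} {w : X → Y → ℝ} (hw : ∀ x, ∑ y, w x y = 1) (x : Fin n → X) :
    ∑ y : Fin n → Y, nfold w x y = 1 := by
  unfold nfold
  rw [sum_prod_pi]
  simp [hw]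

theorem sum_fin_succ {M : Type*} [AddCommMonoid M] {n : ℕ} (F : (Fin (n + 1) → X) → M) :
    ∑ x, F x = ∑ x' : Fin n → X, ∑ x₀, F (Fin.cons x₀ x') := by
  rw [Finset.sum_comm, ← Equiv.sum_comp (Fin.consEquiv fun _ => X), Fintype.sum_prod_type]
  rfl

/-- The tail plays the role of the first block and the initial letter that of the second in
`entDiff_prod`. Slicing by s₀ leaves a problem of length n, and slicing by the output tail leaves a
single-letter term. -/
theorem entDiff_nfold_succ {n : ℕ} (w : X → Y → ℝ) (hw : ∀ x, ∑ y, w x y = 1)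
    (Q : (Fin (n + 1) → S) → (Fin (n + 1) → X) → ℝ) :
    entDiff (nfold w) Q =
      ∑ s₀, entDiff (nfold (n := n) w) (fun s' x' => ∑ x₀, Q (Fin.cons s₀ s') (Fin.cons x₀ x')) +
      ∑ y', entDiff w
        (fun s₀ x₀ => ∑ s', ∑ x', Q (Fin.cons s₀ s') (Fin.cons x₀ x') * nfold w x' y') := by
  rw [← entDiff_prod (nfold (n := n) w) w (sum_nfold hw) hw
    (fun s' s₀ x' x₀ => Q (Fin.cons s₀ s') (Fin.cons x₀ x')), entDiff]
  congr 1
  · rw [← ent_comp_equiv ((Equiv.prodComm _ _).trans (Fin.consEquiv fun _ => S))]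
    congr 1
    funext z
    simp only [srcLaw, sum_fin_succ]
    rfl
  · rw [← ent_comp_equiv ((Equiv.prodComm _ _).trans (Fin.consEquiv fun _ => Y))]
    congr 1
    funext z
    simp only [outLaw, sum_fin_succ]
    refine Finset.sum_congr rfl fun s' _ => Finset.sum_congr rfl fun s₀ _ =>
      Finset.sum_congr rfl fun x' _ => Finset.sum_congr rfl fun x₀ _ => ?_
    congr 1
    simp [nfold, Fin.prod_univ_succ, mul_comm]

/-- The conic tensorization behind the converse: block functionals are sums of single-letter
functionals. -/
theorem blockFunctional_mem [AddCommGroup V] [Module ℝ V] (w : X → Y → ℝ)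
    (hw0 : ∀ x y, 0 ≤ w x y) (hw : ∀ x, ∑ y, w x y = 1) (K : AddSubmonoid (V × ℝ)) {n : ℕ}
    (φ : Fin n → S → X → V)
    (hK : ∀ i (q : S → X → ℝ), (∀ s x, 0 ≤ q s x) →
      (∑ s, ∑ x, q s x • φ i s x, entDiff w q) ∈ K)
    (Q : (Fin n → S) → (Fin n → X) → ℝ) (hQ : ∀ s x, 0 ≤ Q s x) :
    (∑ s, ∑ x, Q s x • ∑ i, φ i (s i) (x i), entDiff (nfold w) Q) ∈ K := by
  induction n with
  | zero =>
    have : entDiff (nfold w) Q = 0 := by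
      simp [entDiff, ent_of_subsingleton]
    rw [this]
    simp only [univ_unique, Finset.univ_eq_empty, Finset.sum_empty, smul_zero, Finset.sum_const_zero]
    exact K.zero_mem
  | succ n ih =>
    rw [entDiff_nfold_succ w hw]
    -- The linear part must be split along the same slices as the entropies: the letters of the tail
    -- go with the slices by s₀, the initial letter with the slices by the output tail.
    have e : ∑ s, ∑ x, Q s x • ∑ i, φ i (s i) (x i) =
        ∑ s₀, ∑ s', ∑ x', (∑ x₀, Q (Fin.cons s₀ s') (Fin.cons x₀ x')) •
          ∑ i : Fin n, φ i.succ (s' i) (x' i) +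
        ∑ y', ∑ s₀, ∑ x₀, (∑ s', ∑ x', Q (Fin.cons s₀ s') (Fin.cons x₀ x') * nfold w x' y') •
          φ 0 s₀ x₀ := by
      simp only [sum_fin_succ, Fin.sum_univ_succ, Fin.cons_zero, Fin.cons_succ, smul_add,
        Finset.sum_add_distrib]
      rw [add_comm]
      congr 1
      · rw [Finset.sum_comm]
        simp only [Finset.sum_smul]
      · simp only [Finset.sum_smul]
        rw [Finset.sum_comm (s := (univ : Finset (Fin n → Y))), Finset.sum_comm]
        refine Finset.sum_congr rfl fun s₀ _ => ?_
        rw [Finset.sum_comm (s := (univ : Finset (Fin n → Y)))]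
        have : ∀ x₀, ∑ y', ∑ s', ∑ x', (Q (Fin.cons s₀ s') (Fin.cons x₀ x') * nfold w x' y') •
            φ 0 s₀ x₀ = ∑ s', ∑ x', Q (Fin.cons s₀ s') (Fin.cons x₀ x') • φ 0 s₀ x₀ := by
          intro x₀
          rw [Finset.sum_comm]
          refine Finset.sum_congr rfl fun s' _ => ?_
          rw [Finset.sum_comm]
          refine Finset.sum_congr rfl fun x' _ => ?_
          rw [← Finset.sum_smul, ← Finset.mul_sum, sum_nfold hw, mul_one]
        refine Eq.symm ((Finset.sum_congr rfl fun x₀ _ => this x₀).trans ?_)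
        rw [Finset.sum_comm]
        refine Finset.sum_congr rfl fun s' _ => ?_
        rw [Finset.sum_comm]
    rw [e, ← Prod.mk_add_mk]
    refine K.add_mem ?_ ?_
    · rw [prod_mk_sum]
      exact K.sum_mem fun s₀ _ => ih (fun i => φ i.succ) (fun i => hK i.succ) _
        (fun s' x' => Finset.sum_nonneg fun x₀ _ => hQ _ _)
    · rw [prod_mk_sum]
      exact K.sum_mem fun y' _ => hK 0 _ fun s₀ x₀ => Finset.sum_nonneg fun s' _ =>
        Finset.sum_nonneg fun x' _ => mul_nonneg (hQ _ _) (nfold_nonneg hw0 _ _)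

end SingleLetter

/-! ### Carathéodory's theorem and compactness -/

section Caratheodory

variable {E : Type*} [AddCommGroup E] [Module ℝ E]

/-- Carathéodory's theorem for a set lying in an affine hyperplane that misses the origin: as many
points as the dimension suffice. -/
theorem exists_convex_combination [FiniteDimensional ℝ E] {A : Set E} (ℓ : E →ₗ[ℝ] ℝ)
    (hℓ : ∀ a ∈ A, ℓ a = 1) {d : ℕ} (hd : Module.finrank ℝ E ≤ d) {x : E}
    (hx : x ∈ convexHull ℝ A) :
    ∃ (z : Fin d → E) (w : Fin d → ℝ), (∀ i, z i ∈ A) ∧ w ∈ stdSimplex ℝ (Fin d) ∧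
      ∑ i, w i • z i = x := by
  obtain ⟨ι, _, z, w, hz, hind, hw0, hw1, hsum⟩ := eq_pos_convex_span_of_mem_convexHull hx
  have hzA : ∀ i, z i ∈ A := fun i => hz ⟨i, rfl⟩
  -- Applying `ℓ` to a linear relation shows that its coefficients sum to zero, so affine
  -- independence becomes linear independence; this saves the usual extra point.
  have hlin : LinearIndependent ℝ z := by
    rw [Fintype.linearIndependent_iff]
    intro c hc i
    have hc0 : ∑ i, c i = 0 := by
      have := congrArg ℓ hc
      simpa [map_sum, hℓ _ (hzA _)] using this
    refine (affineIndependent_iff.1 hind) Finset.univ c ?_ ?_ i (Finset.mem_univ i)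
    · exact hc0
    · exact hc
  have hcard : Fintype.card ι ≤ Fintype.card (Fin d) := by
    rw [Fintype.card_fin]
    exact hlin.fintype_card_le_finrank.trans hd
  obtain ⟨e⟩ := Function.Embedding.nonempty_of_card_le hcard
  have hne : Nonempty ι := by
    by_contra h
    rw [not_nonempty_iff] at h
    simp at hw1
  obtain ⟨i₀⟩ := hne
  -- Fewer than `d` points are padded with copies of `z i₀` of weight zero.
  have hext : ∀ i, Function.extend e w 0 (e i) = w i := fun i => e.injective.extend_apply _ _ _
  have hextz : ∀ i, Function.extend e z (fun _ => z i₀) (e i) = z i :=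
    fun i => e.injective.extend_apply _ _ _
  have hoff : ∀ j, j ∉ Set.range e → Function.extend e w 0 j = 0 := fun j hj => by
    rw [Function.extend_apply' _ _ _ (by simpa using hj)]; rfl
  refine ⟨Function.extend e z (fun _ => z i₀), Function.extend e w 0, ?_, ⟨?_, ?_⟩, ?_⟩
  · intro j
    by_cases hj : j ∈ Set.range e
    · obtain ⟨i, rfl⟩ := hj; rw [hextz]; exact hzA i
    · rw [Function.extend_apply' _ _ _ (by simpa using hj)]; exact hzA i₀
  · intro j
    by_cases hj : j ∈ Set.range e
    · obtain ⟨i, rfl⟩ := hj; rw [hext]; exact (hw0 i).le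
    · rw [hoff j hj]
  · rw [← hw1]
    exact (Fintype.sum_of_injective e e.injective _ _ (fun j hj => hoff j hj)
      fun i => (hext i).symm).symm
  · rw [← hsum]
    refine (Fintype.sum_of_injective e e.injective _ _ (fun j hj => ?_) fun i => ?_).symm
    · rw [hoff j hj, zero_smul]
    · rw [hext, hextz]

/-- With the number of points fixed by Carathéodory's theorem, the hull is a continuous image of a
power of `A` times a simplex. -/
theorem isCompact_convexHull_of_linear {E : Type*} [NormedAddCommGroup E] [NormedSpace ℝ E]
    [FiniteDimensional ℝ E] {A : Set E} (hA : IsCompact A) (ℓ : E →ₗ[ℝ] ℝ)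
    (hℓ : ∀ a ∈ A, ℓ a = 1) : IsCompact (convexHull ℝ A) := by
  have h := ((isCompact_univ_pi fun _ : Fin (Module.finrank ℝ E) => hA).prod
    (isCompact_stdSimplex ℝ (Fin (Module.finrank ℝ E)))).image
    (f := fun p : (Fin (Module.finrank ℝ E) → E) × (Fin (Module.finrank ℝ E) → ℝ) =>
      ∑ i, p.2 i • p.1 i) (by fun_prop)
  convert h using 1
  ext x
  constructor
  · intro hx
    obtain ⟨z, w, hz, hw, rfl⟩ := exists_convex_combination ℓ hℓ le_rfl hx
    exact ⟨(z, w), ⟨fun i _ => hz i, hw⟩, rfl⟩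
  · rintro ⟨⟨z, w⟩, ⟨hz, hw⟩, rfl⟩
    exact (convex_convexHull ℝ A).sum_mem (fun i _ => hw.1 i) hw.2
      fun i _ => subset_convexHull ℝ A (hz i (Set.mem_univ i))

end Caratheodory

/-! ### The single-letter region as a convex hull -/

section Region

variable {S X Y : Type*} [Fintype S] [Fintype X] [Fintype Y]

/-- Marginal law of the source, marginal law of the channel input, encoding distortion,
reconstruction distortion. -/
abbrev Moments (S X : Type*) : Type _ := (S → ℝ) × (X → ℝ) × ℝ × ℝ

open scoped Classical in
/-- The moments of the point mass at `(s, x)` for the reconstruction letter `r`. -/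
def Problem.feature (P : Problem S X Y) (r : S) (s : S) (x : X) : Moments S X :=
  (Pi.single s 1, Pi.single x 1, P.de s x, P.dr s r)

/-- The moments and the entropy difference of a joint (sub-)law of source and channel input. -/
def Problem.point (P : Problem S X Y) (r : S) (q : S → X → ℝ) : Moments S X × ℝ :=
  (∑ s, ∑ x, q s x • P.feature r s x, entDiff (fun x y => P.channel x y) q)

/-- The set of points of probability laws. -/
def Problem.points (P : Problem S X Y) : Set (Moments S X × ℝ) :=
  {z | ∃ (r : S) (q : S → X → ℝ), (∀ s x, 0 ≤ q s x) ∧ ∑ s, ∑ x, q s x = 1 ∧ z = P.point r q}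

/-- The total mass. -/
def massMap (S X : Type*) [Fintype S] : Moments S X × ℝ →ₗ[ℝ] ℝ where
  toFun z := ∑ s, z.1.1 s
  map_add' z z' := by simp [Finset.sum_add_distrib]
  map_smul' c z := by simp [Finset.mul_sum]

theorem Problem.point_srcLaw (P : Problem S X Y) (r : S) (q : S → X → ℝ) :
    (P.point r q).1.1 = srcLaw q := by
  classical
  funext a
  simp [point, feature, Prod.fst_sum, Finset.sum_apply, Pi.single_apply, srcLaw,
    Finset.sum_ite_irrel]

theorem Problem.point_input (P : Problem S X Y) (r : S) (q : S → X → ℝ) (b : X) :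
    (P.point r q).1.2.1 b = ∑ s, q s b := by
  classical
  simp [point, feature, Prod.fst_sum, Prod.snd_sum, Finset.sum_apply, Pi.single_apply]

theorem Problem.point_de (P : Problem S X Y) (r : S) (q : S → X → ℝ) :
    (P.point r q).1.2.2.1 = ∑ s, ∑ x, q s x * P.de s x := by
  simp [point, feature, Prod.fst_sum, Prod.snd_sum]

theorem Problem.point_dr (P : Problem S X Y) (r : S) (q : S → X → ℝ) :
    (P.point r q).1.2.2.2 = ∑ s, ∑ x, q s x * P.dr s r := by
  simp [point, feature, Prod.snd_sum]

theorem Problem.massMap_point (P : Problem S X Y) (r : S) (q : S → X → ℝ) :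
    massMap S X (P.point r q) = ∑ s, ∑ x, q s x := by
  simp [massMap, P.point_srcLaw, srcLaw]

theorem Problem.massMap_points (P : Problem S X Y) : ∀ a ∈ P.points, massMap S X a = 1 := by
  rintro _ ⟨r, q, _, h1, rfl⟩
  rw [P.massMap_point, h1]

theorem Problem.point_smul (P : Problem S X Y) (r : S) (c : ℝ) (q : S → X → ℝ) :
    P.point r (fun s x => c * q s x) = c • P.point r q := by
  simp only [point, entDiff_smul, Prod.smul_mk, Finset.smul_sum, smul_smul, smul_eq_mul]

theorem Problem.continuous_point (P : Problem S X Y) (r : S) :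
    Continuous (fun q : S × X → ℝ => P.point r (fun s x => q (s, x))) := by
  unfold point entDiff srcLaw outLaw
  fun_prop

theorem Problem.isCompact_points (P : Problem S X Y) : IsCompact P.points := by
  have : P.points = ⋃ r, (fun q : S × X → ℝ => P.point r (fun s x => q (s, x))) ''
      stdSimplex ℝ (S × X) := by
    ext z
    simp only [points, Set.mem_ofPred_eq, Set.mem_iUnion, Set.mem_image]
    refine exists_congr fun r => ⟨?_, ?_⟩
    · rintro ⟨q, h0, h1, rfl⟩
      exact ⟨fun z => q z.1 z.2, ⟨fun z => h0 _ _, by rw [Fintype.sum_prod_type]; exact h1⟩, rfl⟩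
    · rintro ⟨q, ⟨h0, h1⟩, rfl⟩
      exact ⟨_, fun s x => h0 _, by rw [Fintype.sum_prod_type] at h1; exact h1, rfl⟩
  rw [this]
  exact isCompact_iUnion fun r => (isCompact_stdSimplex ℝ _).image (P.continuous_point r)

theorem Problem.isCompact_hull (P : Problem S X Y) : IsCompact (convexHull ℝ P.points) :=
  isCompact_convexHull_of_linear P.isCompact_points (massMap S X) P.massMap_points

theorem Problem.points_nonempty (P : Problem S X Y) [Nonempty X] : P.points.Nonempty := by
  classical
  obtain ⟨s⟩ : Nonempty S := by
    by_contra h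
    rw [not_nonempty_iff] at h
    have := P.source.2.2
    simp at this
  obtain ⟨x⟩ := ‹Nonempty X›
  refine ⟨_, s, fun a b => if a = s ∧ b = x then 1 else 0, fun a b => by dsimp only; split_ifs <;> simp, ?_,
    rfl⟩
  simp [ite_and, Finset.sum_ite_irrel]

/-- The convex cone generated by the points. -/
def Problem.cone (P : Problem S X Y) : AddSubmonoid (Moments S X × ℝ) :=
  AddSubmonoid.closure {z | ∃ (r : S) (q : S → X → ℝ), (∀ s x, 0 ≤ q s x) ∧ z = P.point r q}

theorem Problem.point_mem_cone (P : Problem S X Y) (r : S) {q : S → X → ℝ}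
    (hq : ∀ s x, 0 ≤ q s x) : P.point r q ∈ P.cone :=
  AddSubmonoid.subset_closure ⟨r, q, hq, rfl⟩

theorem massMap_hull (P : Problem S X Y) {a : Moments S X × ℝ} (ha : a ∈ convexHull ℝ P.points) :
    massMap S X a = 1 := by
  have : convexHull ℝ P.points ⊆ {a | massMap S X a = 1} :=
    convexHull_min P.massMap_points (convex_hyperplane (massMap S X).isLinear 1)
  exact this ha

/-- By induction over the cone, every element is a nonnegative multiple of a hull point. The mass
equals one on the hull and therefore identifies the multiple. -/
theorem Problem.smul_mem_hull (P : Problem S X Y) [Nonempty X] {z : Moments S X × ℝ}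
    (hz : z ∈ P.cone) {c : ℝ} (hc : massMap S X z = c) (hc0 : 0 < c) :
    c⁻¹ • z ∈ convexHull ℝ P.points := by
  have key : ∃ t : ℝ, 0 ≤ t ∧ ∃ a ∈ convexHull ℝ P.points, z = t • a := by
    clear hc hc0
    obtain ⟨a₀, ha₀⟩ := P.points_nonempty
    have ha₀ := subset_convexHull ℝ _ ha₀
    induction hz using AddSubmonoid.closure_induction with
    | mem z hz =>
      obtain ⟨r, q, hq, rfl⟩ := hz
      have hT : 0 ≤ ∑ s, ∑ x, q s x := Finset.sum_nonneg fun s _ => Finset.sum_nonneg fun x _ => hq s x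
      rcases hT.eq_or_lt with h | h
      · have hz : q = fun _ _ => 0 := by
          funext s x
          have h1 := (Finset.sum_eq_zero_iff_of_nonneg
            (fun s _ => Finset.sum_nonneg fun x _ => hq s x)).1 h.symm s (Finset.mem_univ s)
          exact (Finset.sum_eq_zero_iff_of_nonneg fun x _ => hq s x).1 h1 x (Finset.mem_univ x)
        refine ⟨0, le_rfl, a₀, ha₀, ?_⟩
        have := P.point_smul r 0 q
        simpa [hz] using this
      · refine ⟨_, hT, _, subset_convexHull ℝ _
          ⟨r, fun s x => (∑ s, ∑ x, q s x)⁻¹ * q s x, fun s x => mul_nonneg (by positivity) (hq s x),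
            ?_, rfl⟩, ?_⟩
        · simp only [← Finset.mul_sum]
          exact inv_mul_cancel₀ h.ne'
        · rw [P.point_smul, smul_smul, mul_inv_cancel₀ h.ne', one_smul]
    | zero => exact ⟨0, le_rfl, a₀, ha₀, by simp⟩
    | add x y _ _ hx hy =>
      obtain ⟨t, ht, a, ha, rfl⟩ := hx
      obtain ⟨u, hu, b, hb, rfl⟩ := hy
      rcases (add_nonneg ht hu).eq_or_lt with h | h
      · have h1 : t = 0 := by linarith
        have h2 : u = 0 := by linarith
        exact ⟨0, le_rfl, a₀, ha₀, by simp [h1, h2]⟩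
      · refine ⟨t + u, h.le, (t / (t + u)) • a + (u / (t + u)) • b,
          convex_convexHull ℝ _ ha hb (by positivity) (by positivity) (by field_simp), ?_⟩
        rw [smul_add, smul_smul, smul_smul, mul_div_cancel₀ _ h.ne', mul_div_cancel₀ _ h.ne']
  obtain ⟨t, -, a, ha, rfl⟩ := key
  have : t = c := by
    rw [← hc, map_smul, massMap_hull P ha, smul_eq_mul, mul_one]
  rw [this, smul_smul, inv_mul_cancel₀ hc0.ne', one_smul]
  exact ha

/-- The output law of a vector of moments. -/
def Problem.momentOut (P : Problem S X Y) (z : Moments S X × ℝ) (y : Y) : ℝ :=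
  ∑ x, z.1.2.1 x * P.channel x y

theorem Problem.momentOut_point (P : Problem S X Y) (r : S) (q : S → X → ℝ) :
    P.momentOut (P.point r q) = outLaw (fun x y => P.channel x y) q := by
  funext y
  simp only [momentOut, P.point_input, outLaw, Finset.sum_mul]
  rw [Finset.sum_comm]

/-- The single-letter condition up to a slack `ε`, expressed in terms of moments. -/
def Problem.Feasible (P : Problem S X Y) (De Dr ε : ℝ) : Prop :=
  ∃ z ∈ convexHull ℝ P.points, z.1.1 = (fun s => P.source s) ∧
    -ε ≤ z.2 + ent (P.momentOut z) - ent (fun s => P.source s) ∧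
    z.1.2.2.1 ≤ De + ε ∧ z.1.2.2.2 ≤ Dr + ε

/-- Approximate feasibility implies feasibility, by compactness. -/
theorem Problem.Feasible.of_forall_pos {P : Problem S X Y} {De Dr : ℝ}
    (h : ∀ ε > 0, P.Feasible De Dr ε) : P.Feasible De Dr 0 := by
  -- The three inequalities are folded into one continuous maximum. On the compact set of hull
  -- points with the right source law it attains its minimum, which is at most every positive slack.
  have hcont : Continuous fun z : Moments S X × ℝ => max
      (-(z.2 + ent (P.momentOut z) - ent (fun s => P.source s)))
      (max (z.1.2.2.1 - De) (z.1.2.2.2 - Dr)) := by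
    unfold momentOut
    fun_prop
  have hcl : IsClosed {z : Moments S X × ℝ | z.1.1 = fun s => P.source s} :=
    isClosed_eq (by fun_prop) continuous_const
  have hne : (convexHull ℝ P.points ∩ {z | z.1.1 = fun s => P.source s}).Nonempty := by
    obtain ⟨z, hz, h1, -⟩ := h 1 one_pos
    exact ⟨z, hz, h1⟩
  obtain ⟨z, ⟨hz, hz1⟩, hmin⟩ :=
    (P.isCompact_hull.inter_right hcl).exists_isMinOn hne hcont.continuousOn
  have hle : max (-(z.2 + ent (P.momentOut z) - ent (fun s => P.source s)))
      (max (z.1.2.2.1 - De) (z.1.2.2.2 - Dr)) ≤ 0 := by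
    refine le_of_forall_pos_le_add fun ε hε => ?_
    obtain ⟨z', hz', h1, h2, h3, h4⟩ := h ε hε
    refine (hmin ⟨hz', h1⟩).trans ?_
    rw [zero_add]
    exact max_le (by linarith) (max_le (by linarith) (by linarith))
  rw [max_le_iff, max_le_iff] at hle
  exact ⟨z, hz, hz1, by linarith, by linarith, by linarith⟩

/-! ### Feasibility and the randomized condition -/

/-- The joint (sub-)law of source and channel input for a value of the auxiliary variable. -/
def Problem.slice (P : Problem S X Y) {U : Type*} [Fintype U] (pU : S → stdSimplex ℝ U)
    (pX : U → S → stdSimplex ℝ X) (u : U) (s : S) (x : X) : ℝ :=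
  P.source s * pU s u * pX u s x

section

variable {U : Type*} [Fintype U] (P : Problem S X Y) (pU : S → stdSimplex ℝ U)
    (pX : U → S → stdSimplex ℝ X)

theorem Problem.slice_nonneg (u : U) (s : S) (x : X) : 0 ≤ P.slice pU pX u s x :=
  mul_nonneg (mul_nonneg (P.source.2.1 s) ((pU s).2.1 u)) ((pX u s).2.1 x)

theorem Problem.srcLaw_slice (u : U) (s : S) :
    srcLaw (P.slice pU pX u) s = P.source s * pU s u := by
  have h : ∑ x, pX u s x = 1 := (pX u s).2.2
  simp only [srcLaw, slice, ← Finset.mul_sum, h, mul_one]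

theorem Problem.sum_srcLaw_slice (s : S) : ∑ u, srcLaw (P.slice pU pX u) s = P.source s := by
  have h : ∑ u, pU s u = 1 := (pU s).2.2
  simp only [P.srcLaw_slice, ← Finset.mul_sum, h, mul_one]

theorem Problem.expect_eq (h : S → U → X → ℝ) :
    P.expect pU pX h = ∑ u, ∑ s, ∑ x, P.slice pU pX u s x * h s u x := by
  have hc : ∀ x, ∑ y, P.channel x y = 1 := fun x => (P.channel x).2.2
  rw [expect, Finset.sum_comm]
  simp only [joint, ← Finset.sum_mul, ← Finset.mul_sum, hc, mul_one]
  rfl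

theorem mutualInfo_swap {A B : Type*} [Fintype A] [Fintype B] (p : A → B → ℝ) :
    mutualInfo (fun b a => p a b) = mutualInfo p := by
  rw [mutualInfo, mutualInfo, Finset.sum_comm]
  simp only [mul_comm (∑ b', p _ b')]

theorem Problem.sum_source : ∑ s, P.source s = 1 := P.source.2.2

theorem Problem.sum_channel (x : X) : ∑ y, P.channel x y = 1 := (P.channel x).2.2

theorem Problem.infoSU_eq :
    P.infoSU pU pX * log 2 =
      ent (fun s => P.source s) - ∑ u, ent (srcLaw (P.slice pU pX u)) := by
  have e : (fun (s : S) (u : U) => ∑ x, ∑ y, P.joint pU pX s u x y) =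
      fun s u => srcLaw (P.slice pU pX u) s := by
    funext s u
    have h : ∑ x, pX u s x = 1 := (pX u s).2.2
    simp only [joint, ← Finset.mul_sum, P.sum_channel, mul_one, P.srcLaw_slice, h]
  rw [infoSU, e, ← mutualInfo_swap, mutualInfo_eq_ent]
  · simp only [P.sum_srcLaw_slice]
  · exact fun u s => Finset.sum_nonneg fun x _ => P.slice_nonneg pU pX u s x
  · rw [Finset.sum_comm]
    simp only [P.sum_srcLaw_slice, P.sum_source]

theorem Problem.infoUY_eq :
    P.infoUY pU pX * log 2 =
      ent (fun y => ∑ u, outLaw (fun x y => P.channel x y) (P.slice pU pX u) y) -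
        ∑ u, ent (outLaw (fun x y => P.channel x y) (P.slice pU pX u)) := by
  have e : (fun (u : U) (y : Y) => ∑ s, ∑ x, P.joint pU pX s u x y) =
      fun u => outLaw (fun x y => P.channel x y) (P.slice pU pX u) := rfl
  rw [infoUY, e, mutualInfo_eq_ent]
  · exact fun u y => Finset.sum_nonneg fun s _ => Finset.sum_nonneg fun x _ =>
      mul_nonneg (P.slice_nonneg pU pX u s x) ((P.channel x).2.1 y)
  · have : ∀ u, ∑ y, outLaw (fun x y => P.channel x y) (P.slice pU pX u) y =
        ∑ s, srcLaw (P.slice pU pX u) s := by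
      intro u
      simp only [outLaw]
      rw [Finset.sum_comm]
      refine Finset.sum_congr rfl fun s _ => ?_
      rw [Finset.sum_comm]
      simp only [← Finset.mul_sum, P.sum_channel, mul_one]
      rfl
    simp only [this]
    rw [Finset.sum_comm]
    simp only [P.sum_srcLaw_slice, P.sum_source]

/-- The dependence on the auxiliary variable is additive over its values, apart from H(Y), which
depends only on the averaged input law. This is what turns the search for U into a question about
convex combinations. -/
theorem Problem.infoDiff_eq :
    (P.infoUY pU pX - P.infoSU pU pX) * log 2 =
      ∑ u, entDiff (fun x y => P.channel x y) (P.slice pU pX u) +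
        ent (fun y => ∑ u, outLaw (fun x y => P.channel x y) (P.slice pU pX u) y) -
        ent (fun s => P.source s) := by
  rw [sub_mul, infoUY_eq, infoSU_eq]
  simp only [entDiff, Finset.sum_sub_distrib]
  ring

end

theorem Problem.momentOut_sum (P : Problem S X Y) {ι : Type*} [Fintype ι] 
    (z : ι → Moments S X × ℝ) (y : Y) :
    P.momentOut (∑ i, z i) y = ∑ i, P.momentOut (z i) y := by
  simp only [momentOut, Prod.fst_sum, Prod.snd_sum, Finset.sum_apply, Finset.sum_mul]
  rw [Finset.sum_comm]

/-- The slices p(u,·,·), each with reconstruction letter g(u), sum to an element of the cone of mass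
one, hence to a point of the hull. -/
theorem Problem.RandomizedCondition.feasible {P : Problem S X Y} {De Dr : ℝ} {U : Type*}
    [Fintype U] (h : P.RandomizedCondition De Dr U) : P.Feasible De Dr 0 := by
  obtain ⟨pU, pX, g, h1, h2, h3⟩ := h
  have hX : Nonempty X := by
    have hs := P.source.2.2
    obtain ⟨s, -, -⟩ := Finset.exists_ne_zero_of_sum_ne_zero (hs.trans_ne one_ne_zero)
    obtain ⟨u, -, -⟩ := Finset.exists_ne_zero_of_sum_ne_zero ((pU s).2.2.trans_ne one_ne_zero)
    obtain ⟨x, -, -⟩ := Finset.exists_ne_zero_of_sum_ne_zero ((pX u s).2.2.trans_ne one_ne_zero)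
    exact ⟨x⟩
  set z := ∑ u, P.point (g u) (P.slice pU pX u) with hz
  have hz1 : z.1.1 = fun s => P.source s := by
    funext s
    simp only [hz, Prod.fst_sum, P.point_srcLaw, Finset.sum_apply, P.sum_srcLaw_slice]
  have hmass : massMap S X z = 1 := by
    change ∑ s, z.1.1 s = 1
    rw [hz1]; exact P.sum_source
  have hcone : z ∈ P.cone := P.cone.sum_mem fun u _ =>
    P.point_mem_cone (g u) fun s x => P.slice_nonneg pU pX u s x
  have hmem := P.smul_mem_hull hcone hmass one_pos
  rw [inv_one, one_smul] at hmem
  refine ⟨z, hmem, hz1, ?_, ?_, ?_⟩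
  · have := mul_nonneg h1 (log_pos one_lt_two).le
    rw [P.infoDiff_eq] at this
    have e1 : z.2 = ∑ u, entDiff (fun x y => P.channel x y) (P.slice pU pX u) := by
      simp [hz, Prod.snd_sum, point]
    have e2 : P.momentOut z =
        fun y => ∑ u, outLaw (fun x y => P.channel x y) (P.slice pU pX u) y := by
      funext y
      simp only [hz, P.momentOut_sum, P.momentOut_point]
    rwa [neg_zero, e1, e2]
  · rw [P.expect_eq] at h2
    simpa [hz, Prod.fst_sum, Prod.snd_sum, P.point_de] using h2
  · rw [P.expect_eq] at h3
    simpa [hz, Prod.fst_sum, Prod.snd_sum, P.point_dr] using h3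

/-- This count is the bound on the auxiliary alphabet: two marginals, two distortions and one
entropy difference. -/
theorem finrank_moments :
    Module.finrank ℝ (Moments S X × ℝ) = Fintype.card S + Fintype.card X + 3 := by
  simp [Moments]
  ring

/-- Conditional laws are obtained in multiplied-out form, which stays valid when the conditioning
event has mass zero: any law then serves. -/
theorem exists_stdSimplex_smul {B : Type*} [Fintype B] [Nonempty B] {v : B → ℝ}
    (hv : ∀ b, 0 ≤ v b) : ∃ p : stdSimplex ℝ B, ∀ b, (∑ b', v b') * p b = v b := by
  classical
  by_cases h : ∑ b, v b = 0
  · obtain ⟨b₀⟩ := ‹Nonempty B›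
    refine ⟨stdSimplex.vertex b₀, fun b => ?_⟩
    rw [h, zero_mul, (Finset.sum_eq_zero_iff_of_nonneg fun b _ => hv b).1 h b (Finset.mem_univ b)]
  · have h0 : 0 ≤ ∑ b, v b := Finset.sum_nonneg fun b _ => hv b
    exact ⟨⟨fun b => v b / ∑ b, v b, fun b => div_nonneg (hv b) h0,
      by rw [← Finset.sum_div, div_self h]⟩, fun b => mul_div_cancel₀ _ h⟩

/-- Read a Carathéodory decomposition backwards: the weights are p(u), the chosen laws are p(s,x|u),
the chosen letters are g(u). Bayes' rule yields p(u|s) and p(x|u,s), since the mixture has the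
prescribed source law. -/
theorem Problem.Feasible.randomized {P : Problem S X Y} {De Dr : ℝ} (h : P.Feasible De Dr 0) :
    P.RandomizedCondition De Dr (Fin (Fintype.card S + Fintype.card X + 3)) := by
  obtain ⟨z, hz, hz1, h1, h2, h3⟩ := h
  obtain ⟨a, w, ha, hw, rfl⟩ :=
    exists_convex_combination (massMap S X) P.massMap_points finrank_moments.le hz
  choose r q hq hq1 hpt using ha
  have hX : Nonempty X := by
    obtain ⟨s, -, hs⟩ := Finset.exists_ne_zero_of_sum_ne_zero ((hq1 0).trans_ne one_ne_zero)
    obtain ⟨x, -, -⟩ := Finset.exists_ne_zero_of_sum_ne_zero hs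
    exact ⟨x⟩
  choose pX hpX using fun i s => exists_stdSimplex_smul (v := q i s) (hq i s)
  have hsrc : ∀ s, ∑ i, w i * srcLaw (q i) s = P.source s := by
    intro s
    have := congrFun hz1 s
    simpa [Prod.fst_sum, hpt, P.point_srcLaw] using this
  choose pU hpU using fun s => exists_stdSimplex_smul (v := fun i => w i * srcLaw (q i) s)
    fun i => mul_nonneg (hw.1 i) (Finset.sum_nonneg fun x _ => hq i s x)
  have hslice : ∀ i, P.slice pU pX i = fun s x => w i * q i s x := by
    intro i; funext s x
    have h := hpU s i
    rw [hsrc] at h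
    rw [slice, h, mul_assoc, ← hpX i s x]
    rfl
  refine ⟨pU, pX, r, ?_, ?_, ?_⟩
  · have hl : 0 < log 2 := log_pos one_lt_two
    refine le_of_mul_le_mul_right ?_ hl
    rw [P.infoDiff_eq, zero_mul]
    have e1 : (∑ i, w i • a i).2 =
        ∑ u, entDiff (fun x y => P.channel x y) (P.slice pU pX u) := by
      simp [Prod.snd_sum, hpt, point, hslice, entDiff_smul]
    have e2 : P.momentOut (∑ i, w i • a i) =
        fun y => ∑ u, outLaw (fun x y => P.channel x y) (P.slice pU pX u) y := by
      funext y
      simp only [P.momentOut_sum]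
      refine Finset.sum_congr rfl fun i _ => ?_
      rw [hslice, hpt, ← P.point_smul, P.momentOut_point]
    rwa [neg_zero, e1, e2] at h1
  · rw [P.expect_eq]
    simp only [hslice]
    simpa [Prod.fst_sum, Prod.snd_sum, hpt, P.point_de, Finset.mul_sum, mul_assoc] using h2
  · rw [P.expect_eq]
    simp only [hslice]
    simpa [Prod.fst_sum, Prod.snd_sum, hpt, P.point_dr, Finset.mul_sum, mul_assoc] using h3

end Region

/-! ### Product laws -/

section Product

variable {ι B : Type*} [Fintype ι] [DecidableEq ι] [Fintype B]

theorem sum_pi_eval {f : ι → B → ℝ} (hf : ∀ i, ∑ b, f i b = 1) (i : ι) (G : B → ℝ) :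
    ∑ c : ι → B, (∏ j, f j (c j)) * G (c i) = ∑ b, f i b * G b := by
  -- A function of one coordinate is inserted as a factor equal to one at every other site, so that
  -- the sum over words factorises.
  have h := sum_prod_pi (fun j b => f j b * if j = i then G b else 1)
  have e : ∀ c : ι → B, ∏ j, (f j (c j) * if j = i then G (c j) else 1) =
      (∏ j, f j (c j)) * G (c i) := by
    intro c
    rw [Finset.prod_mul_distrib, Finset.prod_ite_eq']
    simp
  simp only [e] at h
  rw [h, Finset.prod_eq_single i]
  · simp
  · intro j _ hj
    simp [hj, hf]
  · simp

theorem sum_pi {f : ι → B → ℝ} (hf : ∀ i, ∑ b, f i b = 1) :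
    ∑ c : ι → B, ∏ j, f j (c j) = 1 := by
  rw [sum_prod_pi]
  simp [hf]

theorem sum_pi_eval_pair {f : ι → B → ℝ} (hf : ∀ i, ∑ b, f i b = 1) {i k : ι} (hik : i ≠ k)
    (G H : B → ℝ) :
    ∑ c : ι → B, (∏ j, f j (c j)) * (G (c i) * H (c k)) =
      (∑ b, f i b * G b) * ∑ b, f k b * H b := by
  have h := sum_prod_pi
    (fun j b => f j b * ((if j = i then G b else 1) * if j = k then H b else 1))
  have e : ∀ c : ι → B, ∏ j, (f j (c j) * ((if j = i then G (c j) else 1) *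
      if j = k then H (c j) else 1)) = (∏ j, f j (c j)) * (G (c i) * H (c k)) := by
    intro c
    rw [Finset.prod_mul_distrib, Finset.prod_mul_distrib, Finset.prod_ite_eq', Finset.prod_ite_eq']
    simp
  simp only [e] at h
  rw [h, ← Finset.mul_prod_erase _ _ (Finset.mem_univ i),
    ← Finset.mul_prod_erase (univ.erase i) _ (Finset.mem_erase.2 ⟨hik.symm, Finset.mem_univ k⟩),
    Finset.prod_eq_one]
  · simp [hik, hik.symm]
  · intro j hj
    simp only [Finset.mem_erase] at hj
    simp [hj.1, hj.2.1, hf]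

theorem sum_pi_eval_eval {f : ι → B → ℝ} (hf : ∀ i, ∑ b, f i b = 1) {i k : ι} (hik : i ≠ k)
    (G : B → B → ℝ) :
    ∑ c : ι → B, (∏ j, f j (c j)) * G (c i) (c k) = ∑ a, ∑ b, f i a * f k b * G a b := by
  classical
  have e : ∀ c : ι → B, G (c i) (c k) = ∑ a, (if c i = a then 1 else 0) * G a (c k) := by
    intro c; simp
  simp only [e, Finset.mul_sum]
  rw [Finset.sum_comm]
  refine Finset.sum_congr rfl fun a _ => ?_
  rw [sum_pi_eval_pair hf hik (fun b => if b = a then 1 else 0) (G a)]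
  simp [Finset.mul_sum, mul_assoc]

end Product

/-! ### Block entropies -/

section BlockEntropy

variable {B : Type*} [Fintype B]

theorem ent_pi {p : B → ℝ} (hp : ∑ b, p b = 1) (n : ℕ) :
    ent (fun s : Fin n → B => ∏ i, p (s i)) = n * ent p := by
  rw [ent_of_sum_eq_one (sum_pi (f := fun _ => p) fun _ => hp), ent_of_sum_eq_one hp]
  have e : ∀ s : Fin n → B, negMulLog (∏ i, p (s i)) =
      ∑ i, (∏ j, p (s j)) * (-log (p (s i))) := by
    intro s
    by_cases h : ∀ i, p (s i) ≠ 0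
    · rw [negMulLog, log_prod (fun i _ => h i), ← Finset.mul_sum, Finset.sum_neg_distrib]
      ring
    · push Not at h
      obtain ⟨i, hi⟩ := h
      have : ∏ j, p (s j) = 0 := Finset.prod_eq_zero (Finset.mem_univ i) hi
      simp [this]
  simp only [e]
  rw [Finset.sum_comm]
  simp only [sum_pi_eval (f := fun (_ : Fin n) => p) (fun _ => hp) _ (fun b => -log (p b))]
  simp [negMulLog]

/-- Gibbs' inequality against the product of the averaged marginal gives subadditivity and concavity
of entropy in one step. -/
theorem ent_le_of_marginals [DecidableEq B] {n : ℕ} (hn : n ≠ 0) {T : (Fin n → B) → ℝ}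
    (hT : ∀ y, 0 ≤ T y) (hT1 : ∑ y, T y = 1) {m : B → ℝ}
    (hm : ∀ b, n * m b = ∑ y, T y * ∑ i, if y i = b then 1 else 0) :
    ent T ≤ n * ent m := by
  have hn' : (0 : ℝ) < n := by positivity
  have hm0 : ∀ b, 0 ≤ m b := fun b => by
    have : 0 ≤ n * m b := by
      rw [hm]
      exact Finset.sum_nonneg fun y _ => mul_nonneg (hT y)
        (Finset.sum_nonneg fun i _ => by split_ifs <;> simp)
    exact nonneg_of_mul_nonneg_right this hn'
  have hsum : ∀ G : B → ℝ, n * ∑ b, m b * G b = ∑ y, T y * ∑ i, G (y i) := by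
    intro G
    simp only [Finset.mul_sum, ← mul_assoc, hm]
    simp only [Finset.sum_mul]
    rw [Finset.sum_comm]
    refine Finset.sum_congr rfl fun y _ => ?_
    rw [Finset.sum_comm]
    refine Finset.sum_congr rfl fun i _ => ?_
    simp
  have hm1 : ∑ b, m b = 1 := by
    have := hsum fun _ => 1
    simp only [mul_one, Finset.sum_const, Finset.card_univ, Fintype.card_fin, nsmul_eq_mul,
      ← Finset.sum_mul, hT1] at this
    exact mul_left_cancel₀ hn'.ne' (by linarith)
  -- Absolute continuity: a word containing a letter of averaged frequency zero has probability
  -- zero.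
  have hz : ∀ y i, m (y i) = 0 → T y = 0 := by
    intro y i h
    have h0 := hm (y i)
    rw [h, mul_zero] at h0
    have h1 := (Finset.sum_eq_zero_iff_of_nonneg (fun y' _ => mul_nonneg (hT y')
        (Finset.sum_nonneg fun j _ => by split_ifs <;> simp))).1 h0.symm y (Finset.mem_univ y)
    rcases mul_eq_zero.1 h1 with h2 | h2
    · exact h2
    · have := (Finset.sum_eq_zero_iff_of_nonneg
        (fun j _ => by split_ifs <;> simp)).1 h2 i (Finset.mem_univ i)
      simp at this
  refine (ent_le_cross (w := fun y : Fin n → B => ∏ i, m (y i)) hT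
    (fun y => Finset.prod_nonneg fun i _ => hm0 _)
    (sum_pi (f := fun _ => m) fun _ => hm1).le ?_).trans (le_of_eq ?_)
  · intro y h
    obtain ⟨i, -, hi⟩ := Finset.prod_eq_zero_iff.1 h
    exact hz y i hi
  · rw [ent_of_sum_eq_one hm1]
    have := hsum fun b => -log (m b)
    simp only [negMulLog]
    simp only [mul_neg, Finset.sum_neg_distrib, neg_mul] at this ⊢
    rw [this]
    congr 1
    refine Finset.sum_congr rfl fun y _ => ?_
    by_cases h : ∀ i, m (y i) ≠ 0
    · rw [log_prod (fun i _ => h i)]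
    · push Not at h
      obtain ⟨i, hi⟩ := h
      rw [hz y i hi, zero_mul, zero_mul]

variable {S X Y R : Type*} [Fintype S] [Fintype X] [Fintype Y] [Fintype R]

/-- The right-hand side is H(S|R) - H(Y|R). Both conditional entropies are expanded through H(R),
which cancels; then H(R|S) ≥ 0 is dropped and H(R|Y) remains as the loss. -/
theorem sum_entDiff_ge {w : X → Y → ℝ} (hw : ∀ x, ∑ y, w x y = 1)
    {Q : R → S → X → ℝ} (hQ : ∀ r s x, 0 ≤ Q r s x) :
    ent (fun s => ∑ r, srcLaw (Q r) s) - ent (fun y => ∑ r, outLaw w (Q r) y) -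
      ∑ y, ent (fun r => outLaw w (Q r) y) ≤ ∑ r, entDiff w (Q r) := by
  have h1 := (ent_chain (fun r s => srcLaw (Q r) s)).symm.trans
    (ent_chain' (fun r s => srcLaw (Q r) s))
  have h2 := (ent_chain (fun r y => outLaw w (Q r) y)).symm.trans
    (ent_chain' (fun r y => outLaw w (Q r) y))
  have h3 : (fun r => ∑ s, srcLaw (Q r) s) = fun r => ∑ y, outLaw w (Q r) y := by
    funext r
    simp only [outLaw]
    rw [Finset.sum_comm (s := (univ : Finset Y))]
    refine Finset.sum_congr rfl fun s _ => ?_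
    rw [Finset.sum_comm (s := (univ : Finset Y))]
    simp only [← Finset.mul_sum, hw, mul_one]
    rfl
  rw [h3] at h1
  have h4 : 0 ≤ ∑ s, ent (fun r => srcLaw (Q r) s) :=
    Finset.sum_nonneg fun s _ => ent_nonneg fun r => Finset.sum_nonneg fun x _ => hQ r s x
  have h5 : ∑ r, entDiff w (Q r) = ∑ r, ent (fun s => srcLaw (Q r) s) -
    ∑ r, ent (fun y => outLaw w (Q r) y) := by
    rw [← Finset.sum_sub_distrib]
    rfl
  rw [h5]
  linarith

end BlockEntropy

/-! ### Expectations under the law of a scheme -/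

section Avg

variable {S X Y : Type*} [Fintype S] [Fintype X] [Fintype Y] {n : ℕ}

/-- The expectation under the law of a scheme. -/
def Scheme.avg (P : Problem S X Y) (A : Scheme S X Y n) (W : BlockChannel X Y n)
    (F : (Fin A.k → Bool) → (Fin n → S) → (Fin n → X) → (Fin n → S) → (Fin n → Y) →
      Option (Fin n → S) → ℝ) : ℝ :=
  ∑ θ, ∑ s, ∑ x, ∑ r, ∑ y, ∑ φ, A.law P W s θ x r y φ * F θ s x r y φ

variable (P : Problem S X Y) (A : Scheme S X Y n) (W : BlockChannel X Y n)

open scoped Classical in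
theorem Scheme.prob_eq_avg (E : (Fin n → S) → (Fin n → X) → (Fin n → S) → (Fin n → Y) →
    Option (Fin n → S) → Prop) :
    A.prob P W E = A.avg P W (fun _ s x r y φ => if E s x r y φ then 1 else 0) := by
  simp only [prob, avg, mul_ite, mul_one, mul_zero]

theorem Scheme.law_nonneg (s : Fin n → S) (θ : Fin A.k → Bool) (x : Fin n → X) (r : Fin n → S)
    (y : Fin n → Y) (φ : Option (Fin n → S)) : 0 ≤ A.law P W s θ x r y φ := by
  have h1 := (A.encoder s θ).2.1 x
  have h2 := (A.authentic s θ x).2.1 r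
  have h3 := (W x).2.1 y
  have h4 := (A.decoder y θ).2.1 φ
  have h5 : 0 ≤ ∏ i, P.source (s i) := Finset.prod_nonneg fun i _ => P.source.2.1 _
  exact mul_nonneg (mul_nonneg (mul_nonneg (mul_nonneg (mul_nonneg h5 (by positivity)) h1) h2) h3)
    h4

variable {P A W}

theorem Scheme.avg_mono {F G : (Fin A.k → Bool) → (Fin n → S) → (Fin n → X) → (Fin n → S) →
    (Fin n → Y) → Option (Fin n → S) → ℝ} (h : ∀ θ s x r y φ, F θ s x r y φ ≤ G θ s x r y φ) :
    A.avg P W F ≤ A.avg P W G := by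
  unfold avg
  gcongr with θ _ s _ x _ r _ y _ φ _
  · exact A.law_nonneg P W s θ x r y φ
  · exact h θ s x r y φ

theorem Scheme.avg_add (F G : (Fin A.k → Bool) → (Fin n → S) → (Fin n → X) → (Fin n → S) →
    (Fin n → Y) → Option (Fin n → S) → ℝ) :
    A.avg P W (fun θ s x r y φ => F θ s x r y φ + G θ s x r y φ) = A.avg P W F + A.avg P W G := by
  simp only [avg, mul_add, Finset.sum_add_distrib]

theorem Scheme.avg_const_mul (c : ℝ) (F : (Fin A.k → Bool) → (Fin n → S) → (Fin n → X) →
    (Fin n → S) → (Fin n → Y) → Option (Fin n → S) → ℝ) :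
    A.avg P W (fun θ s x r y φ => c * F θ s x r y φ) = c * A.avg P W F := by
  simp only [avg, mul_left_comm _ c, ← Finset.mul_sum]

variable (P A) in
/-- The joint law of key, authentic reconstruction, source block and channel input. -/
def Scheme.inputLaw (θ : Fin A.k → Bool) (r : Fin n → S) (s : Fin n → S) (x : Fin n → X) : ℝ :=
  (∏ i, P.source (s i)) * (1 / 2 ^ A.k) * A.encoder s θ x * A.authentic s θ x r

theorem Scheme.inputLaw_nonneg (θ : Fin A.k → Bool) (r : Fin n → S) (s : Fin n → S)
    (x : Fin n → X) : 0 ≤ A.inputLaw P θ r s x := by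
  have h1 := (A.encoder s θ).2.1 x
  have h2 := (A.authentic s θ x).2.1 r
  have h5 : 0 ≤ ∏ i, P.source (s i) := Finset.prod_nonneg fun i _ => P.source.2.1 _
  exact mul_nonneg (mul_nonneg (mul_nonneg h5 (by positivity)) h1) h2

theorem Scheme.avg_eq (F : (Fin A.k → Bool) → (Fin n → S) → (Fin n → X) → (Fin n → S) →
    (Fin n → Y) → Option (Fin n → S) → ℝ) :
    A.avg P W F = ∑ θ, ∑ r, ∑ s, ∑ x, A.inputLaw P θ r s x *
      ∑ y, W x y * ∑ φ, A.decoder y θ φ * F θ s x r y φ := by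
  unfold avg
  refine Finset.sum_congr rfl fun θ _ => ?_
  rw [Finset.sum_comm (s := (univ : Finset (Fin n → S)))
    (f := fun r s => ∑ x, A.inputLaw P θ r s x * ∑ y, W x y * ∑ φ, A.decoder y θ φ * F θ s x r y φ)]
  refine Finset.sum_congr rfl fun s _ => ?_
  rw [Finset.sum_comm (s := (univ : Finset (Fin n → S)))]
  simp only [Finset.mul_sum, law, inputLaw, mul_assoc]

theorem Scheme.avg_input (F : (Fin A.k → Bool) → (Fin n → S) → (Fin n → X) → (Fin n → S) → ℝ) :
    A.avg P W (fun θ s x r _ _ => F θ s x r) =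
      ∑ θ, ∑ r, ∑ s, ∑ x, A.inputLaw P θ r s x * F θ s x r := by
  have h1 : ∀ y θ, ∑ φ, A.decoder y θ φ = 1 := fun y θ => (A.decoder y θ).2.2
  have h2 : ∀ x, ∑ y, W x y = 1 := fun x => (W x).2.2
  simp only [avg_eq, ← Finset.sum_mul, h1, h2, one_mul]

theorem Scheme.srcLaw_inputLaw (θ : Fin A.k → Bool) (s : Fin n → S) :
    ∑ r, srcLaw (A.inputLaw P θ r) s = (1 / 2 ^ A.k) * ∏ i, P.source (s i) := by
  have h1 : ∑ x, A.encoder s θ x = 1 := (A.encoder s θ).2.2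
  have h2 : ∀ x, ∑ r, A.authentic s θ x r = 1 := fun x => (A.authentic s θ x).2.2
  simp only [srcLaw, inputLaw]
  rw [Finset.sum_comm]
  simp only [← Finset.mul_sum, h1, h2, mul_one]
  ring

theorem Scheme.avg_source (F : (Fin n → S) → ℝ) :
    A.avg P W (fun _ s _ _ _ _ => F s) = ∑ s, (∏ i, P.source (s i)) * F s := by
  have e : ∀ θ : Fin A.k → Bool, ∑ r, ∑ s, ∑ x, A.inputLaw P θ r s x * F s =
      (1 / 2 ^ A.k) * ∑ s, (∏ i, P.source (s i)) * F s := by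
    intro θ
    rw [Finset.sum_comm, Finset.mul_sum]
    refine Finset.sum_congr rfl fun s _ => ?_
    rw [← mul_assoc, ← Scheme.srcLaw_inputLaw θ s, Finset.sum_mul]
    simp only [srcLaw, Finset.sum_mul]
  rw [avg_input, Finset.sum_congr rfl fun θ _ => e θ]
  simp

theorem Scheme.avg_one : A.avg P W (fun _ _ _ _ _ _ => 1) = 1 := by
  rw [avg_source]
  simp only [mul_one]
  exact sum_pi (f := fun _ s => P.source s) fun _ => P.sum_source

/-- Because distortions are bounded, a small probability of excess controls the mean distortion,
which is what the single-letter moments record. -/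
theorem Scheme.avg_le_of_event (C D : ℝ)
    {E : (Fin n → S) → (Fin n → X) → (Fin n → S) → (Fin n → Y) → Option (Fin n → S) → Prop}
    {F : (Fin n → S) → (Fin n → X) → (Fin n → S) → (Fin n → Y) → Option (Fin n → S) → ℝ}
    (h1 : ∀ s x r y φ, ¬ E s x r y φ → F s x r y φ ≤ D)
    (h2 : ∀ s x r y φ, E s x r y φ → F s x r y φ ≤ D + C) :
    A.avg P W (fun _ => F) ≤ D + C * A.prob P W E := by
  classical
  have hD : D = A.avg P W (fun _ _ _ _ _ _ => D * 1) := by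
    rw [avg_const_mul, avg_one, mul_one]
  rw [Scheme.prob_eq_avg, ← avg_const_mul]
  conv_rhs => rw [hD, ← avg_add]
  refine avg_mono fun θ s x r y φ => ?_
  split_ifs with h
  · simpa using h2 s x r y φ h
  · simpa using h1 s x r y φ h

end Avg

/-! ### The converse -/

section Converse

variable {S X Y : Type*} [Fintype S] [Fintype X] [Fintype Y] {n : ℕ}

theorem Problem.reference_apply (P : Problem S X Y) (x : Fin n → X) (y : Fin n → Y) :
    P.reference n x y = nfold (fun x y => P.channel x y) x y := rfl

/-- The decoder output differs from the authentic reconstruction. -/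
def MismatchEvent (_s : Fin n → S) (_x : Fin n → X) (r : Fin n → S) (_y : Fin n → Y)
    (φ : Option (Fin n → S)) : Prop := φ ≠ some r

variable (P : Problem S X Y) (A : Scheme S X Y n)

/-- The block version of `Problem.point` for the joint law induced by a scheme. -/
def Scheme.total : Moments S X × ℝ :=
  ∑ θ, ∑ r, (∑ s, ∑ x, A.inputLaw P θ r s x • ∑ i, P.feature (r i) (s i) (x i),
    entDiff (nfold fun x y => P.channel x y) (A.inputLaw P θ r))

theorem Scheme.total_mem_cone : A.total P ∈ P.cone :=
  P.cone.sum_mem fun θ _ => P.cone.sum_mem fun r _ =>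
    blockFunctional_mem _ (fun x y => (P.channel x).2.1 y) P.sum_channel P.cone
      (fun i => P.feature (r i)) (fun i _ hq => P.point_mem_cone (r i) hq) _
      fun s x => A.inputLaw_nonneg θ r s x

theorem Scheme.total_fst : (A.total P).1 = ∑ θ, ∑ r, ∑ s, ∑ x,
    A.inputLaw P θ r s x • ∑ i, P.feature (r i) (s i) (x i) := by
  simp only [total, Prod.fst_sum]

theorem Scheme.total_src (a : S) : (A.total P).1.1 a = n * P.source a := by
  classical
  have e := A.avg_source (P := P) (W := P.reference n) fun s => ∑ i, if a = s i then 1 else 0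
  rw [A.avg_input (P := P) (W := P.reference n)
    (fun _ s _ _ => ∑ i, if a = s i then (1 : ℝ) else 0)] at e
  rw [total_fst]
  simp only [Prod.fst_sum, Prod.smul_fst, Problem.feature, Finset.sum_apply, Pi.smul_apply,
    Pi.single_apply, smul_eq_mul]
  rw [e]
  simp only [Finset.mul_sum]
  rw [Finset.sum_comm]
  simp only [sum_pi_eval (f := fun (_ : Fin n) s => P.source s) (fun _ => P.sum_source) _
    (fun b => if a = b then 1 else 0)]
  simp

theorem Scheme.total_de : (A.total P).1.2.2.1 =
    A.avg P (P.reference n) (fun _ s x _ _ _ => ∑ i, (P.de (s i) (x i) : ℝ)) := by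
  rw [total_fst, avg_input (F := fun _ s x _ => ∑ i, (P.de (s i) (x i) : ℝ))]
  simp only [Prod.fst_sum, Prod.snd_sum, Prod.smul_fst, Prod.smul_snd, Problem.feature, smul_eq_mul]

theorem Scheme.total_dr : (A.total P).1.2.2.2 =
    A.avg P (P.reference n) (fun _ s _ r _ _ => ∑ i, (P.dr (s i) (r i) : ℝ)) := by
  rw [total_fst, avg_input (F := fun _ s x r => ∑ i, (P.dr (s i) (r i) : ℝ))]
  simp only [Prod.snd_sum, Prod.smul_snd, Problem.feature, smul_eq_mul]

/-- The law of the channel output when the reference channel is in effect. -/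
def Scheme.outputLaw (y : Fin n → Y) : ℝ :=
  ∑ θ, ∑ r, outLaw (nfold fun x y => P.channel x y) (A.inputLaw P θ r) y

theorem Scheme.sum_outputLaw_mul (G : (Fin n → Y) → ℝ) :
    ∑ y, A.outputLaw P y * G y = A.avg P (P.reference n) (fun _ _ _ _ y _ => G y) := by
  have h1 : ∀ y θ, ∑ φ, A.decoder y θ φ = 1 := fun y θ => (A.decoder y θ).2.2
  simp only [avg_eq, ← Finset.sum_mul, h1, one_mul]
  simp only [outputLaw, outLaw, Finset.sum_mul, Finset.mul_sum]
  rw [Finset.sum_comm]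
  refine Finset.sum_congr rfl fun θ _ => ?_
  rw [Finset.sum_comm]
  refine Finset.sum_congr rfl fun r _ => ?_
  rw [Finset.sum_comm]
  refine Finset.sum_congr rfl fun s _ => ?_
  rw [Finset.sum_comm]
  refine Finset.sum_congr rfl fun x _ => Finset.sum_congr rfl fun y _ => ?_
  rw [P.reference_apply]; ring

theorem Scheme.outLaw_inputLaw_nonneg (θ : Fin A.k → Bool) (r : Fin n → S) (y : Fin n → Y) :
    0 ≤ outLaw (nfold fun x y => P.channel x y) (A.inputLaw P θ r) y :=
  Finset.sum_nonneg fun s _ => Finset.sum_nonneg fun x _ =>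
    mul_nonneg (A.inputLaw_nonneg θ r s x) (nfold_nonneg (fun x y => (P.channel x).2.1 y) x y)

-- The moments of the whole block determine the sum of the output marginals, in the form that
-- `ent_le_of_marginals` requires.
open scoped Classical in
theorem Scheme.momentOut_total (b : Y) :
    P.momentOut (A.total P) b = ∑ y, A.outputLaw P y * ∑ i, if y i = b then 1 else 0 := by
  rw [A.sum_outputLaw_mul P fun y => ∑ i, if y i = b then 1 else 0, avg_eq]
  have h1 : ∀ y θ, ∑ φ, A.decoder y θ φ = 1 := fun y θ => (A.decoder y θ).2.2
  simp only [← Finset.sum_mul, h1, one_mul, P.reference_apply]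
  have h2 : ∀ x : Fin n → X, ∑ y, nfold (fun x y => P.channel x y) x y *
      ∑ i, (if y i = b then (1 : ℝ) else 0) = ∑ i, P.channel (x i) b := by
    intro x
    simp only [Finset.mul_sum]
    rw [Finset.sum_comm]
    refine Finset.sum_congr rfl fun i _ => ?_
    have := sum_pi_eval (f := fun i b => P.channel (x i) b) (fun i => P.sum_channel _) i
      (fun c => if c = b then 1 else 0)
    simp only [nfold]
    rw [this]
    simp
  simp only [h2, Problem.momentOut]
  rw [total_fst]
  simp only [Prod.fst_sum, Prod.snd_sum, Prod.smul_fst, Prod.smul_snd, Problem.feature,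
    Finset.sum_apply, Pi.smul_apply, Pi.single_apply, smul_eq_mul, Finset.sum_mul]
  rw [Finset.sum_comm]
  refine Finset.sum_congr rfl fun θ _ => ?_
  rw [Finset.sum_comm]
  refine Finset.sum_congr rfl fun r _ => ?_
  rw [Finset.sum_comm]
  refine Finset.sum_congr rfl fun s _ => ?_
  rw [Finset.sum_comm]
  refine Finset.sum_congr rfl fun x _ => ?_
  simp only [mul_assoc, ← Finset.mul_sum, Finset.sum_mul]
  congr 1
  rw [Finset.sum_comm]
  simp

/-- `sum_entDiff_ge` is summed over the keys. The source entropy is unaffected because the key is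
independent of the source, the output entropy can only drop under conditioning on the key, and
H(R|Y,key) is bounded by Fano's inequality with the decoder as a randomized estimator. -/
theorem Scheme.total_entDiff_ge :
    n * ent (fun s => P.source s) - ent (A.outputLaw P) -
      (log 2 + n * log (Fintype.card S) * A.prob P (P.reference n) MismatchEvent) ≤
      (A.total P).2 := by
  classical
  have hne : Nonempty S := by
    by_contra h
    rw [not_nonempty_iff] at h
    have := P.sum_source
    simp at this
  set w : (Fin n → X) → (Fin n → Y) → ℝ := nfold fun x y => P.channel x y with hw
  have hw1 : ∀ x, ∑ y, w x y = 1 := sum_nfold P.sum_channel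
  have hO := A.outLaw_inputLaw_nonneg P
  have h1 : ∀ θ, ent (fun s => ∑ r, srcLaw (A.inputLaw P θ r) s) =
      (1 / 2 ^ A.k) * (n * ent (fun s => P.source s)) := by
    intro θ
    simp only [A.srcLaw_inputLaw]
    rw [ent_smul, ent_pi P.sum_source]
  have h2 : ∑ θ, ent (fun y => ∑ r, outLaw w (A.inputLaw P θ r) y) ≤ ent (A.outputLaw P) :=
    sum_ent_le_ent_sum fun θ y => Finset.sum_nonneg fun r _ => hO θ r y
  have h3 : ∑ θ, ∑ y, ent (fun r => outLaw w (A.inputLaw P θ r) y) ≤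
      log 2 + n * log (Fintype.card S) * A.prob P (P.reference n) MismatchEvent := by
    have hf : ∀ θ y, ent (fun r => outLaw w (A.inputLaw P θ r) y) ≤
        (∑ r, outLaw w (A.inputLaw P θ r) y) * log 2 + log (Fintype.card (Fin n → S)) *
          ∑ φ, ∑ r, if φ ≠ some r then outLaw w (A.inputLaw P θ r) y * A.decoder y θ φ else 0 :=
      fun θ y => ent_le_fano (hO θ · y) _ (A.decoder y θ).2.1 (A.decoder y θ).2.2
    refine (Finset.sum_le_sum fun θ _ => Finset.sum_le_sum fun y _ => hf θ y).trans (le_of_eq ?_)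
    simp only [Finset.sum_add_distrib, ← Finset.sum_mul, ← Finset.mul_sum]
    congr 1
    · have := A.sum_outputLaw_mul P fun _ => 1
      simp only [mul_one, A.avg_one, outputLaw] at this
      rw [Finset.sum_comm] at this
      rw [this, one_mul]
    · have hc : log (Fintype.card (Fin n → S)) = n * log (Fintype.card S) := by
        simp
      rw [hc, prob_eq_avg, avg_eq]
      congr 1
      refine Finset.sum_congr rfl fun θ _ => ?_
      have e1 : ∀ y, ∑ φ, ∑ r, (if φ ≠ some r then
          outLaw w (A.inputLaw P θ r) y * A.decoder y θ φ else 0) =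
          ∑ r, outLaw w (A.inputLaw P θ r) y *
            ∑ φ, A.decoder y θ φ * if φ ≠ some r then 1 else 0 := by
        intro y
        rw [Finset.sum_comm]
        refine Finset.sum_congr rfl fun r _ => ?_
        rw [Finset.mul_sum]
        refine Finset.sum_congr rfl fun φ _ => ?_
        split_ifs <;> simp
      simp only [e1]
      rw [Finset.sum_comm]
      refine Finset.sum_congr rfl fun r _ => ?_
      simp only [outLaw, Finset.sum_mul]
      rw [Finset.sum_comm]
      refine Finset.sum_congr rfl fun s _ => ?_
      rw [Finset.sum_comm]
      refine Finset.sum_congr rfl fun x _ => ?_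
      rw [Finset.mul_sum]
      refine Finset.sum_congr rfl fun y _ => ?_
      simp only [P.reference_apply, hw, MismatchEvent, mul_assoc]
      refine congrArg _ (congrArg _ (Finset.sum_congr rfl fun φ _ => ?_))
      by_cases h : φ = some r <;> simp [h]
  have h4 : (A.total P).2 = ∑ θ, ∑ r, entDiff w (A.inputLaw P θ r) := by
    simp only [total, Prod.snd_sum, hw]
  have h5 := Finset.sum_le_sum fun θ (_ : θ ∈ (univ : Finset (Fin A.k → Bool))) =>
    sum_entDiff_ge (w := w) hw1 (Q := A.inputLaw P θ) (A.inputLaw_nonneg θ)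
  simp only [Finset.sum_sub_distrib, h1] at h5
  rw [h4]
  have h6 : ∑ _θ : Fin A.k → Bool, (1 / 2 ^ A.k : ℝ) * (n * ent (fun s => P.source s)) =
      n * ent (fun s => P.source s) := by
    simp
  rw [h6] at h5
  linarith

/-- The block total lies in the cone and has mass n, so division by n puts it in the hull. The
averaged output marginal then dominates H(Y^n)/n. -/
theorem Scheme.exists_hull_point (hn : n ≠ 0) :
    ∃ z ∈ convexHull ℝ P.points, z.1.1 = (fun s => P.source s) ∧
      -(log 2 / n + log (Fintype.card S) * A.prob P (P.reference n) MismatchEvent) ≤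
        z.2 + ent (P.momentOut z) - ent (fun s => P.source s) ∧
      z.1.2.2.1 = A.avg P (P.reference n)
        (fun _ s x _ _ _ => (1 / (n : ℝ)) * ∑ i, (P.de (s i) (x i) : ℝ)) ∧
      z.1.2.2.2 = A.avg P (P.reference n)
        (fun _ s _ r _ _ => (1 / (n : ℝ)) * ∑ i, (P.dr (s i) (r i) : ℝ)) := by
  classical
  have hn' : (0 : ℝ) < n := by positivity
  have hX : Nonempty X := by
    have hs := P.sum_source
    obtain ⟨s, -, -⟩ := Finset.exists_ne_zero_of_sum_ne_zero (hs.trans_ne one_ne_zero)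
    obtain ⟨x, -, -⟩ := Finset.exists_ne_zero_of_sum_ne_zero
      ((A.encoder (fun _ => s) (fun _ => true)).2.2.trans_ne one_ne_zero)
    exact ⟨x ⟨0, by omega⟩⟩
  have hmass : massMap S X (A.total P) = n := by
    change ∑ s, (A.total P).1.1 s = n
    simp only [A.total_src, ← Finset.mul_sum, P.sum_source, mul_one]
  refine ⟨_, P.smul_mem_hull (A.total_mem_cone P) hmass hn', ?_, ?_, ?_, ?_⟩
  · funext s
    simp only [Prod.smul_fst, Pi.smul_apply, A.total_src, smul_eq_mul]
    field_simp
  · have hm : ∀ b, n * P.momentOut ((n : ℝ)⁻¹ • A.total P) b =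
        ∑ y, A.outputLaw P y * ∑ i, if y i = b then 1 else 0 := by
      intro b
      rw [← A.momentOut_total, Problem.momentOut, Problem.momentOut, Finset.mul_sum]
      refine Finset.sum_congr rfl fun x _ => ?_
      simp only [Prod.smul_fst, Prod.smul_snd, Pi.smul_apply, smul_eq_mul]
      field_simp
    have h1 : ∑ y, A.outputLaw P y = 1 := by
      have := A.sum_outputLaw_mul P fun _ => 1
      simpa only [mul_one, A.avg_one] using this
    have h2 := ent_le_of_marginals hn (T := A.outputLaw P) (fun y => Finset.sum_nonneg fun θ _ =>
      Finset.sum_nonneg fun r _ => A.outLaw_inputLaw_nonneg P θ r y) h1 hm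
    have h3 := A.total_entDiff_ge P
    have h4 : (n : ℝ) * ((n : ℝ)⁻¹ • A.total P).2 = (A.total P).2 := by
      simp only [Prod.smul_snd, smul_eq_mul]
      field_simp
    refine le_of_mul_le_mul_left ?_ hn'
    have h5 : (n : ℝ) * (log 2 / n) = log 2 := by field_simp
    rw [mul_neg, mul_add, h5, mul_sub, mul_add, h4, ← mul_assoc]
    linarith
  · rw [avg_const_mul, ← A.total_de]
    simp
  · rw [avg_const_mul, ← A.total_dr]
    simp

end Converse

/-! ### The converse in the limit of large block length. -/

section Converse

variable {S X Y : Type*} [Fintype S] [Fintype X] [Fintype Y] {n : ℕ}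

theorem average_le {f : Fin n → ℝ} {C : ℝ} (hn : n ≠ 0) (h : ∀ i, f i ≤ C) :
    (1 / (n : ℝ)) * ∑ i, f i ≤ C := by
  have hn' : (0 : ℝ) < n := by positivity
  have : ∑ i, f i ≤ n * C := by
    simpa using Finset.sum_le_sum fun i (_ : i ∈ univ) => h i
  rw [one_div, inv_mul_le_iff₀ hn']
  exact this

open Filter Topology

theorem Problem.Achieves.feasible {P : Problem S X Y} {De Dr : ℝ} (h : P.Achieves De Dr) :
    ∀ ε > 0, P.Feasible De Dr ε := by
  intro ε hε
  obtain ⟨A, hA, hD⟩ := h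
  obtain ⟨hE, hR⟩ := hD (ε / 2) (by positivity)
  obtain ⟨ce, hce⟩ : ∃ c : ℝ, ∀ s x, (P.de s x : ℝ) ≤ c :=
    ⟨∑ s, ∑ x, (P.de s x : ℝ), fun s x => (Finset.single_le_sum (f := fun x => (P.de s x : ℝ))
      (fun x _ => (P.de s x).2) (Finset.mem_univ x)).trans
      (Finset.single_le_sum (f := fun s => ∑ x, (P.de s x : ℝ))
      (fun s _ => Finset.sum_nonneg fun x _ => (P.de s x).2) (Finset.mem_univ s))⟩
  obtain ⟨cr, hcr⟩ : ∃ c : ℝ, ∀ s x, (P.dr s x : ℝ) ≤ c :=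
    ⟨∑ s, ∑ x, (P.dr s x : ℝ), fun s x => (Finset.single_le_sum (f := fun x => (P.dr s x : ℝ))
      (fun x _ => (P.dr s x).2) (Finset.mem_univ x)).trans
      (Finset.single_le_sum (f := fun s => ∑ x, (P.dr s x : ℝ))
      (fun s _ => Finset.sum_nonneg fun x _ => (P.dr s x).2) (Finset.mem_univ s))⟩
  have hF : Tendsto (fun n => (A n).prob P (P.reference n) AttackEvent +
      (A n).prob P (P.reference n) (P.ReconstructionEvent (Dr + ε / 2))) atTop (𝓝 0) := by
    simpa using (hA fun n => P.reference n).add hR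
  -- A mismatch is either a successful attack or a declared failure. Security enters the converse
  -- only here and in the distortion bound, and only for the reference channel.
  have hmis : ∀ n, (A n).prob P (P.reference n) MismatchEvent ≤
      (A n).prob P (P.reference n) AttackEvent +
      (A n).prob P (P.reference n) (P.ReconstructionEvent (Dr + ε / 2)) := by
    intro n
    classical
    simp only [Scheme.prob_eq_avg, ← Scheme.avg_add]
    refine Scheme.avg_mono fun θ s x r y φ => ?_
    by_cases h1 : φ = none
    · have : P.ReconstructionEvent (Dr + ε / 2) s x r y φ := Or.inl h1
      rw [if_pos this]
      split_ifs <;> norm_num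
    · by_cases h2 : φ = some r
      · rw [if_neg (by simpa [MismatchEvent] using h2)]
        split_ifs <;> norm_num
      · rw [if_pos (show AttackEvent s x r y φ from ⟨h1, h2⟩)]
        split_ifs <;> norm_num
  have t1 : Tendsto (fun n : ℕ => log 2 / n + log (Fintype.card S) *
      ((A n).prob P (P.reference n) AttackEvent +
      (A n).prob P (P.reference n) (P.ReconstructionEvent (Dr + ε / 2)))) atTop (𝓝 0) := by
    simpa using (tendsto_const_div_atTop_nhds_zero_nat (log 2)).add
      (hF.const_mul (log (Fintype.card S)))
  -- The constant |ce| + |De| dominates the amount by which the bounded distortion can exceed De +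
  -- ε/2.
  have t2 : Tendsto (fun n : ℕ => (|ce| + |De|) *
      (A n).prob P (P.reference n) (P.EncodingEvent (De + ε / 2))) atTop (𝓝 0) := by
    simpa using hE.const_mul (|ce| + |De|)
  have t3 : Tendsto (fun n : ℕ => (|cr| + |Dr|) * ((A n).prob P (P.reference n) AttackEvent +
      (A n).prob P (P.reference n) (P.ReconstructionEvent (Dr + ε / 2)))) atTop (𝓝 0) := by
    simpa using hF.const_mul (|cr| + |Dr|)
  obtain ⟨n, hn1, hn2, hn3, hn0⟩ := ((t1.eventually (gt_mem_nhds hε)).and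
    ((t2.eventually (gt_mem_nhds (half_pos hε))).and ((t3.eventually
      (gt_mem_nhds (half_pos hε))).and (eventually_ne_atTop 0)))).exists
  obtain ⟨z, hz, hz1, hz2, hz3, hz4⟩ := (A n).exists_hull_point P hn0
  have hS : 0 ≤ log (Fintype.card S) := log_natCast_nonneg _
  refine ⟨z, hz, hz1, ?_, ?_, ?_⟩
  · have := mul_le_mul_of_nonneg_left (hmis n) hS
    linarith
  · have := Scheme.avg_le_of_event (P := P) (A := A n) (W := P.reference n) (|ce| + |De|)
      (De + ε / 2) (E := P.EncodingEvent (De + ε / 2))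
      (F := fun s x _ _ _ => (1 / (n : ℝ)) * ∑ i, (P.de (s i) (x i) : ℝ))
      (fun s x r y φ h => not_lt.1 h)
      (fun s x r y φ _ => by
        have := average_le hn0 fun i => hce (s i) (x i)
        have h1 := le_abs_self ce
        have h2 := neg_abs_le De
        linarith)
    rw [hz3]
    linarith
  -- The hull point carries the distortion of the authentic reconstruction. Outside both error
  -- events the decoder output equals it, so the guarantee for the decoder transfers.
  · have := Scheme.avg_le_of_event (P := P) (A := A n) (W := P.reference n) (|cr| + |Dr|)
      (Dr + ε / 2) (E := fun s x r y φ => AttackEvent s x r y φ ∨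
        P.ReconstructionEvent (Dr + ε / 2) s x r y φ)
      (F := fun s x r _ _ => (1 / (n : ℝ)) * ∑ i, (P.dr (s i) (r i) : ℝ))
      (fun s x r y φ h => by
        rw [not_or] at h
        obtain ⟨h1, h2⟩ := h
        by_contra hlt
        refine h2 ?_
        by_cases hφ : φ = none
        · exact Or.inl hφ
        · have : φ = some r := by
            by_contra hne
            exact h1 ⟨hφ, hne⟩
          exact Or.inr ⟨r, this, not_le.1 hlt⟩)
      (fun s x r y φ _ => by
        have := average_le hn0 fun i => hcr (s i) (r i)
        have h1 := le_abs_self cr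
        have h2 := neg_abs_le Dr
        linarith)
    have h2 : (A n).prob P (P.reference n) (fun s x r y φ => AttackEvent s x r y φ ∨
        P.ReconstructionEvent (Dr + ε / 2) s x r y φ) ≤
        (A n).prob P (P.reference n) AttackEvent +
        (A n).prob P (P.reference n) (P.ReconstructionEvent (Dr + ε / 2)) := by
      classical
      simp only [Scheme.prob_eq_avg, ← Scheme.avg_add]
      refine Scheme.avg_mono fun θ s x r y φ => ?_
      by_cases h1 : AttackEvent s x r y φ <;>
        by_cases h2 : P.ReconstructionEvent (Dr + ε / 2) s x r y φ <;> simp [h1, h2]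
    have h3 : (0:ℝ) ≤ |cr| + |Dr| := by positivity
    have := mul_le_mul_of_nonneg_left h2 h3
    rw [hz4]
    linarith

theorem Problem.feasible_of_mem_region {P : Problem S X Y} {De Dr : ℝ}
    (h : (De, Dr) ∈ P.region) : P.Feasible De Dr 0 := by
  refine Feasible.of_forall_pos fun ε hε => ?_
  obtain ⟨⟨D1, D2⟩, hD, hdist⟩ := Metric.mem_closure_iff.1 h (ε / 2) (half_pos hε)
  obtain ⟨z, hz, h1, h2, h3, h4⟩ := Achieves.feasible hD (ε / 2) (half_pos hε)
  rw [Prod.dist_eq, max_lt_iff, Real.dist_eq, Real.dist_eq, abs_lt, abs_lt] at hdist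
  obtain ⟨⟨h5, h6⟩, h7, h8⟩ := hdist
  dsimp only at *
  exact ⟨z, hz, h1, by linarith, by linarith, by linarith⟩

end Converse

/-! ### From randomized to deterministic channel inputs -/

section Derandomize

variable {S X Y : Type*} [Fintype S] [Fintype X] [Fintype Y]

/-- A kernel is a point in a product of simplices, which is the convex hull of the deterministic
maps. The ambient dimension is |S||X|, and the sum of one row supplies the hyperplane needed for
Carathéodory's theorem without an extra point. -/
theorem exists_mixture_of_functions [Nonempty S] [DecidableEq X] (κ : S → stdSimplex ℝ X) :
    ∃ (F : Fin (Fintype.card S * Fintype.card X) → S → X)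
      (v : stdSimplex ℝ (Fin (Fintype.card S * Fintype.card X))),
      ∀ s x, ∑ j, v j * (if F j s = x then 1 else 0) = κ s x := by
  classical
  set A : Set (S → X → ℝ) :=
    Set.pi Set.univ fun _ : S => Set.range fun (x : X) => (Pi.single x 1 : X → ℝ) with hA
  obtain ⟨s₀⟩ := ‹Nonempty S›
  let ℓ : (S → X → ℝ) →ₗ[ℝ] ℝ :=
    { toFun := fun z => ∑ x, z s₀ x
      map_add' := fun z z' => by simp [Finset.sum_add_distrib]
      map_smul' := fun c z => by simp [Finset.mul_sum] }
  have hℓ : ∀ a ∈ A, ℓ a = 1 := by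
    intro a ha
    obtain ⟨x, hx⟩ := ha s₀ (Set.mem_univ _)
    change ∑ x, a s₀ x = 1
    rw [← hx]
    simp
  have hmem : (fun s x => κ s x) ∈ convexHull ℝ A := by
    rw [hA, convexHull_pi]
    intro s _
    rw [convexHull_rangle_single_eq_stdSimplex]
    exact (κ s).2
  obtain ⟨z, w, hz, hw, hsum⟩ := exists_convex_combination ℓ hℓ
    (d := Fintype.card S * Fintype.card X)
    (by rw [Module.finrank_pi_fintype]; simp) hmem
  choose F hF using fun j s => hz j s (Set.mem_univ s)
  refine ⟨F, ⟨w, hw⟩, fun s x => ?_⟩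
  have := congrFun (congrFun hsum s) x
  simp only [Finset.sum_apply, Pi.smul_apply, smul_eq_mul] at this
  rw [← this]
  refine Finset.sum_congr rfl fun j _ => ?_
  rw [← hF j s]
  change w j * _ = w j * (Pi.single (F j s) 1 : X → ℝ) x
  rw [Pi.single_apply]
  simp only [eq_comm]

theorem Problem.slice_vertex [DecidableEq X] (P : Problem S X Y) {U : Type*} [Fintype U]
    (pU : S → stdSimplex ℝ U) (f : U → S → X) (u : U) (s : S) (x : X) :
    P.slice pU (fun u s => stdSimplex.vertex (f u s)) u s x =
      P.source s * pU s u * if f u s = x then 1 else 0 := by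
  rw [slice, stdSimplex.vertex_coe, Pi.single_apply]
  simp only [eq_comm]

theorem Problem.expect_vertex [DecidableEq X] (P : Problem S X Y) {U : Type*} [Fintype U]
    (pU : S → stdSimplex ℝ U) (f : U → S → X) (h : S → U → X → ℝ) :
    P.expect pU (fun u s => stdSimplex.vertex (f u s)) h =
      ∑ u, ∑ s, P.source s * pU s u * h s u (f u s) := by
  rw [expect_eq]
  simp [slice_vertex]

theorem Problem.DeterministicCondition.randomized {P : Problem S X Y} {De Dr : ℝ} {U : Type*}
    [Fintype U] (h : P.DeterministicCondition De Dr U) : P.RandomizedCondition De Dr U := by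
  classical
  obtain ⟨pU, f, g, h1, h2, h3⟩ := h
  refine ⟨pU, _, g, h1, ?_, h3⟩
  rw [P.expect_vertex] at h2 ⊢
  exact h2

/-- The index J of the function is adjoined to U and drawn from u alone. Given u it is independent
of s, so I(S;U,J) = I(S;U), while I(U,J;Y) ≥ I(U;Y); joint laws of source, input and u are
unchanged, hence so are the distortions. -/
theorem Problem.RandomizedCondition.deterministic {P : Problem S X Y} {De Dr : ℝ} {U : Type*}
    [Fintype U] (h : P.RandomizedCondition De Dr U) :
    P.DeterministicCondition De Dr (U × Fin (Fintype.card S * Fintype.card X)) := by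
  classical
  obtain ⟨pU, pX, g, h1, h2, h3⟩ := h
  have hne : Nonempty S := by
    by_contra h
    rw [not_nonempty_iff] at h
    have := P.sum_source
    simp at this
  choose F v hF using fun u => exists_mixture_of_functions (pX u)
  have hv : ∀ u, ∑ j, v u j = 1 := fun u => (v u).2.2
  have hv0 : ∀ u j, 0 ≤ v u j := fun u => (v u).2.1
  let pU' : S → stdSimplex ℝ (U × Fin (Fintype.card S * Fintype.card X)) := fun s =>
    ⟨fun p => pU s p.1 * v p.1 p.2, fun p => mul_nonneg ((pU s).2.1 _) ((v _).2.1 _), by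
      rw [Fintype.sum_prod_type]
      simp only [← Finset.mul_sum, hv, mul_one]
      exact (pU s).2.2⟩
  have hpU' : ∀ s p, pU' s p = pU s p.1 * v p.1 p.2 := fun s p => rfl
  let f : U × Fin (Fintype.card S * Fintype.card X) → S → X := fun p => F p.1 p.2
  set pX' : U × Fin (Fintype.card S * Fintype.card X) → S → stdSimplex ℝ X :=
    fun u s => stdSimplex.vertex (f u s) with hpX'
  have hsl : ∀ u j s x, P.slice pU' pX' (u, j) s x =
      P.source s * pU s u * (v u j * if F u j s = x then 1 else 0) := by
    intro u j s x
    rw [hpX', P.slice_vertex, hpU']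
    ring
  have hsum : ∀ u s x, ∑ j, P.slice pU' pX' (u, j) s x = P.slice pU pX u s x := by
    intro u s x
    simp only [hsl, ← Finset.mul_sum, hF]
    rfl
  have hsrc : ∀ u j, srcLaw (P.slice pU' pX' (u, j)) =
      fun s => v u j * srcLaw (P.slice pU pX u) s := by
    intro u j
    funext s
    rw [P.srcLaw_slice, P.srcLaw_slice, hpU']
    ring
  have hout : ∀ u y, ∑ j, outLaw (fun x y => P.channel x y) (P.slice pU' pX' (u, j)) y =
      outLaw (fun x y => P.channel x y) (P.slice pU pX u) y := by
    intro u y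
    simp only [outLaw]
    rw [Finset.sum_comm]
    refine Finset.sum_congr rfl fun s _ => ?_
    rw [Finset.sum_comm]
    simp only [← Finset.sum_mul, hsum]
  refine ⟨pU', f, fun p => g p.1, ?_, ?_, ?_⟩
  · refine le_of_mul_le_mul_right ?_ (log_pos one_lt_two)
    have h0 := mul_nonneg h1 (log_pos one_lt_two).le
    rw [P.infoDiff_eq] at h0
    rw [zero_mul]
    change 0 ≤ (P.infoUY pU' pX' - P.infoSU pU' pX') * log 2
    rw [P.infoDiff_eq]
    have e1 : ∀ u, entDiff (fun x y => P.channel x y) (P.slice pU pX u) ≤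
        ∑ j, entDiff (fun x y => P.channel x y) (P.slice pU' pX' (u, j)) := by
      intro u
      have : ∑ j, ent (outLaw (fun x y => P.channel x y) (P.slice pU' pX' (u, j))) ≤
          ent (outLaw (fun x y => P.channel x y) (P.slice pU pX u)) := by
        refine (sum_ent_le_ent_sum fun j y => Finset.sum_nonneg fun s _ =>
          Finset.sum_nonneg fun x _ => mul_nonneg (P.slice_nonneg _ _ _ _ _)
            ((P.channel x).2.1 y)).trans (le_of_eq ?_)
        congr 1
        funext y
        exact hout u y
      simp only [entDiff, Finset.sum_sub_distrib, hsrc, ent_smul, ← Finset.sum_mul, hv, one_mul]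
      linarith
    have e2 := Finset.sum_le_sum fun u (_ : u ∈ univ) => e1 u
    simp only [Fintype.sum_prod_type, hout]
    linarith
  · change P.expect pU' pX' _ ≤ De
    rw [hpX', P.expect_vertex]
    rw [P.expect_eq] at h2
    refine le_of_eq_of_le ?_ h2
    rw [Fintype.sum_prod_type]
    refine Finset.sum_congr rfl fun u _ => ?_
    rw [Finset.sum_comm]
    refine Finset.sum_congr rfl fun s _ => ?_
    simp only [← hsum, hsl, Finset.sum_mul]
    rw [Finset.sum_comm]
    refine Finset.sum_congr rfl fun j _ => ?_
    simp [hpU', f, mul_assoc]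
  · change P.expect pU' pX' _ ≤ Dr
    rw [hpX', P.expect_vertex]
    rw [P.expect_eq] at h3
    refine le_of_eq_of_le ?_ h3
    rw [Fintype.sum_prod_type]
    refine Finset.sum_congr rfl fun u _ => ?_
    rw [Finset.sum_comm]
    refine Finset.sum_congr rfl fun s _ => ?_
    simp only [← hsum, hsl, Finset.sum_mul]
    rw [Finset.sum_comm]
    refine Finset.sum_congr rfl fun j _ => ?_
    simp [hpU', mul_assoc]

end Derandomize

/-! ### Random codes -/

section RandomCode

variable {ι J U S Y : Type*} [Fintype ι] [DecidableEq ι] [Fintype J] [Fintype U] [Fintype S]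
  [Fintype Y]

/-- Distinct codewords are independent, so the cross terms vanish. The injection `e` is there
because a key selects only some of the codewords of the book. -/
theorem sum_pi_sum_sq {q : U → ℝ} (hq1 : ∑ u, q u = 1) {e : J → ι} (he : Function.Injective e)
    {G : U → ℝ} (hG : ∑ u, q u * G u = 0) :
    ∑ c : ι → U, (∏ i, q (c i)) * (∑ j, G (c (e j))) ^ 2 =
      Fintype.card J * ∑ u, q u * G u ^ 2 := by
  classical
  have hq : ∀ _i : ι, ∑ u, q u = 1 := fun _ => hq1
  have h1 : ∀ c : ι → U, (∏ i, q (c i)) * (∑ j, G (c (e j))) ^ 2 =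
      ∑ j, ∑ k, (∏ i, q (c i)) * (G (c (e j)) * G (c (e k))) := by
    intro c
    rw [sq, Finset.sum_mul_sum]
    simp only [Finset.mul_sum]
  simp only [h1]
  rw [Finset.sum_comm]
  have h2 : ∀ j, ∑ c : ι → U, ∑ k, (∏ i, q (c i)) * (G (c (e j)) * G (c (e k))) =
      ∑ u, q u * G u ^ 2 := by
    intro j
    rw [Finset.sum_comm, Finset.sum_eq_single j]
    · rw [← sum_pi_eval (f := fun (_ : ι) => q) hq (e j) (fun u => G u ^ 2)]
      simp only [sq]
    · intro k _ hk
      rw [sum_pi_eval_pair (f := fun (_ : ι) => q) hq (fun h => hk (he h).symm), hG, zero_mul]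
    · simp
  simp [h2]

theorem sum_pi_abs_le {q : U → ℝ} (hq0 : ∀ u, 0 ≤ q u) (hq1 : ∑ u, q u = 1) {M : ℕ}
    (hM : M ≠ 0) {e : Fin M → ι} (he : Function.Injective e) {g : U → ℝ} :
    ∑ c : ι → U, (∏ i, q (c i)) * |(1 / (M : ℝ)) * ∑ m, g (c (e m)) - ∑ u, q u * g u| ≤
      √((∑ u, q u * g u ^ 2) / M) := by
  have hM' : (0 : ℝ) < M := by positivity
  have hw0 : ∀ c : ι → U, 0 ≤ ∏ i, q (c i) := fun c => Finset.prod_nonneg fun i _ => hq0 _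
  set μ := ∑ u, q u * g u with hμ
  have hG : ∑ u, q u * (g u - μ) = 0 := by
    simp only [mul_sub, Finset.sum_sub_distrib, ← Finset.sum_mul, hq1, hμ]
    ring
  have h1 := sum_pi_sum_sq hq1 he hG
  have h2 : ∀ c : ι → U, (1 / (M : ℝ)) * ∑ m, g (c (e m)) - μ =
      (1 / (M : ℝ)) * ∑ m, (g (c (e m)) - μ) := by
    intro c
    rw [Finset.sum_sub_distrib]
    simp
    field_simp
  have h3 : ∑ c : ι → U, (∏ i, q (c i)) * ((1 / (M : ℝ)) * ∑ m, g (c (e m)) - μ) ^ 2 ≤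
      (∑ u, q u * g u ^ 2) / M := by
    simp only [h2, mul_pow, mul_left_comm _ ((1 / (M : ℝ)) ^ 2), ← Finset.mul_sum]
    rw [h1, Fintype.card_fin]
    have h4 : ∑ u, q u * (g u - μ) ^ 2 = ∑ u, q u * g u ^ 2 - μ ^ 2 := by
      have : ∀ u, q u * (g u - μ) ^ 2 = q u * g u ^ 2 - 2 * μ * (q u * g u) + μ ^ 2 * q u := by
        intro u; ring
      simp only [this, Finset.sum_add_distrib, Finset.sum_sub_distrib, ← Finset.mul_sum, hq1, ← hμ]
      ring
    rw [h4]
    have h5 : (1 / (M : ℝ)) ^ 2 * (M * (∑ u, q u * g u ^ 2 - μ ^ 2)) =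
      (∑ u, q u * g u ^ 2 - μ ^ 2) / M := by field_simp
    rw [h5]
    gcongr
    nlinarith [sq_nonneg μ]
  refine le_sqrt_of_sq_le (le_trans ?_ h3)
  -- Cauchy–Schwarz with the probability weight split into two square roots passes from the variance
  -- to the mean absolute deviation.
  have h6 := Finset.sum_mul_sq_le_sq_mul_sq (univ : Finset (ι → U))
    (fun c => √(∏ i, q (c i)))
    (fun c => √(∏ i, q (c i)) * |(1 / (M : ℝ)) * ∑ m, g (c (e m)) - μ|)
  simp only [mul_pow, sq_sqrt (hw0 _), sq_abs, ← mul_assoc, mul_self_sqrt (hw0 _)] at h6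
  rwa [sum_pi (f := fun (_ : ι) => q) (fun _ => hq1), one_mul] at h6

open scoped Classical in
/-- Soft covering: the output law of a random code approximates the true output law. -/
theorem soft_covering {q : U → ℝ} (hq0 : ∀ u, 0 ≤ q u) (hq1 : ∑ u, q u = 1) {V : U → S → ℝ}
    (hV0 : ∀ u s, 0 ≤ V u s) {p : S → ℝ} (hp : ∀ s, ∑ u, q u * V u s = p s) (hp1 : ∑ s, p s = 1)
    {M : ℕ} (hM : M ≠ 0) {e : Fin M → ι} (he : Function.Injective e) {L : ℝ} (hL : 0 ≤ L) :
    ∑ c : ι → U, (∏ i, q (c i)) * ∑ s, |p s - (1 / (M : ℝ)) * ∑ m, V (c (e m)) s| ≤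
      2 * (∑ u, ∑ s, q u * V u s * if L * p s < V u s then 1 else 0) + √(L / M) := by
  have hw0 : ∀ c : ι → U, 0 ≤ ∏ i, q (c i) := fun c => Finset.prod_nonneg fun i _ => hq0 _
  have hp0 : ∀ s, 0 ≤ p s := fun s => by
    rw [← hp]; exact Finset.sum_nonneg fun u _ => mul_nonneg (hq0 u) (hV0 u s)
  have hM' : (0 : ℝ) < M := by positivity
  -- The likelihoods are truncated at L p(s), since their raw variance may be too large. The
  -- truncated part has second moment at most L p(s)², which yields p(s) √(L/M); the removed part is
  -- paid for twice, in the true law and in the empirical average.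
  set g : S → U → ℝ := fun s u => if L * p s < V u s then 0 else V u s with hg
  set b : S → U → ℝ := fun s u => if L * p s < V u s then V u s else 0 with hb
  have hb0 : ∀ s u, 0 ≤ b s u := by
    intro s u
    simp only [hb]
    split_ifs
    · exact hV0 u s
    · exact le_rfl
  have hgb : ∀ s u, V u s = g s u + b s u := by
    intro s u
    simp only [hg, hb]
    split_ifs <;> simp
  have hterm : ∀ s, ∑ c : ι → U, (∏ i, q (c i)) * |p s - (1 / (M : ℝ)) * ∑ m, V (c (e m)) s| ≤
      p s * √(L / M) + 2 * ∑ u, q u * b s u := by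
    intro s
    have h1 : ∀ c : ι → U, |p s - (1 / (M : ℝ)) * ∑ m, V (c (e m)) s| ≤
        |(1 / (M : ℝ)) * ∑ m, g s (c (e m)) - ∑ u, q u * g s u| +
          (1 / (M : ℝ)) * ∑ m, b s (c (e m)) + ∑ u, q u * b s u := by
      intro c
      have e1 : p s = ∑ u, q u * g s u + ∑ u, q u * b s u := by
        rw [← hp, ← Finset.sum_add_distrib]
        refine Finset.sum_congr rfl fun u _ => ?_
        rw [hgb, mul_add]
      have e2 : (1 / (M : ℝ)) * ∑ m, V (c (e m)) s = (1 / (M : ℝ)) * ∑ m, g s (c (e m)) +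
          (1 / (M : ℝ)) * ∑ m, b s (c (e m)) := by
        rw [← mul_add, ← Finset.sum_add_distrib]
        simp only [hgb]
      have n1 : 0 ≤ (1 / (M : ℝ)) * ∑ m, b s (c (e m)) :=
        mul_nonneg (by positivity) (Finset.sum_nonneg fun m _ => hb0 _ _)
      have n2 : 0 ≤ ∑ u, q u * b s u := Finset.sum_nonneg fun u _ => mul_nonneg (hq0 u) (hb0 _ _)
      rw [e1, e2, abs_le]
      have a1 := le_abs_self ((1 / (M : ℝ)) * ∑ m, g s (c (e m)) - ∑ u, q u * g s u)
      have a2 := neg_abs_le ((1 / (M : ℝ)) * ∑ m, g s (c (e m)) - ∑ u, q u * g s u)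
      constructor <;> linarith
    refine (Finset.sum_le_sum fun c _ => mul_le_mul_of_nonneg_left (h1 c) (hw0 c)).trans ?_
    simp only [mul_add, Finset.sum_add_distrib]
    have h2 : ∑ c : ι → U, (∏ i, q (c i)) * ((1 / (M : ℝ)) * ∑ m, b s (c (e m))) =
        ∑ u, q u * b s u := by
      simp only [mul_left_comm _ (1 / (M : ℝ)), ← Finset.mul_sum]
      simp only [Finset.mul_sum (s := (univ : Finset (Fin M)))]
      rw [Finset.sum_comm]
      simp only [sum_pi_eval (f := fun (_ : ι) => q) (fun _ => hq1) _ (b s)]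
      simp
      field_simp
    have h3 : ∑ c : ι → U, (∏ i, q (c i)) * ∑ u, q u * b s u = ∑ u, q u * b s u := by
      rw [← Finset.sum_mul, sum_pi (f := fun (_ : ι) => q) (fun _ => hq1), one_mul]
    have h4 := sum_pi_abs_le hq0 hq1 hM he (g := g s)
    have h5 : √((∑ u, q u * g s u ^ 2) / M) ≤ p s * √(L / M) := by
      rw [← sqrt_sq (hp0 s), ← sqrt_mul (sq_nonneg _)]
      refine sqrt_le_sqrt ?_
      rw [← mul_div_assoc]
      gcongr
      have : ∀ u, q u * g s u ^ 2 ≤ (L * p s) * (q u * V u s) := by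
        intro u
        simp only [hg]
        split_ifs with h
        · have := mul_nonneg (mul_nonneg hL (hp0 s)) (mul_nonneg (hq0 u) (hV0 u s))
          simpa using this
        · have h' := mul_le_mul_of_nonneg_left (not_lt.1 h) (mul_nonneg (hq0 u) (hV0 u s))
          nlinarith
      refine (Finset.sum_le_sum fun u _ => this u).trans (le_of_eq ?_)
      rw [← Finset.mul_sum, hp]
      ring
    rw [h2, h3]
    linarith
  have hsw : ∑ c : ι → U, (∏ i, q (c i)) * ∑ s, |p s - (1 / (M : ℝ)) * ∑ m, V (c (e m)) s| =
      ∑ s, ∑ c : ι → U, (∏ i, q (c i)) * |p s - (1 / (M : ℝ)) * ∑ m, V (c (e m)) s| := by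
    rw [Finset.sum_comm]
    simp only [Finset.mul_sum]
  rw [hsw]
  refine (Finset.sum_le_sum fun s _ => hterm s).trans (le_of_eq ?_)
  rw [Finset.sum_add_distrib, ← Finset.sum_mul, hp1, one_mul, ← Finset.mul_sum, add_comm]
  congr 2
  rw [Finset.sum_comm]
  refine Finset.sum_congr rfl fun u _ => Finset.sum_congr rfl fun s _ => ?_
  simp only [hb]
  split_ifs <;> simp

/-- The threshold test of the decoder. -/
def passes (L : ℝ) (w : U → Y → ℝ) (r : Y → ℝ) (u : U) (y : Y) : Prop := L * r y < w u y

open scoped Classical in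
/-- The threshold decoder: it returns the unique index whose codeword passes the test. -/
def thresholdDecoder (L : ℝ) (w : U → Y → ℝ) (r : Y → ℝ) (c : ι → U) (y : Y) : Option ι :=
  if h : ∃ i, passes L w r (c i) y ∧ ∀ j, j ≠ i → ¬ passes L w r (c j) y then some h.choose
  else none

theorem thresholdDecoder_eq (L : ℝ) (w : U → Y → ℝ) (r : Y → ℝ) (c : ι → U) (y : Y) {i : ι}
    (h1 : passes L w r (c i) y) (h2 : ∀ j, j ≠ i → ¬ passes L w r (c j) y) :
    thresholdDecoder L w r c y = some i := by
  have h : ∃ i, passes L w r (c i) y ∧ ∀ j, j ≠ i → ¬ passes L w r (c j) y := ⟨i, h1, h2⟩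
  rw [thresholdDecoder, dif_pos h]
  congr 1
  by_contra hne
  exact h2 _ hne h.choose_spec.1

open scoped Classical in
/-- Packing: the error probability of a random code with threshold decoding. -/
theorem packing {q : U → ℝ} (hq0 : ∀ u, 0 ≤ q u) (hq1 : ∑ u, q u = 1) {w : U → Y → ℝ}
    (hw0 : ∀ u y, 0 ≤ w u y) (hw1 : ∀ u, ∑ y, w u y = 1) {r : Y → ℝ}
    (hr : ∀ y, ∑ u, q u * w u y = r y) {L : ℝ} (hL : 0 < L) (i : ι) :
    ∑ c : ι → U, (∏ j, q (c j)) *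
        ∑ y, w (c i) y * (if thresholdDecoder L w r c y ≠ some i then 1 else 0) ≤
      (∑ u, ∑ y, q u * w u y * if L * r y < w u y then 0 else 1) + Fintype.card ι / L := by
  have hc0 : ∀ c : ι → U, 0 ≤ ∏ j, q (c j) := fun c => Finset.prod_nonneg fun i _ => hq0 _
  have hr0 : ∀ y, 0 ≤ r y := fun y => by
    rw [← hr]; exact Finset.sum_nonneg fun u _ => mul_nonneg (hq0 u) (hw0 u y)
  -- Union bound: threshold decoding fails only if the right codeword misses the test or some wrong
  -- one passes it.
  have h1 : ∀ (c : ι → U) y, (if thresholdDecoder L w r c y ≠ some i then (1 : ℝ) else 0) ≤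
      (if passes L w r (c i) y then 0 else 1) +
        ∑ j ∈ univ.erase i, if passes L w r (c j) y then 1 else 0 := by
    intro c y
    have hs : 0 ≤ ∑ j ∈ univ.erase i, (if passes L w r (c j) y then (1 : ℝ) else 0) :=
      Finset.sum_nonneg fun j _ => by split_ifs <;> simp
    by_cases hi : passes L w r (c i) y
    · by_cases hj : ∀ j, j ≠ i → ¬ passes L w r (c j) y
      · rw [thresholdDecoder_eq L w r c y hi hj]
        simp [hi]
      · push Not at hj
        obtain ⟨j, hji, hj⟩ := hj
        have : (if passes L w r (c j) y then (1 : ℝ) else 0) ≤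
            ∑ j ∈ univ.erase i, (if passes L w r (c j) y then (1 : ℝ) else 0) :=
          Finset.single_le_sum (f := fun j => if passes L w r (c j) y then (1 : ℝ) else 0)
            (fun j _ => by split_ifs <;> simp) (Finset.mem_erase.2 ⟨hji, Finset.mem_univ j⟩)
        rw [if_pos hj] at this
        rw [if_pos hi, zero_add]
        refine le_trans ?_ this
        split_ifs <;> simp
    · rw [if_neg hi]
      have : (if thresholdDecoder L w r c y ≠ some i then (1 : ℝ) else 0) ≤ 1 := by
        split_ifs <;> simp
      linarith
  have h2 : ∀ c : ι → U, (∏ j, q (c j)) *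
      ∑ y, w (c i) y * (if thresholdDecoder L w r c y ≠ some i then 1 else 0) ≤
      (∏ j, q (c j)) * (∑ y, w (c i) y * if passes L w r (c i) y then 0 else 1) +
      ∑ j ∈ univ.erase i, (∏ j, q (c j)) *
        ∑ y, w (c i) y * if passes L w r (c j) y then 1 else 0 := by
    intro c
    rw [← Finset.mul_sum, ← mul_add]
    refine mul_le_mul_of_nonneg_left ?_ (hc0 c)
    rw [Finset.sum_comm, ← Finset.sum_add_distrib]
    refine Finset.sum_le_sum fun y _ => ?_
    rw [← Finset.mul_sum, ← mul_add]
    exact mul_le_mul_of_nonneg_left (h1 c y) (hw0 _ _)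
  refine (Finset.sum_le_sum fun c _ => h2 c).trans ?_
  rw [Finset.sum_add_distrib, Finset.sum_comm]
  refine add_le_add ?_ ?_
  · rw [sum_pi_eval (f := fun (_ : ι) => q) (fun _ => hq1) i
      (fun u => ∑ y, w u y * if passes L w r u y then 0 else 1)]
    simp only [Finset.mul_sum, passes, mul_assoc]
    exact le_rfl
  · have h3 : ∀ j ∈ univ.erase i, ∑ c : ι → U, (∏ j, q (c j)) *
        (∑ y, w (c i) y * if passes L w r (c j) y then 1 else 0) ≤ 1 / L := by
      intro j hj
      rw [sum_pi_eval_eval (f := fun (_ : ι) => q) (fun _ => hq1) (Finset.ne_of_mem_erase hj).symm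
        (fun u u' => ∑ y, w u y * if passes L w r u' y then 1 else 0)]
      have e1 : ∑ a, ∑ b, q a * q b * (∑ y, w a y * if passes L w r b y then 1 else 0) =
          ∑ b, ∑ y, q b * (r y * if passes L w r b y then 1 else 0) := by
        rw [Finset.sum_comm]
        refine Finset.sum_congr rfl fun b _ => ?_
        simp only [Finset.mul_sum]
        rw [Finset.sum_comm]
        refine Finset.sum_congr rfl fun y _ => ?_
        rw [← hr, Finset.sum_mul, Finset.mul_sum]
        refine Finset.sum_congr rfl fun a _ => ?_
        ring
      rw [e1]
      have e2 : ∀ b y, q b * (r y * if passes L w r b y then 1 else 0) ≤ q b * (w b y / L) := by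
        intro b y
        refine mul_le_mul_of_nonneg_left ?_ (hq0 b)
        rw [le_div_iff₀ hL]
        split_ifs with h
        · rw [mul_one, mul_comm]; exact le_of_lt h
        · simpa using hw0 b y
      refine (Finset.sum_le_sum fun b _ => Finset.sum_le_sum fun y _ => e2 b y).trans (le_of_eq ?_)
      simp only [← Finset.mul_sum, ← Finset.sum_div, hw1]
      rw [← Finset.sum_mul, hq1, one_mul]
    refine (Finset.sum_le_sum h3).trans ?_
    rw [Finset.sum_const, nsmul_eq_mul, mul_one_div]
    gcongr
    exact Finset.card_le_univ _

end RandomCode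

/-! ### Schemes from codes -/

section OfIndex

variable {S X Y M : Type*} [Fintype S] [Fintype X] [Fintype Y] [Fintype M] {n : ℕ}

open scoped Classical in
/-- The scheme whose encoder draws an index `m` from the law `κ`, sends `x m` and declares
`r m` to be the authentic reconstruction, with the deterministic decoder `ψ`. -/
def Scheme.ofIndex (k : ℕ) (κ : (Fin n → S) → (Fin k → Bool) → stdSimplex ℝ M)
    (x : M → (Fin n → S) → (Fin k → Bool) → Fin n → X) (r : M → (Fin k → Bool) → Fin n → S)
    (ψ : (Fin n → Y) → (Fin k → Bool) → Option (Fin n → S)) : Scheme S X Y n where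
  k := k
  encoder s θ := ⟨fun b => ∑ m, if x m s θ = b then κ s θ m else 0,
    fun b => Finset.sum_nonneg fun m _ => by split_ifs; exacts [(κ s θ).2.1 m, le_rfl], by
      rw [Finset.sum_comm]
      simp only [Finset.sum_ite_eq, Finset.mem_univ, if_true]
      exact (κ s θ).2.2⟩
  -- The index is not visible to this kernel, so the reconstruction is redrawn from its conditional
  -- law given source, key and channel input. The joint law is the same as if `r m` had been kept.
  authentic s θ b :=
    haveI : Nonempty (Fin n → S) := ⟨s⟩
    (exists_stdSimplex_smul (v := fun a => ∑ m, if x m s θ = b ∧ r m θ = a then κ s θ m else 0)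
      fun a => Finset.sum_nonneg fun m _ => by
        split_ifs; exacts [(κ s θ).2.1 m, le_rfl]).choose
  decoder y θ := stdSimplex.vertex (ψ y θ)

-- Encoder law times conditional law of the reconstruction restores the joint law of `x m` and `r
-- m`, so the index can be reintroduced as a summation variable.
open scoped Classical in
theorem Scheme.prob_ofIndex (P : Problem S X Y) (k : ℕ)
    (κ : (Fin n → S) → (Fin k → Bool) → stdSimplex ℝ M)
    (x : M → (Fin n → S) → (Fin k → Bool) → Fin n → X) (r : M → (Fin k → Bool) → Fin n → S)
    (ψ : (Fin n → Y) → (Fin k → Bool) → Option (Fin n → S)) (W : BlockChannel X Y n)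
    (E : (Fin n → S) → (Fin n → X) → (Fin n → S) → (Fin n → Y) → Option (Fin n → S) → Prop) :
    (Scheme.ofIndex k κ x r ψ).prob P W E =
      ∑ θ, ∑ s, (∏ i, P.source (s i)) * (1 / 2 ^ k) * ∑ m, κ s θ m *
        ∑ y, W (x m s θ) y * if E s (x m s θ) (r m θ) y (ψ y θ) then 1 else 0 := by
  rw [prob_eq_avg, avg]
  change ∑ θ : Fin k → Bool, _ = _
  refine Finset.sum_congr rfl fun θ _ => Finset.sum_congr rfl fun s _ => ?_
  have hne : Nonempty (Fin n → S) := ⟨s⟩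
  have henc : ∀ b a, (Scheme.ofIndex k κ x r ψ).encoder s θ b *
      (Scheme.ofIndex k κ x r ψ).authentic s θ b a =
      ∑ m, if x m s θ = b ∧ r m θ = a then κ s θ m else 0 := by
    intro b a
    have h := (exists_stdSimplex_smul
      (v := fun a => ∑ m, if x m s θ = b ∧ r m θ = a then κ s θ m else 0)
      fun a => Finset.sum_nonneg fun m _ => by
        split_ifs; exacts [(κ s θ).2.1 m, le_rfl]).choose_spec a
    have e : ∑ a, ∑ m, (if x m s θ = b ∧ r m θ = a then κ s θ m else 0) =
        (Scheme.ofIndex k κ x r ψ).encoder s θ b := by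
      rw [Finset.sum_comm]
      refine Finset.sum_congr rfl fun m _ => ?_
      by_cases hx : x m s θ = b <;> simp [hx]
    rw [← e]
    exact h
  have hdec : ∀ y φ, (Scheme.ofIndex k κ x r ψ).decoder y θ φ = if φ = ψ y θ then 1 else 0 := by
    intro y φ
    change (stdSimplex.vertex (ψ y θ) : stdSimplex ℝ _) φ = _
    rw [stdSimplex.vertex_coe, Pi.single_apply]
  have hlaw : ∀ b a y φ, (Scheme.ofIndex k κ x r ψ).law P W s θ b a y φ =
      (∏ i, P.source (s i)) * (1 / 2 ^ k) *
        ((∑ m, if x m s θ = b ∧ r m θ = a then κ s θ m else 0) * (W b y *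
        if φ = ψ y θ then 1 else 0)) := by
    intro b a y φ
    change (∏ i, P.source (s i)) * (1 / 2 ^ k) * (Scheme.ofIndex k κ x r ψ).encoder s θ b *
      (Scheme.ofIndex k κ x r ψ).authentic s θ b a * W b y *
      (Scheme.ofIndex k κ x r ψ).decoder y θ φ = _
    rw [hdec, ← henc]
    ring
  simp only [hlaw, mul_assoc, ← Finset.mul_sum]
  congr 2
  simp only [ite_mul, one_mul, zero_mul, Finset.sum_ite_eq', Finset.mem_univ, if_true,
    Finset.sum_mul]
  have e1 : ∀ b, ∑ a, ∑ m, (if x m s θ = b ∧ r m θ = a then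
      κ s θ m * ∑ y, W b y * (if E s b a y (ψ y θ) then 1 else 0) else 0) =
      ∑ m, if x m s θ = b then
        κ s θ m * ∑ y, W b y * (if E s b (r m θ) y (ψ y θ) then 1 else 0) else 0 := by
    intro b
    rw [Finset.sum_comm]
    refine Finset.sum_congr rfl fun m _ => ?_
    by_cases hx : x m s θ = b <;> simp [hx]
  rw [Finset.sum_congr rfl fun b _ => e1 b, Finset.sum_comm]
  simp

end OfIndex

/-! ### Secret tags and the likelihood encoder. -/

section Code

variable {S X Y U : Type*} [Fintype S] [Fintype X] [Fintype Y] [Fintype U] {n : ℕ}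

/-- Keys of `M * τ` bits are the same as assignments of a tag of `τ` bits to each message. -/
def keyEquiv (M τ : ℕ) : (Fin (M * τ) → Bool) ≃ (Fin M → Fin τ → Bool) :=
  (Equiv.arrowCongr finProdFinEquiv.symm (Equiv.refl Bool)).trans (Equiv.curry _ _ _)

theorem sum_keyEquiv {M τ : ℕ} (F : (Fin M → Fin τ → Bool) → ℝ) :
    ∑ θ, (1 / 2 ^ (M * τ) : ℝ) * F (keyEquiv M τ θ) =
      ∑ t : Fin M → Fin τ → Bool, (∏ _m : Fin M, (1 / 2 ^ τ : ℝ)) * F t := by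
  rw [Equiv.sum_comp (keyEquiv M τ) fun t => (1 / 2 ^ (M * τ) : ℝ) * F t]
  simp [pow_mul']

open scoped Classical in
/-- The tag of a guessed message is matched with probability `2 ^ (-τ)`. -/
theorem sum_tag_guess_le {M τ : ℕ} {Z : (Fin τ → Bool) → Y → ℝ} (hZ0 : ∀ a y, 0 ≤ Z a y)
    (hZ1 : ∀ a, ∑ y, Z a y ≤ 1) (m : Fin M) (dec : Y → Option (Fin M × (Fin τ → Bool))) :
    ∑ t : Fin M → Fin τ → Bool, (∏ _m : Fin M, (1 / 2 ^ τ : ℝ)) *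
      ∑ y, Z (t m) y * (if ∃ j, j ≠ m ∧ dec y = some (j, t j) then 1 else 0) ≤ 1 / 2 ^ τ := by
  have hu : ∀ _m : Fin M, ∑ _a : Fin τ → Bool, (1 / 2 ^ τ : ℝ) = 1 := fun _ => by simp
  -- For fixed y the decoded pair (j, b) is fixed. When j ≠ m, the tag of j is independent of the
  -- tag of m, the only tag that influences the output.
  have key : ∀ y, ∑ t : Fin M → Fin τ → Bool, (∏ _m : Fin M, (1 / 2 ^ τ : ℝ)) *
      (Z (t m) y * (if ∃ j, j ≠ m ∧ dec y = some (j, t j) then 1 else 0)) ≤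
      (∑ a, (1 / 2 ^ τ : ℝ) * Z a y) * (1 / 2 ^ τ) := by
    intro y
    have hr : 0 ≤ (∑ a, (1 / 2 ^ τ : ℝ) * Z a y) * (1 / 2 ^ τ) :=
      mul_nonneg (Finset.sum_nonneg fun a _ => mul_nonneg (by positivity) (hZ0 a y))
        (by positivity)
    rcases hd : dec y with _ | ⟨j, b⟩
    · simpa using hr
    · by_cases hj : j = m
      · have : ∀ t : Fin M → Fin τ → Bool,
            ¬ ∃ j', j' ≠ m ∧ some (j, b) = some (j', t j') := by
          rintro t ⟨j', h1, h2⟩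
          simp only [Option.some.injEq, Prod.mk.injEq] at h2
          exact h1 (h2.1 ▸ hj)
        simp only [this, if_false, mul_zero, Finset.sum_const_zero]
        exact hr
      · have e : ∀ t : Fin M → Fin τ → Bool,
            (∃ j', j' ≠ m ∧ some (j, b) = some (j', t j')) ↔ t j = b := by
          intro t
          constructor
          · rintro ⟨j', -, h2⟩
            simp only [Option.some.injEq, Prod.mk.injEq] at h2
            obtain ⟨rfl, h⟩ := h2
            exact h.symm
          · intro h
            exact ⟨j, hj, by rw [h]⟩
        simp only [e]
        have := sum_pi_eval_pair (f := fun (_ : Fin M) (_ : Fin τ → Bool) => (1 / 2 ^ τ : ℝ)) hu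
          (i := m) (k := j) (Ne.symm hj) (fun a => Z a y) (fun a => if a = b then 1 else 0)
        rw [this]
        simp
  simp only [Finset.mul_sum (s := (univ : Finset Y))]
  rw [Finset.sum_comm]
  refine (Finset.sum_le_sum fun y _ => key y).trans ?_
  rw [← Finset.sum_mul, Finset.sum_comm]
  simp only [← Finset.mul_sum]
  have h1 : ∑ a, (∑ y, Z a y) ≤ 2 ^ τ := by
    refine (Finset.sum_le_sum fun a _ => hZ1 a).trans (le_of_eq ?_)
    simp
  have h2 : (1 / 2 ^ τ : ℝ) * ∑ a, (∑ y, Z a y) ≤ 1 := by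
    rw [one_div, inv_mul_le_iff₀ (by positivity), mul_one]
    exact h1
  calc _ ≤ (1 : ℝ) * (1 / 2 ^ τ) := mul_le_mul_of_nonneg_right h2 (by positivity)
    _ = _ := one_mul _

/-- The total variation between the source and the law induced by the code, averaged over keys. -/
def softError {S' : Type*} [Fintype S'] (p : S' → ℝ) (V : U → S' → ℝ) {M τ : ℕ}
    (c : Fin M × (Fin τ → Bool) → U) : ℝ :=
  ∑ t : Fin M → Fin τ → Bool, (∏ _m : Fin M, (1 / 2 ^ τ : ℝ)) *
    ∑ s, |p s - (1 / (M : ℝ)) * ∑ m, V (c (m, t m)) s|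

open scoped Classical in
/-- The decoder for the key that assigns the tags `t`. -/
def tagDecoder {S' Y' : Type*} {M τ : ℕ} (G : U → S') (c : Fin M × (Fin τ → Bool) → U)
    (dec : Y' → Option (Fin M × (Fin τ → Bool))) (y : Y') (t : Fin M → Fin τ → Bool) :
    Option S' :=
  (dec y).bind fun i => if i.2 = t i.1 then some (G (c i)) else none

/-- The performance of the scheme with likelihood encoder built from a code. -/
theorem exists_scheme_of_code (P : Problem S X Y) {V : U → (Fin n → S) → ℝ}
    (hV0 : ∀ u s, 0 ≤ V u s) (hV1 : ∀ u, ∑ s, V u s = 1) (F : U → (Fin n → S) → Fin n → X)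
    (G : U → Fin n → S) {M τ : ℕ} (hM : M ≠ 0) (c : Fin M × (Fin τ → Bool) → U)
    (dec : (Fin n → Y) → Option (Fin M × (Fin τ → Bool))) :
    ∃ A : Scheme S X Y n,
      (∀ W, A.prob P W AttackEvent ≤
        softError (fun s => ∏ i, P.source (s i)) V c + 1 / 2 ^ τ) ∧
      ∀ (E : (Fin n → S) → (Fin n → X) → (Fin n → S) → (Fin n → Y) → Option (Fin n → S) → Prop)
        (err : Fin M × (Fin τ → Bool) → ℝ),
        (∀ (t : Fin M → Fin τ → Bool) (m : Fin M),
          ∑ s, V (c (m, t m)) s * ∑ y, P.reference n (F (c (m, t m)) s) y *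
            (open scoped Classical in if E s (F (c (m, t m)) s) (G (c (m, t m))) y
              (tagDecoder G c dec y t) then 1 else 0) ≤ err (m, t m)) →
        A.prob P (P.reference n) E ≤ softError (fun s => ∏ i, P.source (s i)) V c +
          ∑ t : Fin M → Fin τ → Bool, (∏ _m : Fin M, (1 / 2 ^ τ : ℝ)) *
            ((1 / (M : ℝ)) * ∑ m, err (m, t m)) := by
  classical
  have hM' : (0 : ℝ) < M := by positivity
  have hMne : Nonempty (Fin M) := ⟨⟨0, by omega⟩⟩
  -- The likelihood encoder: the message is drawn from its posterior given the source, as if it were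
  -- uniform and the source had been generated from its codeword. If all likelihoods vanish any law
  -- is allowed.
  choose κ hκ using fun (s : Fin n → S) (t : Fin M → Fin τ → Bool) =>
    exists_stdSimplex_smul (v := fun m => V (c (m, t m)) s) fun m => hV0 _ _
  set p : (Fin n → S) → ℝ := fun s => ∏ i, P.source (s i) with hp
  set A : Scheme S X Y n := Scheme.ofIndex (M * τ) (fun s θ => κ s (keyEquiv M τ θ))
    (fun m s θ => F (c (m, keyEquiv M τ θ m)) s) (fun m θ => G (c (m, keyEquiv M τ θ m)))
    (fun y θ => tagDecoder G c dec y (keyEquiv M τ θ)) with hA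
  -- Change of measure: replacing the true source law by the one induced by the code costs at most
  -- the L¹ distance, since the conditional error probabilities lie between 0 and 1. Under the
  -- induced law the message is uniform.
  have hprob : ∀ W (E : (Fin n → S) → (Fin n → X) → (Fin n → S) → (Fin n → Y) →
      Option (Fin n → S) → Prop), A.prob P W E ≤ softError p V c +
      ∑ t : Fin M → Fin τ → Bool, (∏ _m : Fin M, (1 / 2 ^ τ : ℝ)) * ((1 / (M : ℝ)) * ∑ m,
        ∑ s, V (c (m, t m)) s * ∑ y, W (F (c (m, t m)) s) y *
            if E s (F (c (m, t m)) s) (G (c (m, t m))) y (tagDecoder G c dec y t)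
            then 1 else 0) := by
    intro W E
    rw [hA, Scheme.prob_ofIndex, softError, ← Finset.sum_add_distrib]
    set Φ : (Fin M → Fin τ → Bool) → ℝ := fun t => ∑ s, p s *
          ∑ m, κ s t m * ∑ y, W (F (c (m, t m)) s) y *
          (if E s (F (c (m, t m)) s) (G (c (m, t m))) y (tagDecoder G c dec y t) then 1 else 0)
      with hΦ
    have e1 : ∀ θ : Fin (M * τ) → Bool, ∑ s, (∏ i, P.source (s i)) * (1 / 2 ^ (M * τ)) *
        ∑ m, κ s (keyEquiv M τ θ) m * ∑ y, W (F (c (m, keyEquiv M τ θ m)) s) y *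
          (if E s (F (c (m, keyEquiv M τ θ m)) s) (G (c (m, keyEquiv M τ θ m))) y
            (tagDecoder G c dec y (keyEquiv M τ θ)) then 1 else 0) =
        (1 / 2 ^ (M * τ)) * Φ (keyEquiv M τ θ) := by
      intro θ
      rw [hΦ, Finset.mul_sum]
      refine Finset.sum_congr rfl fun s _ => ?_
      simp only [hp]
      ring
    rw [Finset.sum_congr rfl fun θ _ => e1 θ, sum_keyEquiv Φ]
    refine Finset.sum_le_sum fun t _ => ?_
    rw [← mul_add]
    refine mul_le_mul_of_nonneg_left ?_ (Finset.prod_nonneg fun _ _ => by positivity)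
    rw [Finset.sum_comm (s := (univ : Finset (Fin M))), Finset.mul_sum, ← Finset.sum_add_distrib]
    refine Finset.sum_le_sum fun s _ => ?_
    set ev : Fin M → ℝ := fun m => ∑ y, W (F (c (m, t m)) s) y *
      if E s (F (c (m, t m)) s) (G (c (m, t m))) y (tagDecoder G c dec y t) then 1 else 0 with hev
    have hev0 : ∀ m, 0 ≤ ev m := fun m => Finset.sum_nonneg fun y _ =>
      mul_nonneg ((W _).2.1 y) (by split_ifs <;> simp)
    have hev1 : ∀ m, ev m ≤ 1 := fun m => by
      refine (Finset.sum_le_sum fun y _ => mul_le_of_le_one_right ((W _).2.1 y)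
        (by split_ifs <;> simp)).trans (le_of_eq (W _).2.2)
    have h1 : ∑ m, κ s t m * ev m ≤ 1 := by
      refine (Finset.sum_le_sum fun m _ => mul_le_of_le_one_right ((κ s t).2.1 m)
        (hev1 m)).trans (le_of_eq (κ s t).2.2)
    have h0 : 0 ≤ ∑ m, κ s t m * ev m :=
      Finset.sum_nonneg fun m _ => mul_nonneg ((κ s t).2.1 m) (hev0 m)
    have h2 : 1 / (M : ℝ) * ∑ m, V (c (m, t m)) s * ev m =
        (1 / (M : ℝ) * ∑ m, V (c (m, t m)) s) * ∑ m, κ s t m * ev m := by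
      rw [mul_assoc, Finset.mul_sum (s := (univ : Finset (Fin M))) (f := fun m => κ s t m * ev m)]
      simp only [← mul_assoc, hκ s t]
    rw [h2]
    have h3 := le_abs_self (p s - 1 / (M : ℝ) * ∑ m, V (c (m, t m)) s)
    have h4 := abs_nonneg (p s - 1 / (M : ℝ) * ∑ m, V (c (m, t m)) s)
    nlinarith
  refine ⟨A, fun W => ?_, fun E err herr => ?_⟩
  · refine (hprob W AttackEvent).trans (add_le_add le_rfl ?_)
    have h1 : ∀ (t : Fin M → Fin τ → Bool) m, (∑ s, V (c (m, t m)) s *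
        ∑ y, W (F (c (m, t m)) s) y * (if AttackEvent s (F (c (m, t m)) s) (G (c (m, t m))) y
          (tagDecoder G c dec y t) then 1 else 0)) ≤
        ∑ y, (∑ s, V (c (m, t m)) s * W (F (c (m, t m)) s) y) *
          if ∃ j, j ≠ m ∧ dec y = some (j, t j) then 1 else 0 := by
      intro t m
      simp only [Finset.mul_sum, Finset.sum_mul]
      rw [Finset.sum_comm]
      refine Finset.sum_le_sum fun y _ => Finset.sum_le_sum fun s _ => ?_
      rw [mul_assoc]
      refine mul_le_mul_of_nonneg_left (mul_le_mul_of_nonneg_left ?_ ((W _).2.1 y)) (hV0 _ _)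
      -- An accepted output that differs from the authentic one must come from an index (j, t j)
      -- with j ≠ m: for j = m the correct tag would reproduce the authentic word.
      by_cases h : AttackEvent s (F (c (m, t m)) s) (G (c (m, t m))) y (tagDecoder G c dec y t)
      · rw [if_pos h, if_pos]
        obtain ⟨h1, h2⟩ := h
        rcases hd : dec y with _ | ⟨j, b⟩
        · simp [tagDecoder, hd] at h1
        · by_cases hb : b = t j
          · refine ⟨j, fun hj => h2 ?_, by rw [hb]⟩
            simp [tagDecoder, hd, hb, hj]
          · simp [tagDecoder, hd, hb] at h1
      · rw [if_neg h]
        split_ifs <;> simp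
    have h2 : ∀ m : Fin M, ∑ t : Fin M → Fin τ → Bool, (∏ _m : Fin M, (1 / 2 ^ τ : ℝ)) *
        (∑ s, V (c (m, t m)) s *
        ∑ y, W (F (c (m, t m)) s) y * (if AttackEvent s (F (c (m, t m)) s) (G (c (m, t m))) y
          (tagDecoder G c dec y t) then 1 else 0)) ≤ 1 / 2 ^ τ := by
      intro m
      refine (Finset.sum_le_sum fun t _ => mul_le_mul_of_nonneg_left (h1 t m)
        (Finset.prod_nonneg fun _ _ => by positivity)).trans ?_
      refine sum_tag_guess_le (Z := fun a y => ∑ s, V (c (m, a)) s * W (F (c (m, a)) s) y)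
        (fun a y => Finset.sum_nonneg fun s _ => mul_nonneg (hV0 _ _) ((W _).2.1 y))
        (fun a => ?_) m dec
      have hW : ∀ x, ∑ y, W x y = 1 := fun x => (W x).2.2
      rw [Finset.sum_comm]
      simp only [← Finset.mul_sum, hW, mul_one, hV1, le_refl]
    simp only [mul_left_comm _ (1 / (M : ℝ))]
    rw [← Finset.mul_sum]
    simp only [Finset.mul_sum (s := (univ : Finset (Fin M)))]
    rw [Finset.sum_comm, one_div, inv_mul_le_iff₀ hM']
    refine (Finset.sum_le_sum fun m _ => h2 m).trans (le_of_eq ?_)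
    simp
  · refine (hprob _ E).trans (add_le_add le_rfl (Finset.sum_le_sum fun t _ =>
      mul_le_mul_of_nonneg_left (mul_le_mul_of_nonneg_left
        (Finset.sum_le_sum fun m _ => herr t m) (by positivity))
        (Finset.prod_nonneg fun _ _ => by positivity)))

end Code

/-! ### Random coding -/

section RandomCoding

theorem exists_le_of_average_le {C : Type*} [Fintype C] {μ : C → ℝ} (h0 : ∀ c, 0 ≤ μ c)
    (h1 : ∑ c, μ c = 1) {f : C → ℝ} {δ : ℝ} (h : ∑ c, μ c * f c ≤ δ) : ∃ c, f c ≤ δ := by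
  have hne : Nonempty C := by
    by_contra hn
    rw [not_nonempty_iff] at hn
    simp at h1
  obtain ⟨c, hc⟩ := Finite.exists_min f
  refine ⟨c, le_trans ?_ h⟩
  calc f c = ∑ c', μ c' * f c := by rw [← Finset.sum_mul, h1, one_mul]
    _ ≤ _ := Finset.sum_le_sum fun c' _ => mul_le_mul_of_nonneg_left (hc c') (h0 c')

variable {S X Y U : Type*} [Fintype S] [Fintype X] [Fintype Y] [Fintype U] {n : ℕ}

/-- The law of the channel output given the codeword. -/
def codeChannel (P : Problem S X Y) (V : U → (Fin n → S) → ℝ) (F : U → (Fin n → S) → Fin n → X)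
    (u : U) (y : Fin n → Y) : ℝ :=
  ∑ s, V u s * P.reference n (F u s) y

open scoped Classical in
/-- The probability, given the codeword, of exceeding one of the distortions `D₁`, `D₂`. -/
def distortionError (P : Problem S X Y) (V : U → (Fin n → S) → ℝ)
    (F : U → (Fin n → S) → Fin n → X) (G : U → Fin n → S) (D₁ D₂ : ℝ) (u : U) : ℝ :=
  ∑ s, V u s * if (1 / (n : ℝ)) * ∑ i, (P.de (s i) (F u s i) : ℝ) > D₁ ∨
    (1 / (n : ℝ)) * ∑ i, (P.dr (s i) (G u i) : ℝ) > D₂ then 1 else 0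

open scoped Classical in
/-- The random coding bound. -/
def codingBound (P : Problem S X Y) (q : U → ℝ) (V : U → (Fin n → S) → ℝ)
    (F : U → (Fin n → S) → Fin n → X) (G : U → Fin n → S) (M τ : ℕ) (L₁ L₂ D₁ D₂ : ℝ) : ℝ :=
  2 * (∑ u, ∑ s, q u * V u s * if L₁ * (∏ i, P.source (s i)) < V u s then 1 else 0) + √(L₁ / M) +
    ((∑ u, ∑ y, q u * codeChannel P V F u y *
      if L₂ * (∑ u', q u' * codeChannel P V F u' y) < codeChannel P V F u y then 0 else 1) +
      M * 2 ^ τ / L₂) +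
    ∑ u, q u * distortionError P V F G D₁ D₂ u

theorem exists_scheme (P : Problem S X Y) {q : U → ℝ} (hq0 : ∀ u, 0 ≤ q u) (hq1 : ∑ u, q u = 1)
    {V : U → (Fin n → S) → ℝ} (hV0 : ∀ u s, 0 ≤ V u s) (hV1 : ∀ u, ∑ s, V u s = 1)
    (hp : ∀ s, ∑ u, q u * V u s = ∏ i, P.source (s i)) (F : U → (Fin n → S) → Fin n → X)
    (G : U → Fin n → S) {M τ : ℕ} (hM : M ≠ 0) {L₁ L₂ : ℝ} (hL₁ : 0 ≤ L₁) (hL₂ : 0 < L₂)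
    (D₁ D₂ : ℝ) :
    ∃ A : Scheme S X Y n,
      (∀ W, A.prob P W AttackEvent ≤ codingBound P q V F G M τ L₁ L₂ D₁ D₂ + 1 / 2 ^ τ) ∧
      A.prob P (P.reference n) (P.EncodingEvent D₁) ≤ codingBound P q V F G M τ L₁ L₂ D₁ D₂ ∧
      A.prob P (P.reference n) (P.ReconstructionEvent D₂) ≤
        codingBound P q V F G M τ L₁ L₂ D₁ D₂ := by
  classical
  have hM' : (0 : ℝ) < M := by positivity
  set w := codeChannel P V F with hw
  have hw0 : ∀ u y, 0 ≤ w u y := fun u y => Finset.sum_nonneg fun s _ =>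
    mul_nonneg (hV0 u s) ((P.reference n (F u s)).2.1 y)
  have hW1 : ∀ x, ∑ y, P.reference n x y = 1 := fun x => (P.reference n x).2.2
  have hw1 : ∀ u, ∑ y, w u y = 1 := by
    intro u
    simp only [hw, codeChannel]
    rw [Finset.sum_comm]
    simp only [← Finset.mul_sum, hW1, mul_one, hV1]
  set r : (Fin n → Y) → ℝ := fun y => ∑ u, q u * w u y with hr
  set bd := distortionError P V F G D₁ D₂ with hbd
  have hbd0 : ∀ u, 0 ≤ bd u := fun u => Finset.sum_nonneg fun s _ =>
    mul_nonneg (hV0 u s) (by split_ifs <;> simp)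
  let dec := fun c : Fin M × (Fin τ → Bool) → U => thresholdDecoder L₂ w r c
  let err := fun (c : Fin M × (Fin τ → Bool) → U) i =>
    ∑ y, w (c i) y * (if dec c y ≠ some i then 1 else 0) + bd (c i)
  have herr0 : ∀ c i, 0 ≤ err c i := fun c i => add_nonneg (Finset.sum_nonneg fun y _ =>
    mul_nonneg (hw0 _ _) (by split_ifs <;> simp)) (hbd0 _)
  -- Covering error, decoding error and distortion error are added before averaging, so that one
  -- codebook is good for all of them at once.
  let tot := fun c : Fin M × (Fin τ → Bool) → U =>
    softError (fun s => ∏ i, P.source (s i)) V c +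
      ∑ t : Fin M → Fin τ → Bool, (∏ _m : Fin M, (1 / 2 ^ τ : ℝ)) *
        ((1 / (M : ℝ)) * ∑ m, err c (m, t m))
  have hwt0 : ∀ c : Fin M × (Fin τ → Bool) → U, 0 ≤ ∏ i, q (c i) :=
    fun c => Finset.prod_nonneg fun i _ => hq0 _
  have hwt1 : ∑ c : Fin M × (Fin τ → Bool) → U, ∏ i, q (c i) = 1 :=
    sum_pi (f := fun _ => q) fun _ => hq1
  have htag0 : 0 ≤ ∏ _m : Fin M, (1 / 2 ^ τ : ℝ) := Finset.prod_nonneg fun _ _ => by positivity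
  have htag1 : ∑ _t : Fin M → Fin τ → Bool, ∏ _m : Fin M, (1 / 2 ^ τ : ℝ) = 1 :=
    sum_pi (f := fun (_ : Fin M) (_ : Fin τ → Bool) => (1 / 2 ^ τ : ℝ)) fun _ => by simp
  set B₁ := 2 * (∑ u, ∑ s, q u * V u s * if L₁ * (∏ i, P.source (s i)) < V u s then 1 else 0) +
    √(L₁ / M) with hB₁
  set B₂ := ((∑ u, ∑ y, q u * w u y * if L₂ * r y < w u y then 0 else 1) + M * 2 ^ τ / L₂) +
    ∑ u, q u * bd u with hB₂
  have hbound : codingBound P q V F G M τ L₁ L₂ D₁ D₂ = B₁ + B₂ := by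
    simp only [codingBound, hB₁, hB₂, hw, hr, hbd]
    ring
  have havg : ∑ c, (∏ i, q (c i)) * tot c ≤ B₁ + B₂ := by
    simp only [tot, mul_add, Finset.sum_add_distrib]
    refine add_le_add ?_ ?_
    · simp only [softError, Finset.mul_sum (s := (univ : Finset (Fin M → Fin τ → Bool)))]
      rw [Finset.sum_comm]
      -- For a fixed tag assignment the selected codewords sit at distinct positions and are
      -- therefore i.i.d., so soft covering applies to each key separately.
      have h1 : ∀ t : Fin M → Fin τ → Bool, ∑ c : Fin M × (Fin τ → Bool) → U,
          (∏ i, q (c i)) * ((∏ _m : Fin M, (1 / 2 ^ τ : ℝ)) *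
            ∑ s, |(∏ i, P.source (s i)) - (1 / (M : ℝ)) * ∑ m, V (c (m, t m)) s|) ≤
          (∏ _m : Fin M, (1 / 2 ^ τ : ℝ)) * B₁ := by
        intro t
        simp only [mul_left_comm _ (∏ _m : Fin M, (1 / 2 ^ τ : ℝ))]
        rw [← Finset.mul_sum]
        exact mul_le_mul_of_nonneg_left (soft_covering hq0 hq1 hV0 hp
          (sum_pi (f := fun (_ : Fin n) s => P.source s) fun _ => P.sum_source) hM
          (e := fun m => (m, t m)) (fun a b h => (Prod.ext_iff.1 h).1) hL₁) htag0
      refine (Finset.sum_le_sum fun t _ => h1 t).trans (le_of_eq ?_)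
      rw [← Finset.sum_mul, htag1, one_mul]
    · have herr : ∀ i, ∑ c : Fin M × (Fin τ → Bool) → U, (∏ i, q (c i)) * err c i ≤ B₂ := by
        intro i
        simp only [err, mul_add, Finset.sum_add_distrib]
        refine add_le_add ?_ (le_of_eq (sum_pi_eval (f := fun _ => q) (fun _ => hq1) i bd))
        refine (packing hq0 hq1 hw0 hw1 (r := r) (fun y => rfl) hL₂ i).trans (le_of_eq ?_)
        simp
      simp only [Finset.mul_sum (s := (univ : Finset (Fin M → Fin τ → Bool)))]
      rw [Finset.sum_comm]
      have h1 : ∀ t : Fin M → Fin τ → Bool, ∑ c : Fin M × (Fin τ → Bool) → U,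
          (∏ i, q (c i)) * ((∏ _m : Fin M, (1 / 2 ^ τ : ℝ)) *
            ((1 / (M : ℝ)) * ∑ m, err c (m, t m))) ≤ (∏ _m : Fin M, (1 / 2 ^ τ : ℝ)) * B₂ := by
        intro t
        simp only [mul_left_comm _ (∏ _m : Fin M, (1 / 2 ^ τ : ℝ))]
        rw [← Finset.mul_sum]
        refine mul_le_mul_of_nonneg_left ?_ htag0
        simp only [mul_left_comm _ (1 / (M : ℝ))]
        rw [← Finset.mul_sum]
        simp only [Finset.mul_sum (s := (univ : Finset (Fin M)))]
        rw [Finset.sum_comm, one_div, inv_mul_le_iff₀ hM']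
        refine (Finset.sum_le_sum fun m _ => herr (m, t m)).trans (le_of_eq ?_)
        simp
      refine (Finset.sum_le_sum fun t _ => h1 t).trans (le_of_eq ?_)
      rw [← Finset.sum_mul, htag1, one_mul]
  obtain ⟨c, hc⟩ := exists_le_of_average_le hwt0 hwt1 havg
  obtain ⟨A, hA1, hA2⟩ := exists_scheme_of_code P hV0 hV1 F G hM c (dec c)
  rw [hbound]
  refine ⟨A, fun W => ?_, ?_, ?_⟩
  · refine (hA1 W).trans (add_le_add (le_trans ?_ hc) le_rfl)
    exact le_add_of_nonneg_right (Finset.sum_nonneg fun t _ => mul_nonneg htag0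
      (mul_nonneg (by positivity) (Finset.sum_nonneg fun m _ => herr0 _ _)))
  · refine (hA2 _ (err c) fun t m => ?_).trans hc
    refine le_trans ?_ (le_add_of_nonneg_left (Finset.sum_nonneg fun y _ =>
      mul_nonneg (hw0 _ _) (by split_ifs <;> simp)))
    refine Finset.sum_le_sum fun s _ => mul_le_mul_of_nonneg_left ?_ (hV0 _ _)
    by_cases h : (1 / (n : ℝ)) * ∑ i, (P.de (s i) (F (c (m, t m)) s i) : ℝ) > D₁
    · rw [if_pos (Or.inl h), ← hW1 (F (c (m, t m)) s)]
      exact Finset.sum_le_sum fun y _ =>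
        mul_le_of_le_one_right ((P.reference n _).2.1 y) (by split_ifs <;> simp)
    · refine le_trans (le_of_eq (Finset.sum_eq_zero fun y _ => ?_))
        (by split_ifs <;> simp : (0 : ℝ) ≤ _)
      rw [if_neg (show ¬ P.EncodingEvent D₁ _ _ _ _ _ from h), mul_zero]
  · refine (hA2 _ (err c) fun t m => ?_).trans hc
    set i : Fin M × (Fin τ → Bool) := (m, t m) with hi
    have h1 : ∀ s y, (if P.ReconstructionEvent D₂ s (F (c i) s) (G (c i)) y
        (tagDecoder G c (dec c) y t) then (1 : ℝ) else 0) ≤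
        (if dec c y ≠ some i then 1 else 0) +
        (if (1 / (n : ℝ)) * ∑ j, (P.de (s j) (F (c i) s j) : ℝ) > D₁ ∨
          (1 / (n : ℝ)) * ∑ j, (P.dr (s j) (G (c i) j) : ℝ) > D₂ then 1 else 0) := by
      intro s y
      by_cases hd : dec c y = some i
      · have ht : tagDecoder G c (dec c) y t = some (G (c i)) := by
          simp [tagDecoder, hd, hi]
        rw [ht]
        by_cases hb : (1 / (n : ℝ)) * ∑ j, (P.dr (s j) (G (c i) j) : ℝ) > D₂
        · rw [if_pos (Or.inr hb : _ ∨ _)]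
          split_ifs <;> simp
        · rw [if_neg]
          · exact add_nonneg (by split_ifs <;> simp) (by split_ifs <;> simp)
          · rintro (h | ⟨t', h, h'⟩)
            · simp at h
            · rw [← Option.some.inj h] at h'
              exact hb h'
      · rw [if_pos hd]
        have : (0 : ℝ) ≤ (if (1 / (n : ℝ)) * ∑ j, (P.de (s j) (F (c i) s j) : ℝ) > D₁ ∨
          (1 / (n : ℝ)) * ∑ j, (P.dr (s j) (G (c i) j) : ℝ) > D₂ then 1 else 0) := by
          split_ifs <;> simp
        refine le_trans ?_ (le_add_of_nonneg_right this)
        split_ifs <;> simp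
    have h2 : ∀ s, V (c i) s * ∑ y, P.reference n (F (c i) s) y *
        (if P.ReconstructionEvent D₂ s (F (c i) s) (G (c i)) y
        (tagDecoder G c (dec c) y t) then (1 : ℝ) else 0) ≤
        ∑ y, V (c i) s * P.reference n (F (c i) s) y * (if dec c y ≠ some i then 1 else 0) +
        V (c i) s * (if (1 / (n : ℝ)) * ∑ j, (P.de (s j) (F (c i) s j) : ℝ) > D₁ ∨
          (1 / (n : ℝ)) * ∑ j, (P.dr (s j) (G (c i) j) : ℝ) > D₂ then 1 else 0) := by
      intro s
      have := Finset.sum_le_sum fun y (_ : y ∈ univ) =>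
        mul_le_mul_of_nonneg_left (h1 s y) ((P.reference n (F (c i) s)).2.1 y)
      refine (mul_le_mul_of_nonneg_left this (hV0 _ _)).trans (le_of_eq ?_)
      simp only [mul_add, Finset.sum_add_distrib]
      congr 1
      · simp only [Finset.mul_sum, mul_assoc]
        rfl
      · rw [← Finset.sum_mul]
        congr 1
        rw [show ∑ y, (P.reference n (F (c i) s)).1 y = 1 from hW1 _, one_mul]
    refine (Finset.sum_le_sum fun s _ => h2 s).trans (le_of_eq ?_)
    rw [Finset.sum_add_distrib]
    change _ = ∑ y, w (c i) y * _ + bd (c i)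
    congr 1
    rw [Finset.sum_comm]
    refine Finset.sum_congr rfl fun y _ => ?_
    rw [← Finset.sum_mul]
    rfl

end RandomCoding

/-! ### Concentration -/

section Chebyshev

variable {B U S X Y : Type*} [Fintype B] [Fintype U] [Fintype S] [Fintype X] [Fintype Y]

open scoped Classical in
theorem chebyshev {ρ : B → ℝ} (hρ0 : ∀ b, 0 ≤ ρ b) (hρ1 : ∑ b, ρ b = 1) (h : B → ℝ) {n : ℕ}
    (hn : n ≠ 0) {γ : ℝ} (hγ : 0 < γ) :
    ∑ b : Fin n → B, (∏ i, ρ (b i)) *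
      (if n * γ ≤ |∑ i, h (b i) - n * ∑ b, ρ b * h b| then 1 else 0) ≤
      (∑ b, ρ b * (h b - ∑ b', ρ b' * h b') ^ 2) / γ ^ 2 / n := by
  have hn' : (0 : ℝ) < n := by positivity
  set μ := ∑ b, ρ b * h b with hμ
  have hG : ∑ b, ρ b * (h b - μ) = 0 := by
    simp only [mul_sub, Finset.sum_sub_distrib, ← Finset.sum_mul, hρ1, hμ]
    ring
  have h1 := sum_pi_sum_sq (ι := Fin n) (e := id) hρ1 Function.injective_id hG
  have h2 : ∀ b : Fin n → B, ((n : ℝ) * γ) ^ 2 * ((∏ i, ρ (b i)) *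
      (if n * γ ≤ |∑ i, h (b i) - n * μ| then 1 else 0)) ≤
      (∏ i, ρ (b i)) * (∑ i, (h (b i) - μ)) ^ 2 := by
    intro b
    have hb : 0 ≤ ∏ i, ρ (b i) := Finset.prod_nonneg fun i _ => hρ0 _
    rw [mul_left_comm]
    refine mul_le_mul_of_nonneg_left ?_ hb
    have e : ∑ i, (h (b i) - μ) = ∑ i, h (b i) - n * μ := by
      rw [Finset.sum_sub_distrib]
      simp
    rw [e]
    split_ifs with hc
    · rw [mul_one, ← sq_abs (∑ i, h (b i) - n * μ)]
      exact pow_le_pow_left₀ (by positivity) hc 2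
    · rw [mul_zero]; positivity
  have h3 := Finset.sum_le_sum fun b (_ : b ∈ univ) => h2 b
  simp only [id] at h1
  rw [h1, ← Finset.mul_sum, Fintype.card_fin] at h3
  rw [div_div, le_div_iff₀ (by positivity)]
  refine le_of_mul_le_mul_left ?_ hn'
  calc _ = (n * γ) ^ 2 * ∑ b : Fin n → B, (∏ i, ρ (b i)) *
      (if n * γ ≤ |∑ i, h (b i) - n * μ| then 1 else 0) := by ring
    _ ≤ _ := h3

theorem sum_pair (n : ℕ) (Φ : (Fin n → U) → (Fin n → S) → ℝ) :
    ∑ u, ∑ s, Φ u s = ∑ b : Fin n → U × S, Φ (fun i => (b i).1) (fun i => (b i).2) := by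
  rw [← Fintype.sum_prod_type', ← Equiv.sum_comp (Equiv.arrowProdEquivProdArrow (Fin n) _ _)]
  rfl

/-- The mean of `h` when `u` has law `q` and `s` is drawn from the kernel `V`. -/
def pairMean (q : U → ℝ) (V : U → S → ℝ) (h : U → S → ℝ) : ℝ := ∑ u, ∑ s, q u * V u s * h u s

-- The event need only force a deviation on pairs of positive probability, because the information
-- density carries no meaning off the support.
open scoped Classical in
theorem pair_chebyshev {q : U → ℝ} (hq0 : ∀ u, 0 ≤ q u) (hq1 : ∑ u, q u = 1) {V : U → S → ℝ}
    (hV0 : ∀ u s, 0 ≤ V u s) (hV1 : ∀ u, ∑ s, V u s = 1) (h : U → S → ℝ) {γ : ℝ} (hγ : 0 < γ) :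
    ∃ C : ℝ, ∀ n : ℕ, n ≠ 0 → ∀ E : (Fin n → U) → (Fin n → S) → Prop,
      (∀ u s, (∀ i, 0 < q (u i) * V (u i) (s i)) → E u s →
        n * γ ≤ |∑ i, h (u i) (s i) - n * pairMean q V h|) →
      ∑ u : Fin n → U, ∑ s, (∏ i, q (u i)) * nfold V u s * (if E u s then 1 else 0) ≤ C / n := by
  refine ⟨(∑ b : U × S, q b.1 * V b.1 b.2 * (h b.1 b.2 -
    ∑ b' : U × S, q b'.1 * V b'.1 b'.2 * h b'.1 b'.2) ^ 2) / γ ^ 2, fun n hn E hE => ?_⟩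
  have h1 := chebyshev (ρ := fun b : U × S => q b.1 * V b.1 b.2)
    (fun b => mul_nonneg (hq0 _) (hV0 _ _))
    (by rw [Fintype.sum_prod_type]; simp only [← Finset.mul_sum, hV1, mul_one, hq1])
    (fun b => h b.1 b.2) hn hγ
  refine le_trans ?_ h1
  rw [sum_pair]
  refine Finset.sum_le_sum fun b _ => ?_
  have e1 : (∏ i, q (b i).1) * nfold V (fun i => (b i).1) (fun i => (b i).2) =
      ∏ i, (q (b i).1 * V (b i).1 (b i).2) := by
    rw [Finset.prod_mul_distrib]; rfl
  rw [e1]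
  by_cases hpos : ∀ i, 0 < q (b i).1 * V (b i).1 (b i).2
  · refine mul_le_mul_of_nonneg_left ?_ (Finset.prod_nonneg fun i _ => (hpos i).le)
    by_cases hb : E (fun i => (b i).1) (fun i => (b i).2)
    · have := hE _ _ hpos hb
      rw [pairMean, ← Fintype.sum_prod_type'] at this
      rw [if_pos hb, if_pos this]
    · rw [if_neg hb]
      split_ifs <;> simp
  · push Not at hpos
    obtain ⟨i, hi⟩ := hpos
    have hi0 : q (b i).1 * V (b i).1 (b i).2 = 0 :=
      le_antisymm hi (mul_nonneg (hq0 _) (hV0 _ _))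
    rw [Finset.prod_eq_zero (Finset.mem_univ i) hi0, zero_mul, zero_mul]

/-- The information density `log (V(s|u) / p(s))`. -/
def infoDensity (V : U → S → ℝ) (p : S → ℝ) (u : U) (s : S) : ℝ := log (V u s / p s)

theorem sum_infoDensity {n : ℕ} {q : U → ℝ} {V : U → S → ℝ} (hq0 : ∀ u, 0 ≤ q u)
    (hV0 : ∀ u s, 0 ≤ V u s) {p : S → ℝ} (hp : ∀ s, ∑ u, q u * V u s = p s) {u : Fin n → U}
    {s : Fin n → S} (h : ∀ i, 0 < q (u i) * V (u i) (s i)) :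
    0 < nfold V u s ∧ 0 < ∏ i, p (s i) ∧
      ∑ i, infoDensity V p (u i) (s i) = log (nfold V u s) - log (∏ i, p (s i)) := by
  have hV : ∀ i, 0 < V (u i) (s i) := fun i =>
    lt_of_le_of_ne (hV0 _ _) fun h0 => by have := h i; rw [← h0] at this; simp at this
  have hp' : ∀ i, 0 < p (s i) := fun i => by
    rw [← hp]
    exact lt_of_lt_of_le (h i) (Finset.single_le_sum (f := fun u => q u * V u (s i))
      (fun u _ => mul_nonneg (hq0 u) (hV0 u _)) (Finset.mem_univ _))
  refine ⟨Finset.prod_pos fun i _ => hV i, Finset.prod_pos fun i _ => hp' i, ?_⟩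
  rw [nfold, log_prod fun i _ => (hV i).ne', log_prod fun i _ => (hp' i).ne',
    ← Finset.sum_sub_distrib]
  exact Finset.sum_congr rfl fun i _ => log_div (hV i).ne' (hp' i).ne'

open scoped Classical in
/-- Atypically large information density is improbable. -/
theorem infoDensity_upper {q : U → ℝ} (hq0 : ∀ u, 0 ≤ q u) (hq1 : ∑ u, q u = 1) {V : U → S → ℝ}
    (hV0 : ∀ u s, 0 ≤ V u s) (hV1 : ∀ u, ∑ s, V u s = 1) {p : S → ℝ}
    (hp : ∀ s, ∑ u, q u * V u s = p s) {γ : ℝ} (hγ : 0 < γ) :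
    ∃ C : ℝ, ∀ n : ℕ, n ≠ 0 → ∑ u : Fin n → U, ∑ s, (∏ i, q (u i)) * nfold V u s *
      (if exp (n * (pairMean q V (infoDensity V p) + γ)) * ∏ i, p (s i) < nfold V u s
        then 1 else 0) ≤ C / n := by
  obtain ⟨C, hC⟩ := pair_chebyshev hq0 hq1 hV0 hV1 (infoDensity V p) hγ
  refine ⟨C, fun n hn => hC n hn _ fun u s hpos hE => ?_⟩
  obtain ⟨h1, h2, h3⟩ := sum_infoDensity hq0 hV0 hp hpos
  rw [h3]
  have := log_lt_log (by positivity) hE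
  rw [log_mul (exp_pos _).ne' h2.ne', log_exp] at this
  refine le_trans ?_ (le_abs_self _)
  linarith

open scoped Classical in
/-- Atypically small information density is improbable. -/
theorem infoDensity_lower {q : U → ℝ} (hq0 : ∀ u, 0 ≤ q u) (hq1 : ∑ u, q u = 1) {V : U → S → ℝ}
    (hV0 : ∀ u s, 0 ≤ V u s) (hV1 : ∀ u, ∑ s, V u s = 1) {p : S → ℝ}
    (hp : ∀ s, ∑ u, q u * V u s = p s) {γ : ℝ} (hγ : 0 < γ) :
    ∃ C : ℝ, ∀ n : ℕ, n ≠ 0 → ∑ u : Fin n → U, ∑ s, (∏ i, q (u i)) * nfold V u s *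
      (if exp (n * (pairMean q V (infoDensity V p) - γ)) * ∏ i, p (s i) < nfold V u s
        then 0 else 1) ≤ C / n := by
  obtain ⟨C, hC⟩ := pair_chebyshev hq0 hq1 hV0 hV1 (infoDensity V p) hγ
  refine ⟨C, fun n hn => ?_⟩
  have := hC n hn (fun u s => ¬ exp (n * (pairMean q V (infoDensity V p) - γ)) *
    ∏ i, p (s i) < nfold V u s) fun u s hpos hE => ?_
  · refine le_of_eq_of_le (Finset.sum_congr rfl fun u _ => Finset.sum_congr rfl fun s _ => ?_) this
    by_cases h : exp (n * (pairMean q V (infoDensity V p) - γ)) * ∏ i, p (s i) < nfold V u s <;>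
      simp [h]
  obtain ⟨h1, h2, h3⟩ := sum_infoDensity hq0 hV0 hp hpos
  rw [h3]
  have := log_le_log h1 (not_lt.1 hE)
  rw [log_mul (exp_pos _).ne' h2.ne', log_exp] at this
  rw [abs_sub_comm]
  refine le_trans ?_ (le_abs_self _)
  linarith

open scoped Classical in
theorem average_upper {q : U → ℝ} (hq0 : ∀ u, 0 ≤ q u) (hq1 : ∑ u, q u = 1) {V : U → S → ℝ}
    (hV0 : ∀ u s, 0 ≤ V u s) (hV1 : ∀ u, ∑ s, V u s = 1) (d : U → S → ℝ) {D : ℝ}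
    (hD : pairMean q V d ≤ D) {η : ℝ} (hη : 0 < η) :
    ∃ C : ℝ, ∀ n : ℕ, n ≠ 0 → ∑ u : Fin n → U, ∑ s, (∏ i, q (u i)) * nfold V u s *
      (if (1 / (n : ℝ)) * ∑ i, d (u i) (s i) > D + η then 1 else 0) ≤ C / n := by
  obtain ⟨C, hC⟩ := pair_chebyshev hq0 hq1 hV0 hV1 d hη
  refine ⟨C, fun n hn => hC n hn _ fun u s _ hE => ?_⟩
  have hn' : (0 : ℝ) < n := by positivity
  rw [gt_iff_lt, one_div, ← div_eq_inv_mul, lt_div_iff₀ hn'] at hE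
  refine le_trans ?_ (le_abs_self _)
  nlinarith

end Chebyshev

open Filter Topology

/-! ### Achievability for strictly positive rate gap -/

section Achievability

variable {S X Y U : Type*} [Fintype S] [Fintype X] [Fintype Y] [Fintype U]

theorem sum_pi_mul_nfold {n : ℕ} {q : U → ℝ} {V : U → S → ℝ} {p : S → ℝ}
    (hp : ∀ s, ∑ u, q u * V u s = p s) (s : Fin n → S) :
    ∑ u : Fin n → U, (∏ i, q (u i)) * nfold V u s = ∏ i, p (s i) := by
  simp only [nfold, ← Finset.prod_mul_distrib]
  rw [sum_prod_pi (fun i u => q u * V u (s i))]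
  simp only [hp]

/-- The single-letter channel from the auxiliary variable to the channel output. -/
def letterChannel (P : Problem S X Y) (V : U → S → ℝ) (f : U → S → X) (u : U) (y : Y) : ℝ :=
  ∑ s, V u s * P.channel (f u s) y

theorem codeChannel_nfold (P : Problem S X Y) (V : U → S → ℝ) (f : U → S → X) {n : ℕ}
    (u : Fin n → U) (y : Fin n → Y) :
    codeChannel P (nfold V) (fun u s i => f (u i) (s i)) u y = nfold (letterChannel P V f) u y := by
  simp only [codeChannel, P.reference_apply, nfold, ← Finset.prod_mul_distrib]
  rw [sum_prod_pi (fun i s => V (u i) s * P.channel (f (u i) s) (y i))]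
  rfl

theorem Scheme.prob_mono (P : Problem S X Y) {n : ℕ} (A : Scheme S X Y n) (W : BlockChannel X Y n)
    {E E' : (Fin n → S) → (Fin n → X) → (Fin n → S) → (Fin n → Y) → Option (Fin n → S) → Prop}
    (h : ∀ s x r y φ, E s x r y φ → E' s x r y φ) : A.prob P W E ≤ A.prob P W E' := by
  classical
  rw [prob_eq_avg, prob_eq_avg]
  refine avg_mono fun θ s x r y φ => ?_
  by_cases h1 : E s x r y φ
  · rw [if_pos h1, if_pos (h _ _ _ _ _ h1)]
  · rw [if_neg h1]
    split_ifs <;> simp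

theorem Scheme.prob_nonneg (P : Problem S X Y) {n : ℕ} (A : Scheme S X Y n)
    (W : BlockChannel X Y n)
    (E : (Fin n → S) → (Fin n → X) → (Fin n → S) → (Fin n → Y) → Option (Fin n → S) → Prop) :
    0 ≤ A.prob P W E := by
  unfold prob
  refine Finset.sum_nonneg fun θ _ => Finset.sum_nonneg fun s _ => Finset.sum_nonneg fun x _ =>
    Finset.sum_nonneg fun r _ => Finset.sum_nonneg fun y _ => Finset.sum_nonneg fun φ _ => ?_
  split_ifs
  · exact A.law_nonneg P W _ _ _ _ _ _
  · exact le_rfl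

/-- Schemes whose error probabilities are eventually bounded by a null sequence achieve the
distortion pair. -/
theorem Problem.Achieves.of_bound {P : Problem S X Y} {D₁ D₂ : ℝ} {b : ℕ → ℝ}
    (hb : Tendsto b atTop (𝓝 0)) (A : (n : ℕ) → Scheme S X Y n)
    (h1 : ∀ᶠ n in atTop, ∀ W, (A n).prob P W AttackEvent ≤ b n)
    (h2 : ∀ᶠ n in atTop, (A n).prob P (P.reference n) (P.EncodingEvent D₁) ≤ b n)
    (h3 : ∀ᶠ n in atTop, (A n).prob P (P.reference n) (P.ReconstructionEvent D₂) ≤ b n) :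
    P.Achieves D₁ D₂ := by
  refine ⟨A, fun W => ?_, fun ε hε => ⟨?_, ?_⟩⟩
  · exact tendsto_of_tendsto_of_tendsto_of_le_of_le' tendsto_const_nhds hb
      (Eventually.of_forall fun n => (A n).prob_nonneg P _ _) (h1.mono fun n h => h (W n))
  · refine tendsto_of_tendsto_of_tendsto_of_le_of_le' tendsto_const_nhds hb
      (Eventually.of_forall fun n => (A n).prob_nonneg P _ _) (h2.mono fun n h => ?_)
    refine le_trans (Scheme.prob_mono P _ _ fun s x r y φ he => ?_) h
    unfold EncodingEvent at *
    linarith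
  · refine tendsto_of_tendsto_of_tendsto_of_le_of_le' tendsto_const_nhds hb
      (Eventually.of_forall fun n => (A n).prob_nonneg P _ _) (h3.mono fun n h => ?_)
    refine le_trans (Scheme.prob_mono P _ _ fun s x r y φ he => ?_) h
    rcases he with he | ⟨t, ht, he⟩
    · exact Or.inl he
    · exact Or.inr ⟨t, ht, by linarith⟩

theorem distortionError_le (P : Problem S X Y) {q : U → ℝ} (hq0 : ∀ u, 0 ≤ q u)
    (hq1 : ∑ u, q u = 1) {V : U → S → ℝ} (hV0 : ∀ u s, 0 ≤ V u s) (hV1 : ∀ u, ∑ s, V u s = 1)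
    (f : U → S → X) (g : U → S) {De Dr η : ℝ} (hη : 0 < η)
    (hDe : pairMean q V (fun u s => (P.de s (f u s) : ℝ)) ≤ De)
    (hDr : pairMean q V (fun u s => (P.dr s (g u) : ℝ)) ≤ Dr) :
    ∃ C : ℝ, ∀ n : ℕ, n ≠ 0 → ∑ u : Fin n → U, (∏ i, q (u i)) *
      distortionError P (nfold V) (fun u s i => f (u i) (s i)) (fun u i => g (u i))
        (De + η) (Dr + η) u ≤ C / n := by
  classical
  obtain ⟨C₁, h1⟩ := average_upper hq0 hq1 hV0 hV1 (fun u s => (P.de s (f u s) : ℝ)) hDe hη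
  obtain ⟨C₂, h2⟩ := average_upper hq0 hq1 hV0 hV1 (fun u s => (P.dr s (g u) : ℝ)) hDr hη
  refine ⟨C₁ + C₂, fun n hn => ?_⟩
  rw [add_div]
  refine le_trans ?_ (add_le_add (h1 n hn) (h2 n hn))
  rw [← Finset.sum_add_distrib]
  refine Finset.sum_le_sum fun u _ => ?_
  rw [distortionError, Finset.mul_sum, ← Finset.sum_add_distrib]
  refine Finset.sum_le_sum fun s _ => ?_
  rw [← mul_add, ← mul_assoc]
  refine mul_le_mul_of_nonneg_left ?_
    (mul_nonneg (Finset.prod_nonneg fun i _ => hq0 _) (nfold_nonneg hV0 _ _))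
  by_cases ha : (1 / (n : ℝ)) * ∑ i, (P.de (s i) (f (u i) (s i)) : ℝ) > De + η <;>
    by_cases hb : (1 / (n : ℝ)) * ∑ i, (P.dr (s i) (g (u i)) : ℝ) > Dr + η <;>
    simp only [ha, hb, or_self, or_true, or_false, if_true, if_false] <;> norm_num

/-- Random coding achieves the distortion pair when the auxiliary variable carries strictly more
information about the channel output than about the source. -/
theorem Problem.achieves_of_gap (P : Problem S X Y) {q : U → ℝ} (hq0 : ∀ u, 0 ≤ q u)
    (hq1 : ∑ u, q u = 1) {V : U → S → ℝ} (hV0 : ∀ u s, 0 ≤ V u s) (hV1 : ∀ u, ∑ s, V u s = 1)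
    (hp : ∀ s, ∑ u, q u * V u s = P.source s) (f : U → S → X) (g : U → S)
    (hI0 : 0 ≤ pairMean q V (infoDensity V fun s => P.source s))
    (hI : pairMean q V (infoDensity V fun s => P.source s) <
      pairMean q (letterChannel P V f) (infoDensity (letterChannel P V f)
        fun y => ∑ u, q u * letterChannel P V f u y)) {De Dr η : ℝ} (hη : 0 < η)
    (hDe : pairMean q V (fun u s => (P.de s (f u s) : ℝ)) ≤ De)
    (hDr : pairMean q V (fun u s => (P.dr s (g u) : ℝ)) ≤ Dr) :
    P.Achieves (De + η) (Dr + η) := by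
  classical
  set w := letterChannel P V f with hw
  set r : Y → ℝ := fun y => ∑ u, q u * w u y with hr
  set a := pairMean q V (infoDensity V fun s => P.source s) with ha
  set b := pairMean q w (infoDensity w r) with hb
  have hw0 : ∀ u y, 0 ≤ w u y := fun u y => Finset.sum_nonneg fun s _ =>
    mul_nonneg (hV0 u s) ((P.channel _).2.1 y)
  have hw1 : ∀ u, ∑ y, w u y = 1 := by
    intro u
    simp only [hw, letterChannel]
    rw [Finset.sum_comm]
    simp only [← Finset.mul_sum, P.sum_channel, mul_one, hV1]
  -- The gap is cut into four: the covering threshold has rate a + γ, the messages have rate a + 2γ,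
  -- and the decoding threshold has rate b - γ, so that covering and packing both keep an exponent
  -- γ.
  obtain ⟨γ, hγ, hgap⟩ : ∃ γ > 0, a + 2 * γ + γ ≤ b - γ :=
    ⟨(b - a) / 4, by linarith, by linarith⟩
  obtain ⟨C₁, h1⟩ := infoDensity_upper hq0 hq1 hV0 hV1 hp hγ
  obtain ⟨C₂, h2⟩ := infoDensity_lower hq0 hq1 hw0 hw1 (p := r) (fun y => rfl) hγ
  obtain ⟨C₃, h3⟩ := distortionError_le P hq0 hq1 hV0 hV1 f g hη hDe hDr
  let M : ℕ → ℕ := fun n => ⌈exp (n * (a + 2 * γ))⌉₊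
  -- A logarithmic tag length makes the guessing probability at most 2/(n+1), while the number of
  -- tags stays at most n + 1.
  let τ : ℕ → ℕ := fun n => Nat.log 2 (n + 1)
  have hM : ∀ n, M n ≠ 0 := fun n => (Nat.ceil_pos.2 (exp_pos _)).ne'
  have hS := fun n : ℕ => exists_scheme P (q := fun u : Fin n → U => ∏ i, q (u i))
    (fun u => Finset.prod_nonneg fun i _ => hq0 _)
    (sum_pi (f := fun _ => q) fun _ => hq1) (V := nfold V) (fun u s => nfold_nonneg hV0 u s)
    (fun u => sum_nfold hV1 u) (sum_pi_mul_nfold hp) (fun u s i => f (u i) (s i))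
    (fun u i => g (u i)) (M := M n) (τ := τ n) (hM n) (exp_pos (n * (a + γ))).le
    (exp_pos (n * (b - γ))) (De + η) (Dr + η)
  choose A hA1 hA2 hA3 using hS
  -- The terms bound, in order, the three Chebyshev estimates, the covering error, the number of
  -- wrong codewords divided by the threshold, and the tag guess.
  let β : ℕ → ℝ := fun n => (2 * C₁ + C₂ + C₃) / n + exp (-(γ / 2)) ^ n +
    (4 * (n * exp (-γ) ^ n) + 4 * exp (-γ) ^ n) + 2 / ((n : ℝ) + 1)
  have hexp : ∀ {c : ℝ}, 0 < c → exp (-c) < 1 := fun hc => exp_lt_one_iff.2 (by linarith)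
  have hβ : Tendsto β atTop (𝓝 0) := by
    have t1 := tendsto_const_div_atTop_nhds_zero_nat (2 * C₁ + C₂ + C₃)
    have t2 := tendsto_pow_atTop_nhds_zero_of_lt_one (exp_pos (-(γ / 2))).le (hexp (half_pos hγ))
    have t3 := (tendsto_self_mul_const_pow_of_lt_one (exp_pos (-γ)).le (hexp hγ)).const_mul 4
    have t4 := (tendsto_pow_atTop_nhds_zero_of_lt_one (exp_pos (-γ)).le (hexp hγ)).const_mul 4
    have t5 := (tendsto_one_div_add_atTop_nhds_zero_nat (𝕜 := ℝ)).const_mul 2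
    have := ((t1.add t2).add (t3.add t4)).add t5
    simpa only [β, mul_zero, add_zero, mul_one_div] using this
  have hbound : ∀ n : ℕ, n ≠ 0 → codingBound P (fun u : Fin n → U => ∏ i, q (u i)) (nfold V)
      (fun u s i => f (u i) (s i)) (fun u i => g (u i)) (M n) (τ n) (exp (n * (a + γ)))
      (exp (n * (b - γ))) (De + η) (Dr + η) + 1 / 2 ^ τ n ≤ β n := by
    intro n hn
    have hn' : (0 : ℝ) < n := by positivity
    have hM0 : (0 : ℝ) < M n := by exact_mod_cast Nat.pos_of_ne_zero (hM n)
    have b1 := h1 n hn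
    have b2 := h2 n hn
    have b3 := h3 n hn
    have b4 : √(exp (n * (a + γ)) / M n) ≤ exp (-(γ / 2)) ^ n := by
      rw [← exp_nat_mul]
      refine sqrt_le_iff.2 ⟨(exp_pos _).le, ?_⟩
      rw [div_le_iff₀ hM0, ← exp_nat_mul]
      calc exp (n * (a + γ)) = exp ((2 : ℕ) * (n * (-(γ / 2)))) * exp (n * (a + 2 * γ)) := by
            rw [← exp_add]; congr 1; push_cast; ring
        _ ≤ _ := mul_le_mul_of_nonneg_left (Nat.le_ceil _) (exp_pos _).le
    have hτ : (2 : ℝ) ^ τ n ≤ n + 1 := by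
      exact_mod_cast Nat.pow_log_le_self 2 (Nat.succ_ne_zero n)
    have hτ' : ((n : ℝ) + 1) < 2 ^ (τ n + 1) := by
      exact_mod_cast Nat.lt_pow_succ_log_self one_lt_two (n + 1)
    have b5 : (M n : ℝ) * 2 ^ τ n / exp (n * (b - γ)) ≤
        4 * (n * exp (-γ) ^ n) + 4 * exp (-γ) ^ n := by
      -- Nonnegativity of the rate a makes the exponential at least one, so rounding up at most
      -- doubles it.
      have e1 : (M n : ℝ) ≤ 2 * exp (n * (a + 2 * γ)) := by
        have := (Nat.ceil_lt_add_one (exp_pos (n * (a + 2 * γ))).le).le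
        have h1 : 1 ≤ exp (n * (a + 2 * γ)) := one_le_exp (by positivity)
        have h2 : (M n : ℝ) ≤ exp (n * (a + 2 * γ)) + 1 := this
        linarith
      rw [div_le_iff₀ (exp_pos _), ← exp_nat_mul]
      have e2 : exp (n * (a + 2 * γ)) ≤ exp (n * -γ) * exp (n * (b - γ)) := by
        rw [← exp_add]
        refine exp_le_exp.2 ?_
        nlinarith
      calc (M n : ℝ) * 2 ^ τ n ≤ (2 * exp (n * (a + 2 * γ))) * (n + 1) := by gcongr
        _ ≤ (2 * (exp (n * -γ) * exp (n * (b - γ)))) * (n + 1) := by gcongr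
        _ ≤ _ := by
          have : 0 ≤ (exp (n * -γ) * exp (n * (b - γ))) * (n + 1) := by positivity
          nlinarith
    have b6 : (1 : ℝ) / 2 ^ τ n ≤ 2 / ((n : ℝ) + 1) := by
      rw [div_le_div_iff₀ (by positivity) (by positivity)]
      rw [pow_succ] at hτ'
      linarith
    have e0 : ∀ y : Fin n → Y, ∑ u : Fin n → U, (∏ i, q (u i)) * nfold w u y = ∏ i, r (y i) :=
      sum_pi_mul_nfold (fun y => rfl)
    rw [← ha] at b1
    rw [← hb] at b2
    simp only [codingBound, codeChannel_nfold, ← hw, e0]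
    have e : (2 * C₁ + C₂ + C₃) / n = 2 * (C₁ / n) + C₂ / n + C₃ / n := by ring
    simp only [β, e]
    linarith
  refine Achieves.of_bound hβ A ?_ ?_ ?_
  · filter_upwards [eventually_ne_atTop 0] with n hn W
    exact (hA1 n W).trans (hbound n hn)
  · filter_upwards [eventually_ne_atTop 0] with n hn
    refine (hA2 n).trans (le_trans ?_ (hbound n hn))
    exact le_add_of_nonneg_right (by positivity)
  · filter_upwards [eventually_ne_atTop 0] with n hn
    refine (hA3 n).trans (le_trans ?_ (hbound n hn))
    exact le_add_of_nonneg_right (by positivity)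

end Achievability

/-! ### Achievability on the boundary -/

section Boundary

variable {S X Y U : Type*} [Fintype S] [Fintype X] [Fintype Y] [Fintype U]

theorem pairMean_infoDensity {q : U → ℝ} (hq0 : ∀ u, 0 ≤ q u) (hq1 : ∑ u, q u = 1)
    {V : U → S → ℝ} (hV0 : ∀ u s, 0 ≤ V u s) (hV1 : ∀ u, ∑ s, V u s = 1) {p : S → ℝ}
    (hp : ∀ s, ∑ u, q u * V u s = p s) :
    pairMean q V (infoDensity V p) = ent p - ∑ u, q u * ent (V u) := by
  have key : ∀ u s, q u * V u s * infoDensity V p u s =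
      q u * V u s * (-log (p s)) - q u * negMulLog (V u s) := by
    intro u s
    rcases (mul_nonneg (hq0 u) (hV0 u s)).eq_or_lt with h | h
    · rcases mul_eq_zero.1 h.symm with h0 | h0 <;> simp [h0]
    · have hV : V u s ≠ 0 := fun h0 => by simp [h0] at h
      have hps : p s ≠ 0 := by
        rw [← hp]
        exact (lt_of_lt_of_le h (Finset.single_le_sum (f := fun u => q u * V u s)
          (fun u _ => mul_nonneg (hq0 u) (hV0 u s)) (Finset.mem_univ u))).ne'
      rw [infoDensity, log_div hV hps, negMulLog]
      ring
  have hp1 : ∑ s, p s = 1 := by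
    simp only [← hp]
    rw [Finset.sum_comm]
    simp only [← Finset.mul_sum, hV1, mul_one, hq1]
  simp only [pairMean, key, Finset.sum_sub_distrib, ← Finset.mul_sum]
  rw [ent_of_sum_eq_one hp1]
  congr 1
  · rw [Finset.sum_comm]
    simp only [← Finset.sum_mul, hp, negMulLog]
    exact Finset.sum_congr rfl fun s _ => by ring
  · exact Finset.sum_congr rfl fun u _ => by rw [ent_of_sum_eq_one (hV1 u)]

/-- Conditioning reduces entropy. -/
theorem sum_mul_ent_le {q : U → ℝ} (hq0 : ∀ u, 0 ≤ q u) {V : U → S → ℝ} (hV0 : ∀ u s, 0 ≤ V u s)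
    {p : S → ℝ} (hp : ∀ s, ∑ u, q u * V u s = p s) : ∑ u, q u * ent (V u) ≤ ent p := by
  have := sum_ent_le_ent_sum (v := fun u s => q u * V u s) fun u s => mul_nonneg (hq0 u) (hV0 u s)
  simpa only [ent_smul, hp] using this

/-- If conditioning does not reduce entropy, the variables are independent. -/
theorem mul_eq_mul_of_ent_le {q : U → ℝ} (hq0 : ∀ u, 0 ≤ q u) (hq1 : ∑ u, q u = 1)
    {V : U → S → ℝ} (hV0 : ∀ u s, 0 ≤ V u s) (hV1 : ∀ u, ∑ s, V u s = 1) {p : S → ℝ}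
    (hp : ∀ s, ∑ u, q u * V u s = p s) (h : ent p ≤ ∑ u, q u * ent (V u)) (u : U) (s : S) :
    q u * V u s = q u * p s := by
  have h0 : ∀ u s, 0 ≤ q u * V u s := fun u s => mul_nonneg (hq0 u) (hV0 u s)
  have h1 : ∑ u, ∑ s, q u * V u s = 1 := by simp only [← Finset.mul_sum, hV1, mul_one, hq1]
  have hI := mutualInfo_eq_ent h0 h1
  simp only [ent_smul, hp] at hI
  have h2 : mutualInfo (fun u s => q u * V u s) ≤ 0 := by
    have : 0 < log 2 := log_pos one_lt_two
    by_contra hc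
    have := mul_pos (not_le.1 hc) this
    linarith
  have := eq_mul_of_mutualInfo_nonpos h0 h1 h2 u s
  simpa only [← Finset.mul_sum, hV1, mul_one, hp] using this

theorem letterChannel_nonneg (P : Problem S X Y) {V : U → S → ℝ} (hV0 : ∀ u s, 0 ≤ V u s)
    (f : U → S → X) (u : U) (y : Y) : 0 ≤ letterChannel P V f u y :=
  Finset.sum_nonneg fun s _ => mul_nonneg (hV0 u s) ((P.channel _).2.1 y)

theorem sum_letterChannel (P : Problem S X Y) {V : U → S → ℝ} (hV1 : ∀ u, ∑ s, V u s = 1)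
    (f : U → S → X) (u : U) : ∑ y, letterChannel P V f u y = 1 := by
  simp only [letterChannel]
  rw [Finset.sum_comm]
  simp only [← Finset.mul_sum, P.sum_channel, mul_one, hV1]

theorem Problem.achieves_of_ent_gap (P : Problem S X Y) {q : U → ℝ} (hq0 : ∀ u, 0 ≤ q u)
    (hq1 : ∑ u, q u = 1) {V : U → S → ℝ} (hV0 : ∀ u s, 0 ≤ V u s) (hV1 : ∀ u, ∑ s, V u s = 1)
    (hp : ∀ s, ∑ u, q u * V u s = P.source s) (f : U → S → X) (g : U → S)
    (hI : ent (fun s => P.source s) - ∑ u, q u * ent (V u) <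
      ent (fun y => ∑ u, q u * letterChannel P V f u y) -
        ∑ u, q u * ent (letterChannel P V f u)) {De Dr η : ℝ} (hη : 0 < η)
    (hDe : pairMean q V (fun u s => (P.de s (f u s) : ℝ)) ≤ De)
    (hDr : pairMean q V (fun u s => (P.dr s (g u) : ℝ)) ≤ Dr) :
    P.Achieves (De + η) (Dr + η) := by
  have e1 := pairMean_infoDensity hq0 hq1 hV0 hV1 hp
  have e2 := pairMean_infoDensity hq0 hq1 (letterChannel_nonneg P hV0 f)
    (sum_letterChannel P hV1 f) (p := fun y => ∑ u, q u * letterChannel P V f u y) fun y => rfl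
  refine P.achieves_of_gap hq0 hq1 hV0 hV1 hp f g ?_ ?_ hη hDe hDr
  · have := sum_mul_ent_le hq0 hV0 hp
    rw [e1]
    linarith
  · rw [e1, e2]
    exact hI

/-- Codewords that are independent of the source need no authentication: a codebook with a
single word suffices. -/
theorem Problem.achieves_of_independent (P : Problem S X Y) {q : U → ℝ} (hq0 : ∀ u, 0 ≤ q u)
    (hq1 : ∑ u, q u = 1) (f : U → S → X) (g : U → S) {De Dr η : ℝ} (hη : 0 < η)
    (hDe : pairMean q (fun _ s => P.source s) (fun u s => (P.de s (f u s) : ℝ)) ≤ De)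
    (hDr : pairMean q (fun _ s => P.source s) (fun u s => (P.dr s (g u) : ℝ)) ≤ Dr) :
    P.Achieves (De + η) (Dr + η) := by
  classical
  obtain ⟨C, hC⟩ := distortionError_le P hq0 hq1 (V := fun _ s => P.source s)
    (fun _ s => P.source.2.1 s) (fun _ => P.sum_source) f g hη hDe hDr
  -- Since the source is independent of the codeword, some fixed codeword does at least as well as
  -- the random one. The value at n = 0 is irrelevant.
  have hex : ∀ n : ℕ, ∃ u : Fin n → U, n ≠ 0 → distortionError P (nfold fun (_ : U) s => P.source s)
      (fun u s i => f (u i) (s i)) (fun u i => g (u i)) (De + η) (Dr + η) u ≤ C / n := by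
    intro n
    by_cases hn : n = 0
    · subst hn
      exact ⟨Fin.elim0, fun h => absurd rfl h⟩
    · obtain ⟨u, hu⟩ := exists_le_of_average_le
        (fun u => Finset.prod_nonneg fun i _ => hq0 (u i))
        (sum_pi (f := fun _ => q) fun _ => hq1) (hC n hn)
      exact ⟨u, fun _ => hu⟩
  choose u hu using hex
  -- No key is used and the decoder ignores the channel: it always outputs the word that is also
  -- declared authentic, so an attack cannot succeed.
  let A : (n : ℕ) → Scheme S X Y n := fun n =>
    Scheme.ofIndex 0 (fun _ _ => stdSimplex.vertex ()) (fun _ s _ i => f (u n i) (s i))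
      (fun _ _ i => g (u n i)) (fun _ _ => some fun i => g (u n i))
  have hA : ∀ n (W : BlockChannel X Y n) E, (A n).prob P W E =
      ∑ s, (∏ i, P.source (s i)) * ∑ y, W (fun i => f (u n i) (s i)) y *
        if E s (fun i => f (u n i) (s i)) (fun i => g (u n i)) y (some fun i => g (u n i))
          then 1 else 0 := by
    intro n W E
    rw [Scheme.prob_ofIndex]
    simp
  have hle : ∀ n (W : BlockChannel X Y n) E, n ≠ 0 →
      (∀ s y, E s (fun i => f (u n i) (s i)) (fun i => g (u n i)) y (some fun i => g (u n i)) →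
        (1 / (n : ℝ)) * ∑ i, (P.de (s i) (f (u n i) (s i)) : ℝ) > De + η ∨
          (1 / (n : ℝ)) * ∑ i, (P.dr (s i) (g (u n i)) : ℝ) > Dr + η) →
      (A n).prob P W E ≤ C / n := by
    intro n W E hn hE
    refine le_trans ?_ (hu n hn)
    rw [hA, distortionError]
    refine Finset.sum_le_sum fun s _ => ?_
    refine mul_le_mul_of_nonneg_left ?_ (Finset.prod_nonneg fun i _ => P.source.2.1 _)
    have h0 : ∀ y, 0 ≤ W (fun i => f (u n i) (s i)) y := (W _).2.1
    split_ifs with hbad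
    · refine le_of_le_of_eq (Finset.sum_le_sum fun y _ => ?_)
        (W fun i => f (u n i) (s i)).2.2
      refine mul_le_of_le_one_right (h0 y) ?_
      split_ifs <;> norm_num
    · refine (Finset.sum_eq_zero fun y _ => ?_).le
      rw [if_neg fun h => hbad (hE s y h), mul_zero]
  refine Achieves.of_bound (tendsto_const_div_atTop_nhds_zero_nat C) A ?_ ?_ ?_
  · filter_upwards [eventually_ne_atTop 0] with n hn W
    exact hle n W _ hn fun s y h => absurd rfl h.2
  · filter_upwards [eventually_ne_atTop 0] with n hn
    exact hle n _ _ hn fun s y h => Or.inl h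
  · filter_upwards [eventually_ne_atTop 0] with n hn
    refine hle n _ _ hn fun s y h => ?_
    rcases h with h | ⟨t, ht, h⟩
    · exact absurd h (by simp)
    · obtain rfl := Option.some.inj ht
      exact Or.inr h

theorem pairMean_nonneg {q : U → ℝ} (hq0 : ∀ u, 0 ≤ q u) {V : U → S → ℝ}
    (hV0 : ∀ u s, 0 ≤ V u s) (h : U → S → ℝ≥0) : 0 ≤ pairMean q V fun u s => (h u s : ℝ) :=
  Finset.sum_nonneg fun u _ => Finset.sum_nonneg fun s _ =>
    mul_nonneg (mul_nonneg (hq0 u) (hV0 u s)) (h u s).2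

theorem Problem.mem_region_of_forall_pos {P : Problem S X Y} {De Dr : ℝ}
    (h : ∀ η > 0, P.Achieves (De + η) (Dr + η)) : (De, Dr) ∈ P.region := by
  rw [region, Metric.mem_closure_iff]
  intro ε hε
  refine ⟨(De + ε / 2, Dr + ε / 2), h _ (half_pos hε), ?_⟩
  rw [Prod.dist_eq]
  simp only [Real.dist_eq]
  rw [sub_add_cancel_left, sub_add_cancel_left, max_self, abs_neg, abs_of_pos (half_pos hε)]
  exact half_lt_self hε

/-- Random coding needs a strict gap, and the region is closed. A small admixture of
source-independent uniform input opens the gap at a vanishing cost in distortion, unless the channel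
is useless. -/
theorem Problem.mem_region_of_ent_le (P : Problem S X Y) {q : U → ℝ} (hq0 : ∀ u, 0 ≤ q u)
    (hq1 : ∑ u, q u = 1) {V : U → S → ℝ} (hV0 : ∀ u s, 0 ≤ V u s) (hV1 : ∀ u, ∑ s, V u s = 1)
    (hp : ∀ s, ∑ u, q u * V u s = P.source s) (f : U → S → X) (g : U → S)
    (hI : ent (fun s => P.source s) - ∑ u, q u * ent (V u) ≤
      ent (fun y => ∑ u, q u * letterChannel P V f u y) -
        ∑ u, q u * ent (letterChannel P V f u)) {De Dr : ℝ}
    (hDe : pairMean q V (fun u s => (P.de s (f u s) : ℝ)) ≤ De)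
    (hDr : pairMean q V (fun u s => (P.dr s (g u) : ℝ)) ≤ Dr) :
    (De, Dr) ∈ P.region := by
  refine mem_region_of_forall_pos fun η hη => ?_
  obtain ⟨s₀⟩ : Nonempty S := by
    by_contra h
    rw [not_nonempty_iff] at h
    simpa using P.sum_source
  obtain ⟨u₀⟩ : Nonempty U := by
    by_contra h
    rw [not_nonempty_iff] at h
    simp at hq1
  have hX : Nonempty X := ⟨f u₀ s₀⟩
  set m : ℝ := 1 / Fintype.card X with hm
  have hm0 : 0 < m := by rw [hm]; positivity
  have hm1 : ∑ _x : X, m = 1 := by simp [hm]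
  set W : Y → ℝ := fun y => ∑ x, m * P.channel x y with hW
  -- The dichotomy is whether uniform input carries zero information. If so, all rows of the channel
  -- coincide, I(U;Y) = 0, and the hypothesis forces U to be independent of the source.
  by_cases hc : ent W ≤ ∑ x, m * ent (P.channel x)
  · have hconst : ∀ x y, P.channel x y = W y := fun x y => mul_left_cancel₀ hm0.ne' <|
      mul_eq_mul_of_ent_le (q := fun _ => m) (V := fun x y => P.channel x y) (fun _ => hm0.le) hm1
        (fun x y => (P.channel x).2.1 y) P.sum_channel (fun _ => rfl) hc x y
    have hw : ∀ u, letterChannel P V f u = W := by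
      intro u
      funext y
      simp only [letterChannel, hconst, ← Finset.sum_mul, hV1, one_mul]
    simp only [hw, ← Finset.sum_mul, hq1, one_mul] at hI
    have hind := mul_eq_mul_of_ent_le hq0 hq1 hV0 hV1 hp (by linarith)
    refine P.achieves_of_independent hq0 hq1 f g hη ?_ ?_
    · simpa only [pairMean, hind] using hDe
    · simpa only [pairMean, hind] using hDr
  · rw [not_le] at hc
    set K₁ := pairMean (fun _ : X => m) (fun _ s => P.source s) (fun x s => (P.de s x : ℝ)) with hK₁
    set K₂ := pairMean (fun _ : X => m) (fun _ s => P.source s) (fun _ s => (P.dr s s₀ : ℝ)) with hK₂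
    have hK₁0 : 0 ≤ K₁ := pairMean_nonneg (fun _ => hm0.le) (fun _ s => P.source.2.1 s) _
    have hK₂0 : 0 ≤ K₂ := pairMean_nonneg (fun _ => hm0.le) (fun _ s => P.source.2.1 s) _
    -- K₁ and K₂ are the distortions of the admixture, so this weight adds at most η/2 to either
    -- one.
    obtain ⟨δ, hδ0, hδ1, hδ⟩ : ∃ δ : ℝ, 0 < δ ∧ δ < 1 ∧ δ * (K₁ + K₂ + 1) ≤ η / 2 := by
      have hK : 0 < K₁ + K₂ + 1 := by linarith
      refine ⟨min (1 / 2) (η / 2 / (K₁ + K₂ + 1)), lt_min one_half_pos (by positivity),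
        lt_of_le_of_lt (min_le_left _ _) one_half_lt_one, ?_⟩
      exact (le_div_iff₀ hK).1 (min_le_right _ _)
    have hδ' : 0 < 1 - δ := by linarith
    -- Time sharing with a revealed switch: on the new letters the source keeps its own law, the
    -- input is the letter itself, and the reconstruction is the arbitrary constant `s₀`.
    let q' : U ⊕ X → ℝ := Sum.elim (fun u => (1 - δ) * q u) fun _ => δ * m
    let V' : U ⊕ X → S → ℝ := Sum.elim V fun _ s => P.source s
    let f' : U ⊕ X → S → X := Sum.elim f fun x _ => x
    let g' : U ⊕ X → S := Sum.elim g fun _ => s₀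
    have hsum : ∀ (F : U → ℝ) (G : X → ℝ) (H : U ⊕ X → ℝ), (∀ u, H (Sum.inl u) = F u) →
        (∀ x, H (Sum.inr x) = G x) →
        ∑ z, q' z * H z = (1 - δ) * ∑ u, q u * F u + δ * ∑ x, m * G x := by
      intro F G H h1 h2
      simp only [Fintype.sum_sum_type, h1, h2, q', Sum.elim_inl, Sum.elim_inr, mul_assoc,
        ← Finset.mul_sum]
    have hw' : ∀ x, letterChannel P V' f' (Sum.inr x) = P.channel x := by
      intro x
      funext y
      simp only [letterChannel, V', f', Sum.elim_inr, ← Finset.sum_mul, P.sum_source, one_mul]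
    have hmean : ∀ h : U ⊕ X → S → ℝ, pairMean q' V' h = (1 - δ) *
        pairMean q V (fun u => h (Sum.inl u)) +
        δ * pairMean (fun _ : X => m) (fun _ s => P.source s) (fun x => h (Sum.inr x)) := by
      intro h
      simp only [pairMean, mul_assoc, ← Finset.mul_sum]
      rw [hsum (fun u => ∑ s, V u s * h (Sum.inl u) s)
        (fun x => ∑ s, P.source s * h (Sum.inr x) s) (fun z => ∑ s, V' z s * h z s)
        (fun _ => rfl) fun _ => rfl, ← Finset.mul_sum]
    have hq0' : ∀ z, 0 ≤ q' z := by
      rintro (u | x)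
      · exact mul_nonneg hδ'.le (hq0 u)
      · exact mul_nonneg hδ0.le hm0.le
    have hq1' : ∑ z, q' z = 1 := by
      have := hsum (fun _ => 1) (fun _ => 1) (fun _ => 1) (fun _ => rfl) fun _ => rfl
      simp only [mul_one, hq1, hm1] at this
      rw [this]
      ring
    have hV0' : ∀ z s, 0 ≤ V' z s := by
      rintro (u | x) s
      · exact hV0 u s
      · exact P.source.2.1 s
    have hV1' : ∀ z, ∑ s, V' z s = 1 := by
      rintro (u | x)
      · exact hV1 u
      · exact P.sum_source
    have hp' : ∀ s, ∑ z, q' z * V' z s = P.source s := by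
      intro s
      rw [hsum (fun u => V u s) (fun _ => P.source s) _ (fun _ => rfl) fun _ => rfl, hp,
        ← Finset.sum_mul, hm1]
      ring
    have hr' : ∀ y, ∑ z, q' z * letterChannel P V' f' z y =
        (1 - δ) * (∑ u, q u * letterChannel P V f u y) + δ * W y := fun y =>
      hsum _ (fun x => P.channel x y) _ (fun _ => rfl) fun x => congrFun (hw' x) y
    -- Shrinking by 1 - δ keeps a quantity below its bound only because distortions are nonnegative.
    have hcod : ∀ d : ℝ, ∀ D : ℝ, 0 ≤ d → d ≤ D → (1 - δ) * d ≤ D := fun d D h1 h2 => by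
      nlinarith
    have hgap := P.achieves_of_ent_gap hq0' hq1' hV0' hV1' hp' f' g' (De := De + η / 2)
      (Dr := Dr + η / 2) (η := η / 2) ?_ (half_pos hη) ?_ ?_
    · rwa [add_assoc, add_assoc, add_halves] at hgap
    · rw [hsum (fun u => ent (V u)) (fun _ => ent fun s => P.source s) (fun z => ent (V' z))
          (fun _ => rfl) fun _ => rfl,
        hsum (fun u => ent (letterChannel P V f u)) (fun x => ent (P.channel x))
          (fun z => ent (letterChannel P V' f' z)) (fun _ => rfl) fun x => by rw [hw' x],
        ← Finset.sum_mul, hm1, one_mul]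
      simp only [hr']
      -- The new letters carry no information about the source, so I(S;U) is only scaled by 1 - δ.
      -- Concavity of the output entropy gives at least the mixture of the two output informations,
      -- and the second is strictly positive.
      have hadd := ent_add_le
        (v := fun y => (1 - δ) * (∑ u, q u * letterChannel P V f u y)) (w := fun y => δ * W y)
        (fun y => mul_nonneg hδ'.le (Finset.sum_nonneg fun u _ => mul_nonneg (hq0 u)
          (letterChannel_nonneg P hV0 f u y)))
        (fun y => mul_nonneg hδ0.le (Finset.sum_nonneg fun x _ => mul_nonneg hm0.le
          ((P.channel x).2.1 y)))
      rw [ent_smul, ent_smul] at hadd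
      have h1 := mul_le_mul_of_nonneg_left hI hδ'.le
      have h2 := mul_lt_mul_of_pos_left hc hδ0
      linarith
    · rw [hmean]
      have := hcod _ _ (pairMean_nonneg hq0 hV0 _) hDe
      have h2 : 0 ≤ δ * K₂ := by positivity
      refine add_le_add this ?_
      change δ * K₁ ≤ _
      linarith
    · rw [hmean]
      have := hcod _ _ (pairMean_nonneg hq0 hV0 _) hDr
      have h2 : 0 ≤ δ * K₁ := by positivity
      refine add_le_add this ?_
      change δ * K₂ ≤ _
      linarith

/-- Random coding works with the reversed factorisation p(u) p(s|u), so the given p(s) p(u|s) is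
inverted by Bayes' rule and the informations are reexpressed through entropies. -/
theorem Problem.DeterministicCondition.mem_region {P : Problem S X Y} {De Dr : ℝ}
    (h : P.DeterministicCondition De Dr U) : (De, Dr) ∈ P.region := by
  classical
  obtain ⟨pU, f, g, hI, hDe, hDr⟩ := h
  have hne : Nonempty S := by
    by_contra h
    rw [not_nonempty_iff] at h
    simpa using P.sum_source
  have h0 : ∀ u s, 0 ≤ P.source s * pU s u := fun u s =>
    mul_nonneg (P.source.2.1 s) ((pU s).2.1 u)
  choose V hV using fun u => exists_stdSimplex_smul (h0 u)
  set q : U → ℝ := fun u => ∑ s, P.source s * pU s u with hq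
  have hqV : ∀ u s, P.source s * pU s u = q u * V u s := fun u s => (hV u s).symm
  have hq1 : ∑ u, q u = 1 := by
    have : ∀ s, ∑ u, pU s u = 1 := fun s => (pU s).2.2
    simp only [hq]
    rw [Finset.sum_comm]
    simp only [← Finset.mul_sum, this, mul_one, P.sum_source]
  have hp : ∀ s, ∑ u, q u * V u s = P.source s := by
    intro s
    have : ∑ u, pU s u = 1 := (pU s).2.2
    simp only [← hqV, ← Finset.mul_sum, this, mul_one]
  have hsrc : ∀ u, srcLaw (P.slice pU (fun u s => stdSimplex.vertex (f u s)) u) =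
      fun s => q u * V u s := fun u => by
    funext s
    rw [P.srcLaw_slice, hqV]
  have hout : ∀ u, outLaw (fun x y => P.channel x y)
      (P.slice pU (fun u s => stdSimplex.vertex (f u s)) u) =
      fun y => q u * letterChannel P (fun u s => V u s) f u y := fun u => by
    funext y
    simp only [outLaw, P.slice_vertex, letterChannel, hqV, Finset.mul_sum]
    simp [mul_assoc]
  have e1 := P.infoSU_eq pU fun u s => stdSimplex.vertex (f u s)
  have e2 := P.infoUY_eq pU fun u s => stdSimplex.vertex (f u s)
  simp only [hsrc, hout, ent_smul] at e1 e2
  refine P.mem_region_of_ent_le (q := q) (V := fun u s => V u s)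
    (fun u => Finset.sum_nonneg fun s _ => h0 u s) hq1 (fun u s => (V u).2.1 s)
    (fun u => (V u).2.2) hp f g ?_ ?_ ?_
  · rw [← e1, ← e2]
    exact mul_le_mul_of_nonneg_right (by linarith) (log_pos one_lt_two).le
  · rw [P.expect_vertex] at hDe
    simpa only [pairMean, hqV] using hDe
  · rw [P.expect_vertex] at hDr
    simpa only [pairMean, hqV] using hDr

end Boundary

end Authentication

end

/-! ### The equivalences. -/

theorem theorem1 {S X Y : Type*} [Fintype S] [Fintype X] [Fintype Y] (P : Authentication.Problem S X Y)
    (De Dr : ℝ) :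
    List.TFAE [
      (De, Dr) ∈ P.region,
      ∃ (U : Type) (_ : Fintype U), P.DeterministicCondition De Dr U,
      ∃ (U : Type) (_ : Fintype U),
        Fintype.card U ≤
          (Fintype.card S + Fintype.card X + 3) * Fintype.card S * Fintype.card X ∧
        P.DeterministicCondition De Dr U,
      ∃ (U : Type) (_ : Fintype U), P.RandomizedCondition De Dr U,
      ∃ (U : Type) (_ : Fintype U),
        Fintype.card U ≤ Fintype.card S + Fintype.card X + 3 ∧
        P.RandomizedCondition De Dr U] := by
  -- The two implications into the randomized condition with bounded alphabet, from the region and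
  -- from an arbitrary alphabet, both pass through `Problem.Feasible`, where Carathéodory's theorem
  -- supplies the bound. The deterministic bound is obtained by attaching a function index to that
  -- alphabet.
  tfae_have 1 → 5 := fun h =>
    ⟨_, inferInstance, by rw [Fintype.card_fin], (P.feasible_of_mem_region h).randomized⟩
  tfae_have 5 → 3 := fun ⟨U, _, hU, h⟩ => by
    refine ⟨_, inferInstance, ?_, h.deterministic⟩
    rw [Fintype.card_prod, Fintype.card_fin, mul_assoc]
    exact Nat.mul_le_mul_right _ hU
  tfae_have 3 → 2 := fun ⟨U, i, _, h⟩ => ⟨U, i, h⟩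
  tfae_have 2 → 1 := fun ⟨U, _, h⟩ => h.mem_region
  tfae_have 2 → 4 := fun ⟨U, i, h⟩ => ⟨U, i, h.randomized⟩
  tfae_have 4 → 5 := fun ⟨_, _, h⟩ =>
    ⟨_, inferInstance, by rw [Fintype.card_fin], h.feasible.randomized⟩
  tfae_have 5 → 4 := fun ⟨U, i, _, h⟩ => ⟨U, i, h⟩
  tfae_finish
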